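/- Let $f:\mathbb{R}\to\mathbb{R}$ be continuous with $f(0)=0$, $f'(0)$ existing and $f'(0)=1$, $f$ strictly concave on $(0,\infty)$ and strictly convex on $(-\infty,0)$, and suppose that for some $q\ge 2$ and constants $C_1,\dots,C_4>0$ one has $|f(u)|\le C_1+C_2|u|^{q-1}$ for all $u$, together with $f(u)u\le C_3-C_4|u|^{q}$ for all $u$ if $q>2$, and $\limsup_{u\to\pm\infty} f(u)/u\le 0$ if $q=2$. Let $a:[0,\infty)\to\mathbb{R}$ be continuous with $a(s)\ge m$ for all $s\ge0$ and some $m>0$, and let $\lambda>0$. Let $l(u)=\|u\|_{H^1_0}^r$ with $\|u\|_{H_0^1}=\|u'\|_{L^2(0,1)}$, or $l(u)=\|u\|_{L^p(0,1)}^r$, where $1\le p<\infty$ and $r>0$. Consider the nonlocal problem $$-a(l(u))\,u''=\lambda f(u)\ \text{ on }(0,1),\qquad u(0)=u(1)=0, \qquad (1)$$ and, for $d\ge0$, the local problem $$-a(d)\,u''=\lambda f(u)\ \text{ on }(0,1),\qquad u(0)=u(1)=0. \qquad (2)$$ Solutions are functions in $H^2(0,1)\cap H^1_0(0,1)$ that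 satisfy the equation in $L^2(0,1)$. For $j\ge1$ and $d\ge 0$, $u_{j,d}^{+}$ (respectively $u_{j,d}^{-}$) denotes the solution of (2) with exactly $j+1$ zeros in $[0,1]$, all simple, that is positive (respectively negative) immediately to the right of $x=0$. Put $$d_j=\sup\{d\ge 0:\ \lambda>a(e)\pi^2j^2 \text{ for all } 0\le e\le d\}\in[0,+\infty].$$ Let $k\ge 0$ be an integer with $a(0)\pi^2k^2<\lambda$. Then: 1. For every $1\le j\le k$ and each sign $\sigma\in\{+,-\}$ there is $d^{*}=d_{j}^{*,\sigma}$ with $0\le d^*<d_j$ such that a solution $u_{j,d^{*}}^{\sigma}$ of (2) exists, $l(u_{j,d^{*}}^{\sigma})=d^{*}$, and hence $u_{j,d^{*}}^{\sigma}$ is a solution of (1). 2. If $\lambda\le a(0)\pi^2(k+1)^2$ and $a(0)=\min_{s\ge0}a(s)$, then for no $j>k$ does (1) have a solution with exactly $j+1$ zeros in $[0,1]$. 3. If $N\ge k$ is the first integer such that $\lambda\le\inf_{s\ge0}\{a(s)\pi^2(N+1)^2\}$, then for no $j>N$ does (1) have a solution with exactly $j+1$ zeros in $[0,1]$. 4.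 If $l(u)=\|u\|_{H^1_0}^r$, $\lambda\le a(0)\pi^2(k+1)^2$ and $a$ is non-decreasing, then (1) has exactly $2k+1$ solutions: $0$ and $u_{j,d}^{\sigma}$ with $d=d_j^{*,\sigma}\in[0,d_j)$, for $1\le j\le k$ and $\sigma\in\{+,-\}$; moreover $d_j^{*,+}=d_j^{*,-}$ whenever $j$ is even or $f$ is odd. 5. If $l(u)=\|u\|_{L^p}^r$, $\lambda\le a(0)\pi^2(k+1)^2$, $f$ is odd and $a$ is non-decreasing, then (1) has exactly $2k+1$ solutions: $0$ and $u_{j,d}^{\pm}$ with $d=d_j^{*}\in[0,d_j)$ the same for both signs, for $1\le j\le k$. -/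

import Mathlib

open Set Filter Topology MeasureTheory

noncomputable section

/-- Conditions on the reaction term: `f` is continuous, `f 0 = 0`, `f' 0 = 1`, `f` is strictly
concave for `u > 0` and strictly convex for `u < 0`, and there are an exponent `q ≥ 2` and positive
constants for which the growth and dissipation conditions hold. -/
structure IsChafeeInfanteReaction (f : ℝ → ℝ) : Prop where
  continuous : Continuous f
  map_zero : f 0 = 0
  hasDerivAt_zero : HasDerivAt f 1 0
  strictConcaveOn : StrictConcaveOn ℝ (Ioi 0) f
  strictConvexOn : StrictConvexOn ℝ (Iio 0) f
  growth : ∃ q C₁ C₂ C₃ C₄ : ℝ, 2 ≤ q ∧ 0 < C₁ ∧ 0 < C₂ ∧ 0 < C₃ ∧ 0 < C₄ ∧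
    (∀ u : ℝ, |f u| ≤ C₁ + C₂ * |u| ^ (q - 1)) ∧
    (2 < q → ∀ u : ℝ, f u * u ≤ C₃ - C₄ * |u| ^ q) ∧
    (q = 2 → limsup (fun u : ℝ => ((f u / u : ℝ) : EReal)) atTop ≤ 0 ∧
      limsup (fun u : ℝ => ((f u / u : ℝ) : EReal)) atBot ≤ 0)

/-- Conditions on the diffusion coefficient `a : [0, ∞) → ℝ` (values at negative arguments are
irrelevant): continuous and bounded below by a positive constant. -/
def IsDiffusionCoefficient (a : ℝ → ℝ) : Prop :=
  ContinuousOn a (Ici 0) ∧ ∃ m : ℝ, 0 < m ∧ ∀ s : ℝ, 0 ≤ s → m ≤ a s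

/-- The first derivative of `u` on `[0,1]` (one-sided at the end points). -/
def derivI (u : ℝ → ℝ) : ℝ → ℝ := derivWithin u (Icc 0 1)

/-- The space `H²(0,1) ∩ H¹₀(0,1)`. An element is represented by its continuous representative,
extended by zero outside `(0,1)`, so two elements are equal iff they are equal as functions.
In one dimension, membership in `H²(0,1)` means: the function is differentiable on `[0,1]`,
its derivative is absolutely continuous, and the second derivative (which then exists almost
everywhere and is the weak second derivative) is square integrable. -/
structure MemH2H10 (u : ℝ → ℝ) : Prop where
  eq_zero : ∀ x : ℝ, x ∉ Ioo (0 : ℝ) 1 → u x = 0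
  differentiableOn : DifferentiableOn ℝ u (Icc 0 1)
  absolutelyContinuous : AbsolutelyContinuousOnInterval (derivI u) 0 1
  memLp : MemLp (deriv (derivI u)) 2 (volume.restrict (Ioo 0 1))

/-- `u ∈ H²(0,1) ∩ H¹₀(0,1)` solves `-c u'' = lam f(u)` on `(0,1)`, `u 0 = u 1 = 0`,
as an equality in `L²(0,1)`. -/
def IsStrongSolution (c lam : ℝ) (f u : ℝ → ℝ) : Prop :=
  MemH2H10 u ∧ ∀ᵐ x ∂(volume.restrict (Ioo (0 : ℝ) 1)),
    -c * deriv (derivI u) x = lam * f (u x)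

/-- The nonlocal problem `-a(l(u)) u'' = lam f(u)` on `(0,1)`, `u 0 = u 1 = 0`. -/
def IsNonlocalSolution (a : ℝ → ℝ) (l : (ℝ → ℝ) → ℝ) (lam : ℝ) (f u : ℝ → ℝ) : Prop :=
  IsStrongSolution (a (l u)) lam f u

/-- The norm `‖u'‖_{L²(0,1)}` of `H¹₀(0,1)`. -/
def h10Norm (u : ℝ → ℝ) : ℝ := Real.sqrt (∫ x in (0 : ℝ)..1, (derivI u x) ^ 2)

/-- The norm of `L^p(0,1)` for a real exponent `p`. -/
def lpNormI (p : ℝ) (u : ℝ → ℝ) : ℝ := (∫ x in (0 : ℝ)..1, |u x| ^ p) ^ (1 / p)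

/-- `l(u) = ‖u‖_{H¹₀}^r` for some `r > 0`. -/
def IsH10Functional (l : (ℝ → ℝ) → ℝ) : Prop :=
  ∃ r : ℝ, 0 < r ∧ ∀ u : ℝ → ℝ, l u = h10Norm u ^ r

/-- `l(u) = ‖u‖_{L^p}^r` for some `p ≥ 1` and `r > 0`. -/
def IsLpFunctional (l : (ℝ → ℝ) → ℝ) : Prop :=
  ∃ p r : ℝ, 1 ≤ p ∧ 0 < r ∧ ∀ u : ℝ → ℝ, l u = lpNormI p u ^ r

/-- The zeros of `u` in `[0,1]`. -/
def zerosI (u : ℝ → ℝ) : Set ℝ := {x | x ∈ Icc (0 : ℝ) 1 ∧ u x = 0}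

/-- `u = u_j^{d,σ}`: a solution of the local problem `-a(d) u'' = lam f(u)`, `u 0 = u 1 = 0`, with
exactly `j + 1` zeros in `[0,1]`, all of them simple, such that `u` has the sign `σ` to the right
of `0` (`σ = 1` for `u_j^+` and `σ = -1` for `u_j^-`). -/
structure IsBranch (a : ℝ → ℝ) (lam : ℝ) (f : ℝ → ℝ) (d : ℝ) (σ : ℤˣ) (j : ℕ)
    (u : ℝ → ℝ) : Prop where
  solution : IsStrongSolution (a d) lam f u
  ncard_zeros : (zerosI u).ncard = j + 1
  simple : ∀ x ∈ zerosI u, derivI u x ≠ 0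
  sign : ∀ᶠ x in 𝓝[>] (0 : ℝ), 0 < ((σ : ℤ) : ℝ) * u x

/-- `d_j = sup {d ≥ 0 : lam > a(e) π² j² for all 0 ≤ e ≤ d}`, possibly `+∞`. -/
def dSup (a : ℝ → ℝ) (lam : ℝ) (j : ℕ) : EReal :=
  sSup ((fun d : ℝ => (d : EReal)) ''
    {d : ℝ | 0 ≤ d ∧ ∀ e ∈ Icc 0 d, a e * Real.pi ^ 2 * (j : ℝ) ^ 2 < lam})

/-- The nonlocal problem has exactly `2k+1` solutions `0, u_1^±, …, u_k^±`, where `u_j^σ` is the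
solution `u_j^{d,σ}` of the local problem for a number `d = d σ j < d_j`; this number is the same
for both signs if `j` is even or `f` is odd. -/
def HasExactlyCascade (a : ℝ → ℝ) (l : (ℝ → ℝ) → ℝ) (lam : ℝ) (f : ℝ → ℝ) (k : ℕ) : Prop :=
  ∃ (d : ℤˣ → ℕ → ℝ) (u : ℤˣ → ℕ → ℝ → ℝ),
    (∀ σ : ℤˣ, ∀ j ∈ Finset.Icc 1 k,
      0 ≤ d σ j ∧ (d σ j : EReal) < dSup a lam j ∧
      IsBranch a lam f (d σ j) σ j (u σ j) ∧ l (u σ j) = d σ j) ∧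
    (∀ j ∈ Finset.Icc 1 k, (Even j ∨ Function.Odd f) → d 1 j = d (-1) j) ∧
    {v : ℝ → ℝ | IsNonlocalSolution a l lam f v} =
      insert 0 {v : ℝ → ℝ | ∃ σ : ℤˣ, ∃ j ∈ Finset.Icc 1 k, v = u σ j} ∧
    {v : ℝ → ℝ | IsNonlocalSolution a l lam f v}.ncard = 2 * k + 1

end

open Set Filter Topology MeasureTheory

noncomputable section

/-! An orbit of `-w'' = Φ(w)` with `w(0) = 0`, `w'(0) = S` conserves energy: `w'² + 2F(w) = S²`,
where `F` is the primitive of `Φ`. In the coordinate `y = ±√(2F(w))`, with the sign of `w`, this is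
a circle, so `y = S sin η`, `w' = S cos η`, and time runs as `dt/dη = g(S sin η)` with `g = dw/dy`.
The zeros sit at the phases `iπ`, the `j`-th one at time `T(S) = ∫₀^{jπ} g(S sin η) dη`. Scaled to
`[0,1]`, the orbit solves `-c u'' = λ f(u)` when `c T(S)² = λ`. With `L(S)` the value of `l` on the
scaled orbit, the nonlocal problem becomes the scalar equation `a(L(S)) T(S)² = λ`, and the sign of
`S` is the sign `σ`.

These coordinates need a globally Lipschitz force with the sign of its argument, so `f` is truncated
at levels `-N`, `M` with `f(-N) < 0 < f(M)`. Every solution stays between such levels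
(`IsStrongSolution.exists_bounds`), and Cauchy uniqueness identifies it with a scaled orbit
(`IsStrongSolution.eq_nodalSolution`).

Existence (`exists_branch`): `T = jπ` at `S = 0`, where the left side is below `λ`; orbits with
arbitrarily long arches exist (`HalfReaction.exists_long_arch`) and `a ≥ m`, so the left side
reaches `λ`. Stopping at the first such `S` gives `d < d_j`.

Nonexistence: `g > 1` away from `0`, so `T > jπ` and any solution with `j + 1` zeros forces `a(l(u))
π² j² < λ`.

Uniqueness: strict concavity and convexity make `g` increasing in `|y|`
(`HalfForce.energyCoordDeriv_lt`), so `T` increases strictly in `|S|`. The functional `L` is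
non-decreasing in `|S|`: for the `H¹₀` norm by its phase formula, for `L^p` and odd `f` by pointwise
comparison of scaled quarter orbits. If `a` is non-decreasing, `a(L) T²` is strictly increasing on
each ray and equals `λ` at most once. -/

/-! ### Reaction terms -/

/-- The function `u ↦ -f (-u)`, which interchanges positive and negative arguments. -/
def oddReflect (f : ℝ → ℝ) : ℝ → ℝ := fun u => -f (-u)

theorem oddReflect_oddReflect (f : ℝ → ℝ) : oddReflect (oddReflect f) = f := by
  funext u; simp [oddReflect]

theorem hasDerivAt_oddReflect {f : ℝ → ℝ} {c : ℝ} (h : HasDerivAt f c 0) :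
    HasDerivAt (oddReflect f) c 0 := by
  have h1 : HasDerivAt f c (-0) := by simpa using h
  have h2 := (h1.comp (0 : ℝ) (hasDerivAt_neg (0 : ℝ))).neg
  have h3 : -(c * -1) = c := by ring
  rw [h3] at h2
  exact h2

/-- The properties of a Chafee–Infante reaction term on `[0, ∞)`. -/
structure HalfReaction (f : ℝ → ℝ) : Prop where
  cont : Continuous f
  zero : f 0 = 0
  deriv : HasDerivAt f 1 0
  concave : ConcaveOn ℝ (Ici 0) f
  anti : ∀ u v : ℝ, 0 < u → u < v → f v * u < f u * v
  small : ∀ ε : ℝ, 0 < ε → ∃ u : ℝ, 0 < u ∧ f u ≤ ε * u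

/-- The properties of a Chafee–Infante reaction term, stated symmetrically. -/
structure Reaction (f : ℝ → ℝ) : Prop where
  pos : HalfReaction f
  neg : HalfReaction (oddReflect f)

theorem Reaction.reflect {f : ℝ → ℝ} (h : Reaction f) : Reaction (oddReflect f) :=
  ⟨h.neg, by rw [oddReflect_oddReflect]; exact h.pos⟩

/-- Both points are shifted to the right by `e > 0`, and `e → 0` by continuity. -/
theorem concaveOn_Ici_of_Ioi {f : ℝ → ℝ} (hc : Continuous f) (h : ConcaveOn ℝ (Ioi 0) f) :
    ConcaveOn ℝ (Ici 0) f := by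
  refine ⟨convex_Ici 0, fun x hx y hy s t hs ht hst => ?_⟩
  simp only [mem_Ici, smul_eq_mul] at *
  have key : ∀ e : ℝ, 0 < e → s * f (x + e) + t * f (y + e) ≤ f (s * x + t * y + e) := by
    intro e he
    have := h.2 (x := x + e) (by simp; linarith) (y := y + e) (by simp; linarith) hs ht hst
    simp only [smul_eq_mul] at this
    refine this.trans (le_of_eq ?_)
    congr 1
    linear_combination e * hst
  have h1 : Tendsto (fun e => s * f (x + e) + t * f (y + e)) (𝓝[>] 0)
      (𝓝 (s * f (x + 0) + t * f (y + 0))) :=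
    ((by fun_prop : Continuous fun e => s * f (x + e) + t * f (y + e)).tendsto 0).mono_left
      nhdsWithin_le_nhds
  have h2 : Tendsto (fun e => f (s * x + t * y + e)) (𝓝[>] 0) (𝓝 (f (s * x + t * y + 0))) :=
    ((by fun_prop : Continuous fun e => f (s * x + t * y + e)).tendsto 0).mono_left
      nhdsWithin_le_nhds
  simpa using le_of_tendsto_of_tendsto h1 h2
    (eventually_nhdsWithin_of_forall fun e he => key e he)

theorem halfReaction_of_strictConcaveOn {f : ℝ → ℝ} (hc : Continuous f) (h0 : f 0 = 0)
    (hd : HasDerivAt f 1 0) (hs : StrictConcaveOn ℝ (Ioi 0) f)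
    (hsmall : ∀ ε : ℝ, 0 < ε → ∃ u : ℝ, 0 < u ∧ f u ≤ ε * u) : HalfReaction f := by
  have hcon := concaveOn_Ici_of_Ioi hc hs.concaveOn
  refine ⟨hc, h0, hd, hcon, fun u v hu huv => ?_, hsmall⟩
  have hv : 0 < v := hu.trans huv
  -- Strict concavity is not available at the end point `0`, so `u / 2` is inserted: strict
  -- comparison on `u/2, u, v`, weak comparison on `0, u/2, u`.
  have h1 := hs.slope_anti_adjacent (x := u / 2) (y := u) (z := v) (by simp; linarith) (by simpa)
    (by linarith) huv
  have h2 := hcon.slope_anti_adjacent (x := 0) (y := u / 2) (z := u) (by simp) (by simp; linarith)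
    (by linarith) (by linarith)
  rw [div_lt_div_iff₀ (by linarith) (by linarith)] at h1
  rw [div_le_div_iff₀ (by linarith) (by linarith), h0] at h2
  have h3 : f u - f (u / 2) ≤ f (u / 2) := by
    have : 0 < u / 2 := by linarith
    nlinarith
  have h4 : f u - f (u / 2) ≤ f u / 2 := by linarith
  have h5 : (f u - f (u / 2)) * (v - u) ≤ f u / 2 * (v - u) :=
    mul_le_mul_of_nonneg_right h4 (by linarith)
  nlinarith

theorem small_of_limsup {g : ℝ → ℝ} (hg : limsup (fun u : ℝ => ((g u : ℝ) : EReal)) atTop ≤ 0)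
    {ε : ℝ} (hε : 0 < ε) : ∃ u : ℝ, 0 < u ∧ g u ≤ ε := by
  have h1 : limsup (fun u : ℝ => ((g u : ℝ) : EReal)) atTop < (ε : EReal) :=
    hg.trans_lt (by exact_mod_cast hε)
  have h2 := eventually_lt_of_limsup_lt h1
  obtain ⟨u, hu, hu0⟩ := (h2.and (eventually_gt_atTop 0)).exists
  exact ⟨u, hu0, le_of_lt (by exact_mod_cast hu)⟩

/-- Dissipation is needed only in the form `f u ≤ ε u` for some `u > 0`. For `q > 2`, `f u * u ≤ C₃`
gives it at `u = √(C₃ / ε)`; for `q = 2` it is the limsup condition. -/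
theorem IsChafeeInfanteReaction.reaction {f : ℝ → ℝ} (hf : IsChafeeInfanteReaction f) :
    Reaction f := by
  obtain ⟨q, C₁, C₂, C₃, C₄, hq, h1, h2, h3, h4, -, hgt, heq⟩ := hf.growth
  have hneg : Continuous (oddReflect f) := (hf.continuous.comp continuous_neg).neg
  have dissip : ∀ g : ℝ → ℝ, (∀ u : ℝ, 0 < u → g u * u ≤ C₃) → ∀ ε : ℝ, 0 < ε →
      ∃ u : ℝ, 0 < u ∧ g u ≤ ε * u := by
    intro g hg ε hε
    refine ⟨Real.sqrt (C₃ / ε), Real.sqrt_pos.2 (by positivity), ?_⟩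
    have hs : 0 < Real.sqrt (C₃ / ε) := Real.sqrt_pos.2 (by positivity)
    have hsq : Real.sqrt (C₃ / ε) * Real.sqrt (C₃ / ε) = C₃ / ε :=
      Real.mul_self_sqrt (by positivity)
    refine le_of_mul_le_mul_right ((hg _ hs).trans (le_of_eq ?_)) hs
    rw [mul_assoc, hsq]; field_simp
  have hterm : ∀ u : ℝ, 0 ≤ C₄ * |u| ^ q := fun u => by positivity
  constructor
  · refine halfReaction_of_strictConcaveOn hf.continuous hf.map_zero hf.hasDerivAt_zero
      hf.strictConcaveOn fun ε hε => ?_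
    rcases hq.lt_or_eq with hq | hq
    · exact dissip f (fun u _ => (hgt hq u).trans (by linarith [hterm u])) ε hε
    · obtain ⟨u, hu, h⟩ := small_of_limsup (g := fun u => f u / u) (heq hq.symm).1 hε
      exact ⟨u, hu, (div_le_iff₀ hu).1 h⟩
  · refine halfReaction_of_strictConcaveOn hneg (by simp [oddReflect, hf.map_zero])
      (hasDerivAt_oddReflect hf.hasDerivAt_zero) ⟨convex_Ioi 0, ?_⟩ fun ε hε => ?_
    · intro x hx y hy hxy s t hs ht hst
      have := hf.strictConvexOn.2 (x := -x) (by simpa using hx) (y := -y) (by simpa using hy)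
        (by simpa using hxy) hs ht hst
      simp only [smul_eq_mul, oddReflect] at *
      have e : -(s * x + t * y) = s * -x + t * -y := by ring
      rw [e]; linarith
    · rcases hq.lt_or_eq with hq | hq
      · refine dissip _ (fun u _ => ?_) ε hε
        have := hgt hq (-u)
        simp only [oddReflect]
        nlinarith [hterm (-u)]
      · have hlim : limsup (fun u : ℝ => ((oddReflect f u / u : ℝ) : EReal)) atTop ≤ 0 := by
          have := (heq hq.symm).2
          rw [← map_neg_atTop (G := ℝ)] at this
          refine le_trans (le_of_eq ?_) this
          simp only [limsup, map_map]
          congr 2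
          funext u
          simp [oddReflect, div_neg, neg_div]
        obtain ⟨u, hu, h⟩ := small_of_limsup (g := fun u => oddReflect f u / u) hlim hε
        exact ⟨u, hu, (div_le_iff₀ hu).1 h⟩

/-- The quotient `f v / v` decreases from its limit `f'(0) = 1`; comparison with `u / 2` makes the
bound strict. -/
theorem HalfReaction.lt_self {f : ℝ → ℝ} (hf : HalfReaction f) {u : ℝ} (hu : 0 < u) :
    f u < u := by
  have hle : ∀ v : ℝ, 0 < v → f v ≤ v := by
    intro v hv
    have h1 := hasDerivAt_iff_tendsto_slope.1 hf.deriv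
    have h2 : Tendsto (slope f 0) (𝓝[>] 0) (𝓝 1) :=
      h1.mono_left (nhdsWithin_mono _ fun x hx => ne_of_gt hx)
    have h3 : f v / v ≤ 1 := by
      refine ge_of_tendsto h2 ?_
      filter_upwards [Ioo_mem_nhdsGT hv] with e he
      have := hf.anti e v he.1 he.2
      rw [slope_def_field, hf.zero, sub_zero, sub_zero, div_le_div_iff₀ hv he.1]
      exact this.le
    rwa [div_le_one hv] at h3
  have h1 := hf.anti (u / 2) u (by linarith) (by linarith)
  have h2 := hle (u / 2) (by linarith)
  nlinarith

theorem HalfReaction.exists_lipschitz {f : ℝ → ℝ} (hf : HalfReaction f) {M : ℝ} (hM : 0 ≤ M) :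
    ∃ C : ℝ, 0 ≤ C ∧ ∀ x ∈ Icc 0 M, ∀ y ∈ Icc 0 M, |f x - f y| ≤ C * |x - y| := by
  -- Chord slopes in `[0, M]` are at most `1`, and by concavity at least the slope `f (M + 1) - f M`
  -- of the chord just to the right.
  set C := max 1 (f M - f (M + 1)) with hC
  have key : ∀ x ∈ Icc 0 M, ∀ y ∈ Icc 0 M, x < y → |f x - f y| ≤ C * |x - y| := by
    intro x hx y hy hxy
    rw [abs_of_neg (by linarith : x - y < 0), abs_le]
    have hxy' : 0 < y - x := by linarith
    have hup : f y - f x ≤ y - x := by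
      rcases hx.1.eq_or_lt with h | h
      · rw [← h, hf.zero]
        have := hf.lt_self (u := y) (by linarith)
        linarith
      · have h1 := hf.anti x y h hxy
        have h2 := hf.lt_self h
        have h3 : f x * (y - x) ≤ x * (y - x) := mul_le_mul_of_nonneg_right h2.le hxy'.le
        nlinarith
    have hlow : -(f M - f (M + 1)) * (y - x) ≤ f y - f x := by
      have h1 := hf.concave.slope_anti_adjacent (x := x) (y := y) (z := M + 1) hx.1
        (by simp; linarith) hxy (by linarith [hy.2])
      have h2 : f (M + 1) - f M ≤ (f (M + 1) - f y) / (M + 1 - y) := by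
        rcases hy.2.eq_or_lt with h | h
        · simp [h]
        · have := hf.concave.slope_anti_adjacent (x := y) (y := M) (z := M + 1) hy.1
            (by simp; linarith) h (by linarith)
          rw [div_le_div_iff₀ (by linarith) (by linarith)] at this
          rw [le_div_iff₀ (by linarith)]
          nlinarith
      have h3 := h2.trans h1
      rw [le_div_iff₀ hxy'] at h3
      linarith
    have hC1 : 1 * (y - x) ≤ C * (y - x) := mul_le_mul_of_nonneg_right (le_max_left _ _) hxy'.le
    have hC2 : (f M - f (M + 1)) * (y - x) ≤ C * (y - x) :=
      mul_le_mul_of_nonneg_right (le_max_right _ _) hxy'.le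
    constructor <;> linarith
  refine ⟨C, le_trans zero_le_one (le_max_left _ _), fun x hx y hy => ?_⟩
  rcases lt_trichotomy x y with h | h | h
  · exact key x hx y hy h
  · simp [h]
  · rw [abs_sub_comm, abs_sub_comm x]
    exact key y hy x hx h

/-! ### Truncated reaction terms -/

/-- The properties on `[0, ∞)` of a reaction term truncated at a positive value. -/
structure HalfForce (Φ : ℝ → ℝ) : Prop where
  pos : ∀ u : ℝ, 0 < u → 0 < Φ u
  anti : ∀ u v : ℝ, 0 < u → u ≤ v → Φ v * u ≤ Φ u * v
  lt_self : ∀ u : ℝ, 0 < u → Φ u < u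
  bound : ∃ c M : ℝ, 0 < c ∧ 0 < M ∧ ∀ u, M ≤ u → c ≤ Φ u

/-- A globally Lipschitz force field with the sign of its argument. -/
structure IsForce (Φ : ℝ → ℝ) : Prop where
  lip : ∃ C : NNReal, LipschitzWith C Φ
  zero : Φ 0 = 0
  deriv : HasDerivAt Φ 1 0
  half : HalfForce Φ
  half_neg : HalfForce (oddReflect Φ)

theorem IsForce.cont {Φ : ℝ → ℝ} (h : IsForce Φ) : Continuous Φ := h.lip.choose_spec.continuous

theorem IsForce.reflect {Φ : ℝ → ℝ} (h : IsForce Φ) : IsForce (oddReflect Φ) := by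
  obtain ⟨C, hC⟩ := h.lip
  refine ⟨⟨C, ?_⟩, by simp [oddReflect, h.zero], hasDerivAt_oddReflect h.deriv, h.half_neg,
    by rw [oddReflect_oddReflect]; exact h.half⟩
  refine LipschitzWith.of_dist_le_mul fun x y => ?_
  have := hC.dist_le_mul (-x) (-y)
  simpa [oddReflect] using this

/-- `f` with its argument truncated to `[-N, M]`. -/
def truncate (f : ℝ → ℝ) (N M : ℝ) : ℝ → ℝ := fun u => f (max (-N) (min M u))

theorem truncate_eq {f : ℝ → ℝ} {N M u : ℝ} (hu : u ∈ Icc (-N) M) : truncate f N M u = f u := by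
  rw [truncate, min_eq_right hu.2, max_eq_right hu.1]

theorem oddReflect_truncate {f : ℝ → ℝ} {N M : ℝ} (hN : 0 ≤ N) (hM : 0 ≤ M) :
    oddReflect (truncate f N M) = truncate (oddReflect f) M N := by
  funext u
  simp only [oddReflect, truncate]
  congr 2
  grind

/-- As `f u / u` decreases, `0 < f M` forces `f > 0` on all of `(0, M]`; past `M` the truncation is
the positive constant `f M`. -/
theorem HalfReaction.halfForce_truncate {f : ℝ → ℝ} (hf : HalfReaction f) {N M : ℝ} (hN : 0 ≤ N)
    (hM : 0 < M) (hfM : 0 < f M) : HalfForce (truncate f N M) := by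
  have hpos : ∀ u, 0 < u → u ≤ M → 0 < f u := by
    intro u hu huM
    rcases huM.eq_or_lt with h | h
    · rwa [h]
    · have := hf.anti u M hu h
      by_contra hcon
      nlinarith [mul_pos hfM hu]
  have e1 : ∀ u, 0 < u → u ≤ M → truncate f N M u = f u := fun u hu huM =>
    truncate_eq ⟨by linarith, huM⟩
  have e2 : ∀ u, M ≤ u → truncate f N M u = f M := fun u hu => by
    rw [truncate, min_eq_left hu, max_eq_right (by linarith)]
  have hanti : ∀ u v, 0 < u → u ≤ v → f v * u ≤ f u * v := fun u v hu huv => by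
    rcases huv.eq_or_lt with h | h
    · rw [h]
    · exact (hf.anti u v hu h).le
  refine ⟨fun u hu => ?_, fun u v hu huv => ?_, fun u hu => ?_, f M, M, hfM, hM,
    fun u hu => (e2 u hu).ge⟩
  · rcases le_total u M with h | h
    · rw [e1 u hu h]; exact hpos u hu h
    · rw [e2 u h]; exact hfM
  · rcases le_total v M with h | h
    · rw [e1 u hu (huv.trans h), e1 v (hu.trans_le huv) h]; exact hanti u v hu huv
    · rw [e2 v h]
      rcases le_total u M with h' | h'
      · rw [e1 u hu h']
        exact (hanti u M hu h').trans (mul_le_mul_of_nonneg_left h (hpos u hu h').le)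
      · rw [e2 u h']
        exact mul_le_mul_of_nonneg_left huv hfM.le
  · rcases le_total u M with h | h
    · rw [e1 u hu h]; exact hf.lt_self hu
    · rw [e2 u h]; exact (hf.lt_self hM).trans_le h

theorem Reaction.exists_lipschitzWith_truncate {f : ℝ → ℝ} (hf : Reaction f) {N M : ℝ}
    (hN : 0 < N) (hM : 0 < M) : ∃ C : NNReal, LipschitzWith C (truncate f N M) := by
  obtain ⟨C₁, hC₁, h₁⟩ := hf.pos.exists_lipschitz hM.le
  obtain ⟨C₂, hC₂, h₂⟩ := hf.neg.exists_lipschitz hN.le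
  have h₂' : ∀ x ∈ Icc (-N) 0, ∀ y ∈ Icc (-N) 0, |f x - f y| ≤ C₂ * |x - y| := by
    intro x hx y hy
    have := h₂ (-x) ⟨by linarith [hx.2], by linarith [hx.1]⟩ (-y)
      ⟨by linarith [hy.2], by linarith [hy.1]⟩
    simp only [oddReflect, neg_neg] at this
    rw [abs_sub_comm, abs_sub_comm x]
    convert this using 2 <;> ring_nf
  have key : ∀ x ∈ Icc (-N) M, ∀ y ∈ Icc (-N) M, x ≤ y →
      |f x - f y| ≤ max C₁ C₂ * |x - y| := by
    intro x hx y hy hxy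
    have a1 : C₁ ≤ max C₁ C₂ := le_max_left _ _
    have a2 : C₂ ≤ max C₁ C₂ := le_max_right _ _
    rcases le_total 0 x with h0 | h0
    · exact (h₁ x ⟨h0, hx.2⟩ y ⟨h0.trans hxy, hy.2⟩).trans
        (mul_le_mul_of_nonneg_right a1 (abs_nonneg _))
    rcases le_total y 0 with h1 | h1
    · exact (h₂' x ⟨hx.1, h0⟩ y ⟨hy.1, h1⟩).trans (mul_le_mul_of_nonneg_right a2 (abs_nonneg _))
    have b1 := h₂' x ⟨hx.1, h0⟩ 0 ⟨by linarith, le_rfl⟩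
    have b2 := h₁ 0 ⟨le_rfl, hM.le⟩ y ⟨h1, hy.2⟩
    have b3 := abs_sub_le (f x) (f 0) (f y)
    rw [abs_of_nonpos (by linarith : x - 0 ≤ 0)] at b1
    rw [abs_of_nonpos (by linarith : 0 - y ≤ 0)] at b2
    rw [abs_of_nonpos (by linarith : x - y ≤ 0)]
    have c1 : C₂ * -(x - 0) ≤ max C₁ C₂ * -(x - 0) := mul_le_mul_of_nonneg_right a2 (by linarith)
    have c2 : C₁ * -(0 - y) ≤ max C₁ C₂ * -(0 - y) := mul_le_mul_of_nonneg_right a1 (by linarith)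
    linarith
  have hmem : ∀ u, max (-N) (min M u) ∈ Icc (-N) M := fun u =>
    ⟨le_max_left _ _, max_le (by linarith) (min_le_left _ _)⟩
  have hlip : LipschitzWith 1 fun u : ℝ => max (-N) (min M u) :=
    (LipschitzWith.id.const_min M).const_max (-N)
  refine ⟨⟨max C₁ C₂, hC₁.trans (le_max_left _ _)⟩, ?_⟩
  refine LipschitzWith.of_dist_le_mul fun x y => ?_
  have h3 : |f (max (-N) (min M x)) - f (max (-N) (min M y))| ≤
      max C₁ C₂ * |max (-N) (min M x) - max (-N) (min M y)| := by
    rcases le_total (max (-N) (min M x)) (max (-N) (min M y)) with h | h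
    · exact key _ (hmem x) _ (hmem y) h
    · rw [abs_sub_comm, abs_sub_comm (max (-N) (min M x))]
      exact key _ (hmem y) _ (hmem x) h
  have h4 := hlip.dist_le_mul x y
  simp only [Real.dist_eq, NNReal.coe_one, one_mul] at h4 ⊢
  exact h3.trans (mul_le_mul_of_nonneg_left h4 (hC₁.trans (le_max_left _ _)))

theorem Reaction.isForce_truncate {f : ℝ → ℝ} (hf : Reaction f) {N M : ℝ} (hN : 0 < N)
    (hM : 0 < M) (hfN : f (-N) < 0) (hfM : 0 < f M) : IsForce (truncate f N M) := by
  refine ⟨hf.exists_lipschitzWith_truncate hN hM, ?_, ?_,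
    hf.pos.halfForce_truncate hN.le hM hfM, ?_⟩
  · rw [truncate_eq ⟨by linarith, hM.le⟩, hf.pos.zero]
  · refine hf.pos.deriv.congr_of_eventuallyEq ?_
    filter_upwards [Icc_mem_nhds (by linarith : -N < 0) hM] with u hu
    exact truncate_eq hu
  · rw [oddReflect_truncate hN.le hM.le]
    exact hf.neg.halfForce_truncate hM.le hN (by simp [oddReflect, hfN])

/-! ### Energy coordinates -/

/-- The primitive `∫₀ᵘ Φ` of the force `Φ`. -/
def potential (Φ : ℝ → ℝ) (u : ℝ) : ℝ := ∫ x in (0 : ℝ)..u, Φ x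

/-- The signed square root of twice the potential. -/
def energyCoord (Φ : ℝ → ℝ) (u : ℝ) : ℝ :=
  if 0 ≤ u then √(2 * potential Φ u) else -√(2 * potential Φ u)

/-- The inverse of `energyCoord`. -/
def energyInv (Φ : ℝ → ℝ) : ℝ → ℝ := Function.invFun (energyCoord Φ)

/-- The derivative of `energyCoord`. -/
def energyCoordDeriv (Φ : ℝ → ℝ) (u : ℝ) : ℝ := if u = 0 then 1 else Φ u / energyCoord Φ u

/-- The derivative of `energyInv`. -/
def energyInvDeriv (Φ : ℝ → ℝ) (y : ℝ) : ℝ := (energyCoordDeriv Φ (energyInv Φ y))⁻¹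

theorem potential_oddReflect (Φ : ℝ → ℝ) (u : ℝ) :
    potential (oddReflect Φ) u = potential Φ (-u) := by
  simp only [potential, oddReflect]
  rw [intervalIntegral.integral_neg, intervalIntegral.integral_comp_neg (f := Φ), neg_zero,
    ← intervalIntegral.integral_symm]

theorem potential_zero (Φ : ℝ → ℝ) : potential Φ 0 = 0 := by simp [potential]

theorem energyCoord_zero (Φ : ℝ → ℝ) : energyCoord Φ 0 = 0 := by
  simp [energyCoord, potential_zero]

theorem energyCoord_oddReflect (Φ : ℝ → ℝ) (u : ℝ) :
    energyCoord (oddReflect Φ) u = -energyCoord Φ (-u) := by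
  rcases lt_trichotomy u 0 with h | h | h
  · simp only [energyCoord, potential_oddReflect]
    rw [if_neg (by linarith), if_pos (by linarith)]
  · simp [h, energyCoord_zero]
  · simp only [energyCoord, potential_oddReflect]
    rw [if_pos (by linarith), if_neg (by linarith), neg_neg]

theorem hasDerivAt_potential {Φ : ℝ → ℝ} (hΦ : Continuous Φ) (u : ℝ) :
    HasDerivAt (potential Φ) (Φ u) u :=
  intervalIntegral.integral_hasDerivAt_right (hΦ.intervalIntegrable _ _)
    (hΦ.stronglyMeasurableAtFilter _ _) hΦ.continuousAt

theorem potential_sub {Φ : ℝ → ℝ} (hΦ : Continuous Φ) (u v : ℝ) :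
    potential Φ v - potential Φ u = ∫ x in u..v, Φ x :=
  intervalIntegral.integral_interval_sub_left (hΦ.intervalIntegrable _ _)
    (hΦ.intervalIntegrable _ _)

namespace HalfForce

variable {Φ : ℝ → ℝ}

/-- On `(0, u)` the graph of `Φ` lies above the chord from the origin to `(u, Φ u)`. -/
theorem mul_le_two_potential (h : HalfForce Φ) (hc : Continuous Φ) {u : ℝ} (hu : 0 < u) :
    u * Φ u ≤ 2 * potential Φ u := by
  have h1 : ∫ x in (0 : ℝ)..u, Φ u / u * x ≤ ∫ x in (0 : ℝ)..u, Φ x := by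
    refine intervalIntegral.integral_mono_on_of_le_Ioo hu.le
      ((by fun_prop : Continuous fun x : ℝ => Φ u / u * x).intervalIntegrable _ _)
      (hc.intervalIntegrable _ _) fun x hx => ?_
    have := h.anti x u hx.1 hx.2.le
    rw [div_mul_eq_mul_div, div_le_iff₀ hu]
    exact this
  rw [intervalIntegral.integral_const_mul, integral_id] at h1
  have h2 : Φ u / u * ((u ^ 2 - 0 ^ 2) / 2) = u * Φ u / 2 := by field_simp; ring
  rw [h2] at h1
  simp only [potential]; linarith

theorem two_potential_le (h : HalfForce Φ) (hc : Continuous Φ) {u : ℝ} (hu : 0 < u) :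
    2 * potential Φ u ≤ u ^ 2 := by
  have h1 : ∫ x in (0 : ℝ)..u, Φ x ≤ ∫ x in (0 : ℝ)..u, x := by
    exact intervalIntegral.integral_mono_on_of_le_Ioo hu.le (hc.intervalIntegrable _ _)
      (continuous_id.intervalIntegrable _ _) fun x hx => (h.lt_self x hx.1).le
  rw [integral_id] at h1
  simp only [potential]; linarith

theorem potential_pos (h : HalfForce Φ) (hc : Continuous Φ) {u : ℝ} (hu : 0 < u) :
    0 < potential Φ u := by
  have := h.mul_le_two_potential hc hu
  have := mul_pos hu (h.pos u hu)
  linarith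

theorem energyCoord_sq (h : HalfForce Φ) (hc : Continuous Φ) {u : ℝ} (hu : 0 < u) :
    energyCoord Φ u ^ 2 = 2 * potential Φ u := by
  rw [energyCoord, if_pos hu.le, Real.sq_sqrt]
  linarith [h.potential_pos hc hu]

theorem energyCoord_pos (h : HalfForce Φ) (hc : Continuous Φ) {u : ℝ} (hu : 0 < u) :
    0 < energyCoord Φ u := by
  rw [energyCoord, if_pos hu.le]
  exact Real.sqrt_pos.2 (by linarith [h.potential_pos hc hu])

/-- `Φ² < u Φ ≤ 2F`. This makes the derivative `Φ / √(2F)` of the energy coordinate less than `1`,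
the source of `T > jπ`. -/
theorem lt_energyCoord (h : HalfForce Φ) (hc : Continuous Φ) {u : ℝ} (hu : 0 < u) :
    Φ u < energyCoord Φ u := by
  refine lt_of_pow_lt_pow_left₀ 2 (h.energyCoord_pos hc hu).le ?_
  rw [h.energyCoord_sq hc hu]
  have h1 := h.pos u hu
  have h2 := h.lt_self u hu
  have h3 := h.mul_le_two_potential hc hu
  nlinarith

theorem energyCoord_le (h : HalfForce Φ) (hc : Continuous Φ) {u : ℝ} (hu : 0 < u) :
    energyCoord Φ u ≤ u := by
  refine le_of_sq_le_sq ?_ hu.le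
  rw [h.energyCoord_sq hc hu]
  exact h.two_potential_le hc hu

theorem hasDerivAt_energyCoord (h : HalfForce Φ) (hc : Continuous Φ) {u : ℝ} (hu : 0 < u) :
    HasDerivAt (energyCoord Φ) (Φ u / energyCoord Φ u) u := by
  have h1 : HasDerivAt (fun x => √(2 * potential Φ x)) (2 * Φ u / (2 * √(2 * potential Φ u))) u :=
    ((hasDerivAt_potential hc u).const_mul 2).sqrt (by linarith [h.potential_pos hc hu])
  have h2 : 2 * Φ u / (2 * √(2 * potential Φ u)) = Φ u / energyCoord Φ u := by
    rw [energyCoord, if_pos hu.le, mul_div_mul_left _ _ two_ne_zero]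
  rw [h2] at h1
  refine h1.congr_of_eventuallyEq ?_
  filter_upwards [Ioi_mem_nhds hu] with x hx
  rw [energyCoord, if_pos (le_of_lt hx)]

theorem hasDerivWithinAt_energyCoord_zero (h : HalfForce Φ) (hc : Continuous Φ) (h0 : Φ 0 = 0)
    (hd : HasDerivAt Φ 1 0) : HasDerivWithinAt (energyCoord Φ) 1 (Ici 0) 0 := by
  have h1 : Tendsto (slope Φ 0) (𝓝[>] 0) (𝓝 1) :=
    (hasDerivAt_iff_tendsto_slope.1 hd).mono_left (nhdsWithin_mono _ fun x hx => ne_of_gt hx)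
  rw [← hasDerivWithinAt_Ioi_iff_Ici, hasDerivWithinAt_iff_tendsto_slope' (by simp)]
  -- The difference quotient is squeezed between `Φ x / x`, which tends to `Φ'(0) = 1`, and `1`.
  refine tendsto_of_tendsto_of_tendsto_of_le_of_le' h1 tendsto_const_nhds ?_ ?_
  · filter_upwards [self_mem_nhdsWithin] with x hx
    simp only [slope_def_field, h0, energyCoord_zero, sub_zero]
    have hx' : (0 : ℝ) < x := hx
    gcongr
    exact (h.lt_energyCoord hc hx').le
  · filter_upwards [self_mem_nhdsWithin] with x hx
    simp only [slope_def_field, energyCoord_zero, sub_zero]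
    rw [div_le_one hx]
    exact h.energyCoord_le hc hx

theorem tendsto_energyCoord (h : HalfForce Φ) (hc : Continuous Φ) :
    Tendsto (energyCoord Φ) atTop atTop := by
  obtain ⟨c, M, hc0, hM, hb⟩ := h.bound
  have h1 : Tendsto (fun u => √(2 * (c * (u - M)))) atTop atTop :=
    Real.tendsto_sqrt_atTop.comp (((tendsto_atTop_add_const_right _ (-M) tendsto_id).const_mul_atTop
      hc0).const_mul_atTop two_pos)
  refine tendsto_atTop_mono' _ ?_ h1
  filter_upwards [eventually_ge_atTop M] with u hu
  rw [energyCoord, if_pos (by linarith)]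
  refine Real.sqrt_le_sqrt ?_
  have h2 : ∫ x in M..u, c ≤ ∫ x in M..u, Φ x :=
    intervalIntegral.integral_mono_on hu (by simp) (hc.intervalIntegrable _ _) fun x hx => hb x hx.1
  rw [← potential_sub hc] at h2
  simp only [intervalIntegral.integral_const, smul_eq_mul] at h2
  have := h.potential_pos hc hM
  linarith

end HalfForce

namespace IsForce

variable {Φ : ℝ → ℝ}

theorem energyCoord_neg (h : IsForce Φ) {u : ℝ} (hu : u < 0) : energyCoord Φ u < 0 := by
  have := h.half_neg.energyCoord_pos h.reflect.cont (u := -u) (by linarith)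
  rw [energyCoord_oddReflect, neg_neg] at this
  linarith

theorem energyCoord_sq (h : IsForce Φ) (u : ℝ) : energyCoord Φ u ^ 2 = 2 * potential Φ u := by
  rcases lt_trichotomy u 0 with hu | hu | hu
  · have := h.half_neg.energyCoord_sq h.reflect.cont (u := -u) (by linarith)
    rwa [energyCoord_oddReflect, potential_oddReflect, neg_neg, neg_sq] at this
  · simp [hu, energyCoord_zero, potential_zero]
  · exact h.half.energyCoord_sq h.cont hu

theorem apply_neg (h : IsForce Φ) {u : ℝ} (hu : u < 0) : Φ u < 0 := by
  have := h.half_neg.pos (-u) (by linarith)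
  simp only [oddReflect, neg_neg] at this
  linarith

theorem hasDerivAt_energyCoord (h : IsForce Φ) (u : ℝ) :
    HasDerivAt (energyCoord Φ) (energyCoordDeriv Φ u) u := by
  have e : energyCoord Φ = fun u => -energyCoord (oddReflect Φ) (-u) := by
    funext u; rw [energyCoord_oddReflect, neg_neg, neg_neg]
  rcases lt_trichotomy u 0 with hu | hu | hu
  · have h1 := h.half_neg.hasDerivAt_energyCoord h.reflect.cont (u := -u) (by linarith)
    have h2 := (h1.comp u (hasDerivAt_neg u)).neg
    have h3 : energyCoordDeriv Φ u =
        -(oddReflect Φ (-u) / energyCoord (oddReflect Φ) (-u) * -1) := by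
      rw [energyCoordDeriv, if_neg hu.ne, energyCoord_oddReflect, oddReflect]
      simp only [neg_neg]
      rw [neg_div_neg_eq]; ring
    rw [h3, e]
    exact h2
  · subst hu
    rw [energyCoordDeriv, if_pos rfl]
    have h1 := h.half.hasDerivWithinAt_energyCoord_zero h.cont h.zero h.deriv
    have h2 := h.half_neg.hasDerivWithinAt_energyCoord_zero h.reflect.cont h.reflect.zero
      h.reflect.deriv
    have h3 : HasDerivWithinAt (energyCoord Φ) 1 (Iic 0) 0 := by
      have h4 : HasDerivWithinAt (energyCoord (oddReflect Φ)) 1 (Ici 0) (-0) := by simpa using h2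
      have h5 := (h4.scomp (0 : ℝ) (hasDerivAt_neg (0 : ℝ)).hasDerivWithinAt
        (fun x (hx : x ∈ Iic (0 : ℝ)) => by simpa using hx)).neg
      have h7 : -((-1 : ℝ) • (1 : ℝ)) = 1 := by simp
      rw [h7] at h5
      rw [e]
      exact h5
    have h6 := h1.union h3
    rwa [Ici_union_Iic, hasDerivWithinAt_univ] at h6
  · rw [energyCoordDeriv, if_neg hu.ne']
    exact h.half.hasDerivAt_energyCoord h.cont hu

theorem energyCoordDeriv_pos (h : IsForce Φ) (u : ℝ) : 0 < energyCoordDeriv Φ u := by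
  rw [energyCoordDeriv]
  rcases lt_trichotomy u 0 with hu | hu | hu
  · rw [if_neg hu.ne]
    exact div_pos_of_neg_of_neg (h.apply_neg hu) (h.energyCoord_neg hu)
  · simp [hu]
  · rw [if_neg hu.ne']
    exact div_pos (h.half.pos u hu) (h.half.energyCoord_pos h.cont hu)

theorem energyCoordDeriv_lt_one (h : IsForce Φ) {u : ℝ} (hu : u ≠ 0) :
    energyCoordDeriv Φ u < 1 := by
  rw [energyCoordDeriv, if_neg hu]
  rcases hu.lt_or_gt with hu | hu
  · rw [div_lt_one_of_neg (h.energyCoord_neg hu)]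
    have := h.half_neg.lt_energyCoord h.reflect.cont (u := -u) (by linarith)
    rw [energyCoord_oddReflect, oddReflect] at this
    simp only [neg_neg] at this
    linarith
  · rw [div_lt_one (h.half.energyCoord_pos h.cont hu)]
    exact h.half.lt_energyCoord h.cont hu

theorem strictMono_energyCoord (h : IsForce Φ) : StrictMono (energyCoord Φ) :=
  strictMono_of_deriv_pos fun u => by
    rw [(h.hasDerivAt_energyCoord u).deriv]; exact h.energyCoordDeriv_pos u

theorem continuous_energyCoord (h : IsForce Φ) : Continuous (energyCoord Φ) :=
  continuous_iff_continuousAt.2 fun u => (h.hasDerivAt_energyCoord u).continuousAt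

theorem surjective_energyCoord (h : IsForce Φ) : Function.Surjective (energyCoord Φ) := by
  refine h.continuous_energyCoord.surjective (h.half.tendsto_energyCoord h.cont) ?_
  have e : energyCoord Φ = fun u => -energyCoord (oddReflect Φ) (-u) := by
    funext u; rw [energyCoord_oddReflect, neg_neg, neg_neg]
  rw [e]
  exact tendsto_neg_atTop_atBot.comp ((h.half_neg.tendsto_energyCoord h.reflect.cont).comp
    tendsto_neg_atBot_atTop)

theorem continuous_energyCoordDeriv (h : IsForce Φ) : Continuous (energyCoordDeriv Φ) := by
  refine continuous_iff_continuousAt.2 fun u => ?_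
  rcases eq_or_ne u 0 with hu | hu
  · subst hu
    rw [continuousAt_iff_punctured_nhds]
    have h1 := hasDerivAt_iff_tendsto_slope.1 h.deriv
    have h2 := hasDerivAt_iff_tendsto_slope.1 (h.hasDerivAt_energyCoord 0)
    have h3 : energyCoordDeriv Φ 0 = 1 := by simp [energyCoordDeriv]
    rw [h3] at h2 ⊢
    -- Near `0` the derivative is the quotient of `Φ x / x` by `energyCoord Φ x / x`, both of which
    -- tend to `1`.
    have h4 := h1.div h2 one_ne_zero
    rw [div_one] at h4
    refine h4.congr' ?_
    filter_upwards [self_mem_nhdsWithin] with x hx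
    have hx' : x ≠ 0 := hx
    simp only [Pi.div_apply, slope_def_field, h.zero, energyCoord_zero, sub_zero,
      energyCoordDeriv, if_neg hx']
    rw [div_div_div_cancel_right₀ hx']
  · have h1 : ContinuousAt (fun u => Φ u / energyCoord Φ u) u := by
      refine h.cont.continuousAt.div h.continuous_energyCoord.continuousAt ?_
      rcases hu.lt_or_gt with h' | h'
      · exact (h.energyCoord_neg h').ne
      · exact (h.half.energyCoord_pos h.cont h').ne'
    refine h1.congr ?_
    filter_upwards [isOpen_ne.mem_nhds hu] with x hx
    rw [energyCoordDeriv, if_neg hx]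

theorem energyInv_energyCoord (h : IsForce Φ) (u : ℝ) : energyInv Φ (energyCoord Φ u) = u :=
  Function.leftInverse_invFun h.strictMono_energyCoord.injective u

theorem energyCoord_energyInv (h : IsForce Φ) (y : ℝ) : energyCoord Φ (energyInv Φ y) = y :=
  Function.rightInverse_invFun h.surjective_energyCoord y

theorem strictMono_energyInv (h : IsForce Φ) : StrictMono (energyInv Φ) := fun x y hxy => by
  rw [← h.strictMono_energyCoord.lt_iff_lt, h.energyCoord_energyInv, h.energyCoord_energyInv]
  exact hxy

theorem energyInv_zero (h : IsForce Φ) : energyInv Φ 0 = 0 := by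
  have := h.energyInv_energyCoord 0
  rwa [energyCoord_zero] at this

theorem energyInv_eq_zero (h : IsForce Φ) {y : ℝ} : energyInv Φ y = 0 ↔ y = 0 := by
  conv_lhs => rw [← h.energyInv_zero]
  exact h.strictMono_energyInv.injective.eq_iff

theorem energyInv_oddReflect (h : IsForce Φ) (y : ℝ) :
    energyInv (oddReflect Φ) y = -energyInv Φ (-y) := by
  apply h.reflect.strictMono_energyCoord.injective
  rw [h.reflect.energyCoord_energyInv, energyCoord_oddReflect, neg_neg, h.energyCoord_energyInv,
    neg_neg]

theorem continuous_energyInv (h : IsForce Φ) : Continuous (energyInv Φ) := by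
  have : energyInv Φ = (h.strictMono_energyCoord.orderIsoOfSurjective _
      h.surjective_energyCoord).symm := by
    funext y
    apply h.strictMono_energyCoord.injective
    rw [h.energyCoord_energyInv]
    exact ((h.strictMono_energyCoord.orderIsoOfSurjective _
      h.surjective_energyCoord).apply_symm_apply y).symm
  rw [this]
  exact OrderIso.continuous _

theorem hasDerivAt_energyInv (h : IsForce Φ) (y : ℝ) :
    HasDerivAt (energyInv Φ) (energyInvDeriv Φ y) y :=
  HasDerivAt.of_local_left_inverse h.continuous_energyInv.continuousAt
    (h.hasDerivAt_energyCoord _) (h.energyCoordDeriv_pos _).ne'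
    (Eventually.of_forall h.energyCoord_energyInv)

theorem continuous_energyInvDeriv (h : IsForce Φ) : Continuous (energyInvDeriv Φ) :=
  (h.continuous_energyCoordDeriv.comp h.continuous_energyInv).inv₀
    fun _ => (h.energyCoordDeriv_pos _).ne'

theorem one_lt_energyInvDeriv (h : IsForce Φ) {y : ℝ} (hy : y ≠ 0) : 1 < energyInvDeriv Φ y :=
  (one_lt_inv₀ (h.energyCoordDeriv_pos _)).2
    (h.energyCoordDeriv_lt_one fun h' => hy (h.energyInv_eq_zero.1 h'))

theorem energyInvDeriv_zero (h : IsForce Φ) : energyInvDeriv Φ 0 = 1 := by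
  simp [energyInvDeriv, h.energyInv_zero, energyCoordDeriv]

theorem one_le_energyInvDeriv (h : IsForce Φ) (y : ℝ) : 1 ≤ energyInvDeriv Φ y := by
  rcases eq_or_ne y 0 with hy | hy
  · rw [hy, h.energyInvDeriv_zero]
  · exact (h.one_lt_energyInvDeriv hy).le

theorem energyInvDeriv_pos (h : IsForce Φ) (y : ℝ) : 0 < energyInvDeriv Φ y :=
  one_pos.trans_le (h.one_le_energyInvDeriv y)

/-- Since `dy/du = Φ(u) / y`. This identity turns uniform rotation of the energy circle, in the
phase variable, into the equation `w'' = -Φ(w)`. -/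
theorem div_energyInvDeriv (h : IsForce Φ) (y : ℝ) :
    y / energyInvDeriv Φ y = Φ (energyInv Φ y) := by
  rcases eq_or_ne y 0 with hy | hy
  · rw [hy, h.energyInv_zero, h.zero, zero_div]
  · have hne : energyInv Φ y ≠ 0 := fun h' => hy (h.energyInv_eq_zero.1 h')
    rw [energyInvDeriv, div_inv_eq_mul, energyCoordDeriv, if_neg hne, h.energyCoord_energyInv]
    field_simp

theorem energyInvDeriv_oddReflect (h : IsForce Φ) (y : ℝ) :
    energyInvDeriv (oddReflect Φ) y = energyInvDeriv Φ (-y) := by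
  rcases eq_or_ne y 0 with hy | hy
  · rw [hy, neg_zero, h.energyInvDeriv_zero, h.reflect.energyInvDeriv_zero]
  · have hne : energyInv Φ (-y) ≠ 0 := fun h' => hy (neg_eq_zero.1 (h.energyInv_eq_zero.1 h'))
    have hne' : energyInv (oddReflect Φ) y ≠ 0 := fun h' => hy (h.reflect.energyInv_eq_zero.1 h')
    rw [energyInvDeriv, energyInvDeriv, energyCoordDeriv, energyCoordDeriv, if_neg hne,
      if_neg hne', h.energyCoord_energyInv, h.reflect.energyCoord_energyInv,
      h.energyInv_oddReflect, oddReflect, neg_neg, neg_div, div_neg]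

end IsForce

/-! ### Explicit orbits of `-w'' = Φ w` -/

/-- The time at which the orbit of energy coordinate amplitude `S` has phase `η`. -/
def phaseTime (Φ : ℝ → ℝ) (S η : ℝ) : ℝ := ∫ x in (0 : ℝ)..η, energyInvDeriv Φ (S * Real.sin x)

/-- The phase at a given time, the inverse of `phaseTime`. -/
def phase (Φ : ℝ → ℝ) (S : ℝ) : ℝ → ℝ := Function.invFun (phaseTime Φ S)

/-- The solution of `-w'' = Φ w`, `w 0 = 0`, `w' 0 = S`. -/
def orbit (Φ : ℝ → ℝ) (S t : ℝ) : ℝ := energyInv Φ (S * Real.sin (phase Φ S t))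

/-- The time of the `j`-th zero of the orbit after time zero. -/
def nodalTime (Φ : ℝ → ℝ) (S : ℝ) (j : ℕ) : ℝ := phaseTime Φ S (j * Real.pi)

/-- The orbit rescaled such that its `j`-th positive zero is `1`, extended by zero. -/
def nodalSolution (Φ : ℝ → ℝ) (S : ℝ) (j : ℕ) (x : ℝ) : ℝ :=
  if x ∈ Ioo (0 : ℝ) 1 then orbit Φ S (nodalTime Φ S j * x) else 0

theorem phaseTime_zero (Φ : ℝ → ℝ) (S : ℝ) : phaseTime Φ S 0 = 0 := by simp [phaseTime]

namespace IsForce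

variable {Φ : ℝ → ℝ}

theorem continuous_phaseDensity (h : IsForce Φ) (S : ℝ) :
    Continuous fun x => energyInvDeriv Φ (S * Real.sin x) :=
  h.continuous_energyInvDeriv.comp (by fun_prop)

theorem hasDerivAt_phaseTime (h : IsForce Φ) (S η : ℝ) :
    HasDerivAt (phaseTime Φ S) (energyInvDeriv Φ (S * Real.sin η)) η :=
  hasDerivAt_potential (h.continuous_phaseDensity S) η

theorem phaseTime_sub (h : IsForce Φ) (S u v : ℝ) :
    phaseTime Φ S v - phaseTime Φ S u = ∫ x in u..v, energyInvDeriv Φ (S * Real.sin x) :=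
  potential_sub (h.continuous_phaseDensity S) u v

theorem sub_le_phaseTime_sub (h : IsForce Φ) (S : ℝ) {u v : ℝ} (huv : u ≤ v) :
    v - u ≤ phaseTime Φ S v - phaseTime Φ S u := by
  have h1 : ∫ _x in u..v, (1 : ℝ) ≤ ∫ x in u..v, energyInvDeriv Φ (S * Real.sin x) :=
    intervalIntegral.integral_mono_on huv (by simp)
      ((h.continuous_phaseDensity S).intervalIntegrable _ _) fun x _ => h.one_le_energyInvDeriv _
  rw [← h.phaseTime_sub] at h1
  simpa using h1

theorem strictMono_phaseTime (h : IsForce Φ) (S : ℝ) : StrictMono (phaseTime Φ S) :=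
  fun u v huv => by have := h.sub_le_phaseTime_sub S huv.le; linarith

theorem continuous_phaseTime (h : IsForce Φ) (S : ℝ) : Continuous (phaseTime Φ S) :=
  continuous_iff_continuousAt.2 fun η => (h.hasDerivAt_phaseTime S η).continuousAt

theorem surjective_phaseTime (h : IsForce Φ) (S : ℝ) : Function.Surjective (phaseTime Φ S) := by
  refine (h.continuous_phaseTime S).surjective ?_ ?_
  · refine tendsto_atTop_mono' _ ?_ tendsto_id
    filter_upwards [eventually_ge_atTop 0] with η hη
    have := h.sub_le_phaseTime_sub S hη
    simpa [phaseTime_zero] using this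
  · refine tendsto_atBot_mono' _ ?_ tendsto_id
    filter_upwards [eventually_le_atBot 0] with η hη
    have := h.sub_le_phaseTime_sub S hη
    simp only [phaseTime_zero, id] at *
    linarith

theorem phase_phaseTime (h : IsForce Φ) (S η : ℝ) : phase Φ S (phaseTime Φ S η) = η :=
  Function.leftInverse_invFun (h.strictMono_phaseTime S).injective η

theorem phaseTime_phase (h : IsForce Φ) (S t : ℝ) : phaseTime Φ S (phase Φ S t) = t :=
  Function.rightInverse_invFun (h.surjective_phaseTime S) t

theorem phase_zero (h : IsForce Φ) (S : ℝ) : phase Φ S 0 = 0 := by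
  have := h.phase_phaseTime S 0
  rwa [phaseTime_zero] at this

theorem strictMono_phase (h : IsForce Φ) (S : ℝ) : StrictMono (phase Φ S) := fun s t hst => by
  rw [← (h.strictMono_phaseTime S).lt_iff_lt, h.phaseTime_phase, h.phaseTime_phase]
  exact hst

theorem continuous_phase (h : IsForce Φ) (S : ℝ) : Continuous (phase Φ S) := by
  have : phase Φ S = ((h.strictMono_phaseTime S).orderIsoOfSurjective _
      (h.surjective_phaseTime S)).symm := by
    funext y
    apply (h.strictMono_phaseTime S).injective
    rw [h.phaseTime_phase]
    exact (((h.strictMono_phaseTime S).orderIsoOfSurjective _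
      (h.surjective_phaseTime S)).apply_symm_apply y).symm
  rw [this]
  exact OrderIso.continuous _

theorem hasDerivAt_phase (h : IsForce Φ) (S t : ℝ) :
    HasDerivAt (phase Φ S) (energyInvDeriv Φ (S * Real.sin (phase Φ S t)))⁻¹ t :=
  HasDerivAt.of_local_left_inverse (h.continuous_phase S).continuousAt
    (h.hasDerivAt_phaseTime S _) (h.energyInvDeriv_pos _).ne'
    (Eventually.of_forall (h.phaseTime_phase S))

theorem hasDerivAt_orbit (h : IsForce Φ) (S t : ℝ) :
    HasDerivAt (orbit Φ S) (S * Real.cos (phase Φ S t)) t := by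
  have h1 := (h.hasDerivAt_energyInv (S * Real.sin (phase Φ S t))).comp t
    ((h.hasDerivAt_phase S t).sin.const_mul S)
  -- The derivative of `energyInv` cancels against the phase velocity, its reciprocal.
  have h2 : energyInvDeriv Φ (S * Real.sin (phase Φ S t)) * (S * (Real.cos (phase Φ S t) *
      (energyInvDeriv Φ (S * Real.sin (phase Φ S t)))⁻¹)) = S * Real.cos (phase Φ S t) := by
    have := (h.energyInvDeriv_pos (S * Real.sin (phase Φ S t))).ne'
    field_simp
  rw [h2] at h1
  exact h1

theorem hasDerivAt_velocity (h : IsForce Φ) (S t : ℝ) :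
    HasDerivAt (fun t => S * Real.cos (phase Φ S t)) (-Φ (orbit Φ S t)) t := by
  have h1 := (h.hasDerivAt_phase S t).cos.const_mul S
  have h2 : S * (-Real.sin (phase Φ S t) * (energyInvDeriv Φ (S * Real.sin (phase Φ S t)))⁻¹) =
      -Φ (orbit Φ S t) := by
    rw [orbit, ← h.div_energyInvDeriv]; ring
  rw [h2] at h1
  exact h1

theorem continuous_orbit (h : IsForce Φ) (S : ℝ) : Continuous (orbit Φ S) :=
  continuous_iff_continuousAt.2 fun t => (h.hasDerivAt_orbit S t).continuousAt

theorem nodalTime_pos (h : IsForce Φ) (S : ℝ) {j : ℕ} (hj : 0 < j) : 0 < nodalTime Φ S j := by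
  have := h.strictMono_phaseTime S (by positivity : (0 : ℝ) < j * Real.pi)
  rwa [phaseTime_zero] at this

theorem lt_nodalTime (h : IsForce Φ) {S : ℝ} (hS : S ≠ 0) {j : ℕ} (hj : 0 < j) :
    j * Real.pi < nodalTime Φ S j := by
  have hj1 : (1 : ℝ) ≤ j := by exact_mod_cast hj
  have hle : Real.pi ≤ j * Real.pi := by nlinarith [Real.pi_pos]
  -- Strictness is extracted from the first half-wave, at phase `π / 2`; the remaining phases take
  -- at least their own length.
  have h1 := h.sub_le_phaseTime_sub S hle
  have h2 : ∫ _x in (0 : ℝ)..Real.pi, (1 : ℝ) <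
      ∫ x in (0 : ℝ)..Real.pi, energyInvDeriv Φ (S * Real.sin x) := by
    refine intervalIntegral.integral_lt_integral_of_continuousOn_of_le_of_exists_lt Real.pi_pos
      continuousOn_const (h.continuous_phaseDensity S).continuousOn
      (fun x _ => h.one_le_energyInvDeriv _)
      ⟨Real.pi / 2, ⟨by positivity, by linarith [Real.pi_pos]⟩, ?_⟩
    exact h.one_lt_energyInvDeriv (by simpa using hS)
  rw [← h.phaseTime_sub, phaseTime_zero] at h2
  simp only [intervalIntegral.integral_const, smul_eq_mul] at h2
  rw [nodalTime]; linarith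

theorem nodalTime_zero_left (h : IsForce Φ) (j : ℕ) : nodalTime Φ 0 j = j * Real.pi := by
  simp [nodalTime, phaseTime, h.energyInvDeriv_zero]

/-- The orbit vanishes at both scaled end points, so extension by zero agrees with it on the closed
interval, where one-sided derivatives are taken. -/
theorem nodalSolution_eq (h : IsForce Φ) (S : ℝ) (j : ℕ) {x : ℝ} (hx : x ∈ Icc (0 : ℝ) 1) :
    nodalSolution Φ S j x = orbit Φ S (nodalTime Φ S j * x) := by
  by_cases hx' : x ∈ Ioo (0 : ℝ) 1
  · rw [nodalSolution, if_pos hx']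
  · rw [nodalSolution, if_neg hx']
    rcases hx.1.eq_or_lt with h0 | h0
    · rw [← h0, mul_zero, orbit, h.phase_zero, Real.sin_zero, mul_zero, h.energyInv_zero]
    · have h1 : x = 1 := by
        by_contra hne
        exact hx' ⟨h0, lt_of_le_of_ne hx.2 hne⟩
      rw [h1, mul_one, orbit, nodalTime, h.phase_phaseTime, Real.sin_nat_mul_pi, mul_zero,
        h.energyInv_zero]

theorem hasDerivWithinAt_nodalSolution (h : IsForce Φ) (S : ℝ) (j : ℕ) {x : ℝ}
    (hx : x ∈ Icc (0 : ℝ) 1) : HasDerivWithinAt (nodalSolution Φ S j)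
      (nodalTime Φ S j * (S * Real.cos (phase Φ S (nodalTime Φ S j * x)))) (Icc 0 1) x := by
  have h1 := (h.hasDerivAt_orbit S (nodalTime Φ S j * x)).comp x
    ((hasDerivAt_id x).const_mul (nodalTime Φ S j))
  rw [mul_one, mul_comm] at h1
  exact h1.hasDerivWithinAt.congr (fun y hy => h.nodalSolution_eq S j hy)
    (h.nodalSolution_eq S j hx)

theorem derivI_nodalSolution (h : IsForce Φ) (S : ℝ) (j : ℕ) {x : ℝ} (hx : x ∈ Icc (0 : ℝ) 1) :
    derivI (nodalSolution Φ S j) x =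
      nodalTime Φ S j * (S * Real.cos (phase Φ S (nodalTime Φ S j * x))) :=
  (h.hasDerivWithinAt_nodalSolution S j hx).derivWithin (uniqueDiffOn_Icc zero_lt_one x hx)

theorem hasDerivAt_scaledVelocity (h : IsForce Φ) (S : ℝ) (j : ℕ) (x : ℝ) :
    HasDerivAt (fun x => nodalTime Φ S j * (S * Real.cos (phase Φ S (nodalTime Φ S j * x))))
      (-(nodalTime Φ S j ^ 2 * Φ (orbit Φ S (nodalTime Φ S j * x)))) x := by
  have h1 := ((h.hasDerivAt_velocity S (nodalTime Φ S j * x)).comp x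
    ((hasDerivAt_id x).const_mul (nodalTime Φ S j))).const_mul (nodalTime Φ S j)
  have h2 : nodalTime Φ S j * (-Φ (orbit Φ S (nodalTime Φ S j * x)) * (nodalTime Φ S j * 1)) =
      -(nodalTime Φ S j ^ 2 * Φ (orbit Φ S (nodalTime Φ S j * x))) := by ring
  rw [h2] at h1
  exact h1

theorem deriv_derivI_nodalSolution (h : IsForce Φ) (S : ℝ) (j : ℕ) {x : ℝ}
    (hx : x ∈ Ioo (0 : ℝ) 1) : _root_.deriv (derivI (nodalSolution Φ S j)) x =
      -(nodalTime Φ S j ^ 2 * Φ (orbit Φ S (nodalTime Φ S j * x))) := by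
  refine ((h.hasDerivAt_scaledVelocity S j x).congr_of_eventuallyEq ?_).deriv
  filter_upwards [Icc_mem_nhds hx.1 hx.2] with y hy
  exact h.derivI_nodalSolution S j hy

theorem memH2H10_nodalSolution (h : IsForce Φ) (S : ℝ) (j : ℕ) :
    MemH2H10 (nodalSolution Φ S j) := by
  have hcont : Continuous fun x => -(nodalTime Φ S j ^ 2 * Φ (orbit Φ S (nodalTime Φ S j * x))) :=
    (continuous_const.mul (h.cont.comp ((h.continuous_orbit S).comp (by fun_prop)))).neg
  obtain ⟨C, hC⟩ := isCompact_Icc.exists_bound_of_continuousOn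
    (s := Icc (0 : ℝ) 1) hcont.continuousOn
  refine ⟨fun x hx => if_neg hx,
    fun x hx => (h.hasDerivWithinAt_nodalSolution S j hx).differentiableWithinAt, ?_, ?_⟩
  · have hlip : LipschitzOnWith (Real.toNNReal C) (derivI (nodalSolution Φ S j)) (uIcc 0 1) := by
      rw [uIcc_of_le zero_le_one]
      refine (convex_Icc 0 1).lipschitzOnWith_of_nnnorm_hasDerivWithin_le
        (f' := fun x => -(nodalTime Φ S j ^ 2 * Φ (orbit Φ S (nodalTime Φ S j * x))))
        (fun x hx => ?_) fun x hx => ?_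
      · exact (h.hasDerivAt_scaledVelocity S j x).hasDerivWithinAt.congr
          (fun y hy => h.derivI_nodalSolution S j hy) (h.derivI_nodalSolution S j hx)
      · rw [← NNReal.coe_le_coe, coe_nnnorm]
        exact (hC x hx).trans (Real.le_coe_toNNReal C)
    exact hlip.absolutelyContinuousOnInterval
  · have h1 : MemLp (fun x => -(nodalTime Φ S j ^ 2 * Φ (orbit Φ S (nodalTime Φ S j * x)))) 2
        (volume.restrict (Ioo 0 1)) :=
      MemLp.of_bound hcont.aestronglyMeasurable C
        ((ae_restrict_mem measurableSet_Ioo).mono fun x hx => hC x (Ioo_subset_Icc_self hx))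
    refine h1.ae_eq ?_
    filter_upwards [ae_restrict_mem measurableSet_Ioo] with x hx
    exact (h.deriv_derivI_nodalSolution S j hx).symm

theorem phase_mem_Icc (h : IsForce Φ) (S : ℝ) (j : ℕ) {x : ℝ} (hx : x ∈ Icc (0 : ℝ) 1) :
    phase Φ S (nodalTime Φ S j * x) ∈ Icc 0 (j * Real.pi) := by
  have h0 : 0 ≤ nodalTime Φ S j := by
    have := (h.strictMono_phaseTime S).monotone (by positivity : (0 : ℝ) ≤ j * Real.pi)
    rwa [phaseTime_zero] at this
  constructor
  · have := (h.strictMono_phase S).monotone (mul_nonneg h0 hx.1)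
    rwa [h.phase_zero] at this
  · have := (h.strictMono_phase S).monotone (mul_le_of_le_one_right h0 hx.2)
    rwa [nodalTime, h.phase_phaseTime] at this

/-- The force has to agree with `f` only on the values that the orbit takes, so orbits of a
truncated force solve the original equation. -/
theorem isStrongSolution_nodalSolution (h : IsForce Φ) {f : ℝ → ℝ} {S c lam : ℝ} {j : ℕ}
    (hc : c * nodalTime Φ S j ^ 2 = lam)
    (hf : ∀ η ∈ Icc (0 : ℝ) (j * Real.pi),
      Φ (energyInv Φ (S * Real.sin η)) = f (energyInv Φ (S * Real.sin η))) :
    IsStrongSolution c lam f (nodalSolution Φ S j) := by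
  refine ⟨h.memH2H10_nodalSolution S j, ?_⟩
  filter_upwards [ae_restrict_mem measurableSet_Ioo] with x hx
  rw [h.deriv_derivI_nodalSolution S j hx, h.nodalSolution_eq S j (Ioo_subset_Icc_self hx), orbit,
    ← hf _ (h.phase_mem_Icc S j (Ioo_subset_Icc_self hx)), ← hc]
  ring

theorem nodalSolution_eq_zero_iff (h : IsForce Φ) {S : ℝ} (hS : S ≠ 0) (j : ℕ) {x : ℝ}
    (hx : x ∈ Icc (0 : ℝ) 1) :
    nodalSolution Φ S j x = 0 ↔ Real.sin (phase Φ S (nodalTime Φ S j * x)) = 0 := by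
  rw [h.nodalSolution_eq S j hx, orbit, h.energyInv_eq_zero, mul_eq_zero, or_iff_right hS]

theorem zerosI_nodalSolution (h : IsForce Φ) {S : ℝ} (hS : S ≠ 0) {j : ℕ} (hj : 0 < j) :
    zerosI (nodalSolution Φ S j) =
      (fun i : ℕ => phaseTime Φ S (i * Real.pi) / nodalTime Φ S j) '' Iio (j + 1) := by
  have hT := h.nodalTime_pos S hj
  ext x
  constructor
  · rintro ⟨hx, hx0⟩
    rw [h.nodalSolution_eq_zero_iff hS j hx, Real.sin_eq_zero_iff] at hx0
    obtain ⟨n, hn⟩ := hx0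
    have hmem := h.phase_mem_Icc S j hx
    rw [← hn] at hmem
    have hn0 : 0 ≤ n := by
      have := nonneg_of_mul_nonneg_left hmem.1 Real.pi_pos
      exact_mod_cast this
    lift n to ℕ using hn0
    have hnj : n ≤ j := by
      have := le_of_mul_le_mul_right hmem.2 Real.pi_pos
      exact_mod_cast this
    refine ⟨n, by simp; omega, ?_⟩
    simp only
    push_cast at hn
    rw [hn, h.phaseTime_phase, mul_div_cancel_left₀ _ hT.ne']
  · rintro ⟨n, hn, rfl⟩
    simp only [mem_Iio] at hn
    have hnj : (n : ℝ) ≤ j := by exact_mod_cast Nat.lt_succ_iff.1 hn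
    have h1 : 0 ≤ phaseTime Φ S (n * Real.pi) := by
      have := (h.strictMono_phaseTime S).monotone (by positivity : (0 : ℝ) ≤ n * Real.pi)
      rwa [phaseTime_zero] at this
    have h2 : phaseTime Φ S (n * Real.pi) ≤ nodalTime Φ S j :=
      (h.strictMono_phaseTime S).monotone (by nlinarith [Real.pi_pos])
    have hx : phaseTime Φ S (n * Real.pi) / nodalTime Φ S j ∈ Icc (0 : ℝ) 1 :=
      ⟨div_nonneg h1 hT.le, (div_le_one hT).2 h2⟩
    refine ⟨hx, ?_⟩
    rw [h.nodalSolution_eq_zero_iff hS j hx, mul_div_cancel₀ _ hT.ne', h.phase_phaseTime,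
      Real.sin_nat_mul_pi]

theorem ncard_zerosI_nodalSolution (h : IsForce Φ) {S : ℝ} (hS : S ≠ 0) {j : ℕ} (hj : 0 < j) :
    (zerosI (nodalSolution Φ S j)).ncard = j + 1 := by
  have hT := h.nodalTime_pos S hj
  rw [h.zerosI_nodalSolution hS hj, ncard_image_of_injective]
  · rw [← Finset.coe_Iio, ncard_coe_finset, Nat.card_Iio]
  · intro m n hmn
    have h1 := (h.strictMono_phaseTime S).injective ((div_left_inj' hT.ne').1 hmn)
    exact_mod_cast mul_right_cancel₀ Real.pi_ne_zero h1

theorem nodalSolution_simple (h : IsForce Φ) {S : ℝ} (hS : S ≠ 0) {j : ℕ} (hj : 0 < j) {x : ℝ}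
    (hx : x ∈ zerosI (nodalSolution Φ S j)) : derivI (nodalSolution Φ S j) x ≠ 0 := by
  have h1 := (h.nodalSolution_eq_zero_iff hS j hx.1).1 hx.2
  rw [h.derivI_nodalSolution S j hx.1]
  refine mul_ne_zero (h.nodalTime_pos S hj).ne' (mul_ne_zero hS fun h2 => ?_)
  have := Real.sin_sq_add_cos_sq (phase Φ S (nodalTime Φ S j * x))
  rw [h1, h2] at this
  norm_num at this

theorem sign_nodalSolution (h : IsForce Φ) {S : ℝ} {j : ℕ} (hj : 0 < j) {σ : ℤˣ}
    (hS : 0 < ((σ : ℤ) : ℝ) * S) :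
    ∀ᶠ x in 𝓝[>] (0 : ℝ), 0 < ((σ : ℤ) : ℝ) * nodalSolution Φ S j x := by
  have h1 : Continuous fun x => phase Φ S (nodalTime Φ S j * x) :=
    (h.continuous_phase S).comp (by fun_prop)
  have h2 : ∀ᶠ x in 𝓝[>] (0 : ℝ), phase Φ S (nodalTime Φ S j * x) < Real.pi := by
    refine (h1.tendsto 0).mono_left nhdsWithin_le_nhds |>.eventually (gt_mem_nhds ?_)
    rw [mul_zero, h.phase_zero]; exact Real.pi_pos
  filter_upwards [h2, Ioo_mem_nhdsGT (zero_lt_one' ℝ)] with x hx hx01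
  have h3 : 0 < phase Φ S (nodalTime Φ S j * x) := by
    have := h.strictMono_phase S (mul_pos (h.nodalTime_pos S hj) hx01.1)
    rwa [h.phase_zero] at this
  have h4 := Real.sin_pos_of_pos_of_lt_pi h3 hx
  rw [nodalSolution, if_pos hx01, orbit]
  rcases Int.units_eq_one_or σ with rfl | rfl
  · simp only [Units.val_one, Int.cast_one, one_mul] at *
    rw [← h.energyInv_zero]
    exact h.strictMono_energyInv (mul_pos hS h4)
  · simp only [Units.val_neg, Units.val_one, Int.cast_neg, Int.cast_one, neg_mul, one_mul,
      Left.neg_pos_iff] at *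
    rw [← h.energyInv_zero]
    exact h.strictMono_energyInv (mul_neg_of_neg_of_pos hS h4)

theorem isBranch_nodalSolution (h : IsForce Φ) {f a : ℝ → ℝ} {S d lam : ℝ} {j : ℕ} (hj : 0 < j)
    {σ : ℤˣ} (hS : 0 < ((σ : ℤ) : ℝ) * S) (hc : a d * nodalTime Φ S j ^ 2 = lam)
    (hf : ∀ η ∈ Icc (0 : ℝ) (j * Real.pi),
      Φ (energyInv Φ (S * Real.sin η)) = f (energyInv Φ (S * Real.sin η))) :
    IsBranch a lam f d σ j (nodalSolution Φ S j) := by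
  have hS0 : S ≠ 0 := by rintro rfl; simp at hS
  exact ⟨h.isStrongSolution_nodalSolution hc hf, h.ncard_zerosI_nodalSolution hS0 hj,
    fun x hx => h.nodalSolution_simple hS0 hj hx, h.sign_nodalSolution hj hS⟩

/-! ### Norms of the explicit solutions -/

/-- Substitution `x = t(η) / t(b)`, with `t` the phase time. Integrals of the scaled orbit become
phase integrals whose dependence on `S` is explicit, which yields continuity and monotonicity of the
norms. -/
theorem integral_comp_phase (h : IsForce Φ) (S : ℝ) {b : ℝ} (hb : 0 < b) {G : ℝ → ℝ}
    (hG : Continuous G) : ∫ x in (0 : ℝ)..1, G (phase Φ S (phaseTime Φ S b * x)) =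
      (∫ η in (0 : ℝ)..b, G η * energyInvDeriv Φ (S * Real.sin η)) / phaseTime Φ S b := by
  have hT : phaseTime Φ S b ≠ 0 := by
    have := h.strictMono_phaseTime S hb
    rw [phaseTime_zero] at this
    exact this.ne'
  have h1 := intervalIntegral.integral_comp_mul_deriv (a := 0) (b := b)
    (f := fun η => phaseTime Φ S η / phaseTime Φ S b)
    (f' := fun η => energyInvDeriv Φ (S * Real.sin η) / phaseTime Φ S b)
    (g := fun x => G (phase Φ S (phaseTime Φ S b * x)))
    (fun η _ => (h.hasDerivAt_phaseTime S η).div_const _)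
    ((h.continuous_phaseDensity S).div_const _).continuousOn
    (hG.comp ((h.continuous_phase S).comp (by fun_prop)))
  simp only [Function.comp_apply, phaseTime_zero, zero_div, mul_div_cancel₀ _ hT,
    h.phase_phaseTime, div_self hT] at h1
  rw [← h1, ← intervalIntegral.integral_div]
  simp only [mul_div_assoc]

theorem integral_derivI_sq_nodalSolution (h : IsForce Φ) (S : ℝ) {j : ℕ} (hj : 0 < j) :
    ∫ x in (0 : ℝ)..1, derivI (nodalSolution Φ S j) x ^ 2 = nodalTime Φ S j *
      ∫ η in (0 : ℝ)..(j * Real.pi), (S * Real.cos η) ^ 2 * energyInvDeriv Φ (S * Real.sin η) := by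
  have hT := (h.nodalTime_pos S hj).ne'
  have h1 : ∫ x in (0 : ℝ)..1, derivI (nodalSolution Φ S j) x ^ 2 = ∫ x in (0 : ℝ)..1,
      (fun η => (nodalTime Φ S j * (S * Real.cos η)) ^ 2) (phase Φ S (nodalTime Φ S j * x)) := by
    refine intervalIntegral.integral_congr fun x hx => ?_
    rw [uIcc_of_le zero_le_one] at hx
    simp only [h.derivI_nodalSolution S j hx]
  have h2 := h.integral_comp_phase S (b := j * Real.pi) (by positivity)
    (G := fun η => (nodalTime Φ S j * (S * Real.cos η)) ^ 2) (by fun_prop)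
  rw [h1]
  refine h2.trans ?_
  rw [← nodalTime, div_eq_iff hT]
  simp only [mul_pow _ (S * Real.cos _), mul_assoc (nodalTime Φ S j ^ 2)]
  rw [intervalIntegral.integral_const_mul]
  ring

theorem integral_abs_rpow_nodalSolution (h : IsForce Φ) (S : ℝ) {j : ℕ} (hj : 0 < j) {p : ℝ}
    (hp : 0 ≤ p) : ∫ x in (0 : ℝ)..1, |nodalSolution Φ S j x| ^ p =
      (∫ η in (0 : ℝ)..(j * Real.pi), |energyInv Φ (S * Real.sin η)| ^ p *
        energyInvDeriv Φ (S * Real.sin η)) / nodalTime Φ S j := by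
  refine Eq.trans ?_ (h.integral_comp_phase S (b := j * Real.pi) (by positivity)
    (G := fun η => |energyInv Φ (S * Real.sin η)| ^ p)
    ((h.continuous_energyInv.comp (by fun_prop)).abs.rpow_const fun _ => Or.inr hp))
  refine intervalIntegral.integral_congr fun x hx => ?_
  rw [uIcc_of_le zero_le_one] at hx
  simp only [h.nodalSolution_eq S j hx, orbit, nodalTime]

theorem continuous_nodalTime (h : IsForce Φ) (j : ℕ) : Continuous fun S => nodalTime Φ S j := by
  refine intervalIntegral.continuous_parametric_intervalIntegral_of_continuous' ?_ _ _
  exact h.continuous_energyInvDeriv.comp (by fun_prop)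

theorem continuous_functional_nodalSolution (h : IsForce Φ) {l : (ℝ → ℝ) → ℝ}
    (hl : IsH10Functional l ∨ IsLpFunctional l) {j : ℕ} (hj : 0 < j) :
    Continuous fun S => l (nodalSolution Φ S j) := by
  have hT : ∀ S, nodalTime Φ S j ≠ 0 := fun S => (h.nodalTime_pos S hj).ne'
  rcases hl with ⟨r, hr, hl⟩ | ⟨p, r, hp, hr, hl⟩
  · simp only [hl, h10Norm, h.integral_derivI_sq_nodalSolution _ hj]
    refine Continuous.rpow_const (Continuous.sqrt ((h.continuous_nodalTime j).mul ?_))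
      fun _ => Or.inr hr.le
    refine intervalIntegral.continuous_parametric_intervalIntegral_of_continuous' ?_ _ _
    exact Continuous.mul (by fun_prop) (h.continuous_energyInvDeriv.comp (by fun_prop))
  · have hp0 : 0 ≤ p := by linarith
    simp only [hl, lpNormI, h.integral_abs_rpow_nodalSolution _ hj hp0]
    refine Continuous.rpow_const (Continuous.rpow_const (Continuous.div₀ ?_
      (h.continuous_nodalTime j) hT) fun _ => Or.inr (by positivity)) fun _ => Or.inr hr.le
    refine intervalIntegral.continuous_parametric_intervalIntegral_of_continuous' ?_ _ _
    exact Continuous.mul (((h.continuous_energyInv.comp (by fun_prop)).abs).rpow_const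
      fun _ => Or.inr hp0) (h.continuous_energyInvDeriv.comp (by fun_prop))

theorem nodalSolution_zero_left (h : IsForce Φ) (j : ℕ) : nodalSolution Φ 0 j = 0 := by
  funext x
  simp [nodalSolution, orbit, h.energyInv_zero]

end IsForce

theorem functional_zero {l : (ℝ → ℝ) → ℝ} (hl : IsH10Functional l ∨ IsLpFunctional l) :
    l 0 = 0 := by
  rcases hl with ⟨r, hr, hl⟩ | ⟨p, r, hp, hr, hl⟩
  · have : derivI 0 = 0 := by funext x; simp [derivI]
    simp [hl, h10Norm, this, Real.zero_rpow hr.ne']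
  · have hp0 : p ≠ 0 := by linarith
    simp [hl, lpNormI, Real.zero_rpow hr.ne', Real.zero_rpow hp0,
      Real.zero_rpow (inv_ne_zero hp0)]

theorem functional_nonneg {l : (ℝ → ℝ) → ℝ} (hl : IsH10Functional l ∨ IsLpFunctional l)
    (u : ℝ → ℝ) : 0 ≤ l u := by
  rcases hl with ⟨r, hr, hl⟩ | ⟨p, r, hp, hr, hl⟩
  · rw [hl, h10Norm]; positivity
  · rw [hl, lpNormI]
    refine Real.rpow_nonneg (Real.rpow_nonneg ?_ _) _
    exact intervalIntegral.integral_nonneg zero_le_one fun x _ => by positivity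

/-! ### Monotonicity of the time map -/

/-- Equivalently, `Φ² / F` decreases strictly. If `Φ v ≤ Φ u` this holds because `F` increases.
Otherwise `Φ` is compared with the secant line through `u` and `v`, of slope `m > 0`: concavity puts
`Φ` below it on `[0, u]` and above it on `[u, v]`. A line `ℓ` satisfies `(ℓ²)' = 2mℓ`, so `2m F(u) ≤
Φ(u)² - ℓ(0)²` and `2m (F(v) - F(u)) ≥ Φ(v)² - Φ(u)²`, which combine to the claim. -/
theorem HalfForce.energyCoordDeriv_lt {Φ : ℝ → ℝ} (h : HalfForce Φ) (hc : Continuous Φ) {M : ℝ}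
    (hcon : ConcaveOn ℝ (Icc 0 M) Φ) {u v : ℝ} (hu : 0 < u) (huv : u < v) (hv : v ≤ M)
    (hanti : Φ v * u < Φ u * v) : energyCoordDeriv Φ v < energyCoordDeriv Φ u := by
  have hv0 : 0 < v := hu.trans huv
  have hFu := h.potential_pos hc hu
  have hΦu := h.pos u hu
  have hΦv := h.pos v hv0
  have key : potential Φ u * Φ v ^ 2 < potential Φ v * Φ u ^ 2 := by
    have hmono : potential Φ u < potential Φ v := by
      have h1 : ∫ _x in u..v, (0 : ℝ) < ∫ x in u..v, Φ x :=
        intervalIntegral.integral_lt_integral_of_continuousOn_of_le_of_exists_lt huv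
          continuousOn_const hc.continuousOn (fun x hx => (h.pos x (hu.trans hx.1)).le)
          ⟨v, right_mem_Icc.2 huv.le, hΦv⟩
      rw [← potential_sub hc] at h1
      simp at h1
      exact h1
    rcases le_or_gt (Φ v) (Φ u) with hle | hlt
    · have : Φ v ^ 2 ≤ Φ u ^ 2 := pow_le_pow_left₀ hΦv.le hle 2
      have h3 : 0 < Φ u ^ 2 := by positivity
      nlinarith
    · set m := (Φ v - Φ u) / (v - u) with hm
      have hvu : 0 < v - u := by linarith
      have hm0 : 0 < m := div_pos (by linarith) hvu
      have hmv : m * (v - u) = Φ v - Φ u := div_mul_cancel₀ _ hvu.ne'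
      have hlow : ∀ x ∈ Icc (0 : ℝ) u, Φ x ≤ Φ u + m * (x - u) := by
        intro x hx
        rcases hx.2.eq_or_lt with hxu | hxu
        · simp [hxu]
        · have := hcon.slope_anti_adjacent (x := x) (y := u) (z := v)
            ⟨hx.1, by linarith⟩ ⟨hv0.le, hv⟩ hxu huv
          rw [← hm, le_div_iff₀ (by linarith)] at this
          linarith
      have hup : ∀ x ∈ Icc u v, Φ u + m * (x - u) ≤ Φ x := by
        intro x hx
        rcases hx.1.eq_or_lt with hxu | hxu
        · simp [← hxu]
        rcases hx.2.eq_or_lt with hxv | hxv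
        · rw [hxv]; linarith
        · have := hcon.slope_anti_adjacent (x := u) (y := x) (z := v)
            ⟨hu.le, by linarith⟩ ⟨hv0.le, hv⟩ hxu hxv
          rw [div_le_div_iff₀ (by linarith) (by linarith)] at this
          have h5 : (Φ u + m * (x - u)) * (v - u) ≤ Φ x * (v - u) := by
            have : (Φ u + m * (x - u)) * (v - u) = Φ u * (v - u) + (Φ v - Φ u) * (x - u) := by
              rw [← hmv]; ring
            rw [this]; nlinarith
          exact le_of_mul_le_mul_right h5 hvu
      have hint : ∀ a b : ℝ, ∫ x in a..b, (Φ u + m * (x - u)) =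
          Φ u * (b - a) + m * ((b - u) ^ 2 - (a - u) ^ 2) / 2 := by
        intro a b
        rw [intervalIntegral.integral_eq_sub_of_hasDerivAt
          (f := fun x => Φ u * x + m * (x - u) ^ 2 / 2)]
        · ring
        · intro x _
          have h1 := ((hasDerivAt_id x).const_mul (Φ u)).add
            (((((hasDerivAt_id x).sub_const u).pow 2).const_mul m).div_const 2)
          refine h1.congr_deriv ?_
          simp; ring
        · exact (by fun_prop : Continuous fun x => Φ u + m * (x - u)).intervalIntegrable _ _
      have hcl : ∀ a b : ℝ, IntervalIntegrable (fun x => Φ u + m * (x - u)) volume a b :=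
        fun a b => (by fun_prop : Continuous fun x => Φ u + m * (x - u)).intervalIntegrable _ _
      have i1 : potential Φ u ≤ Φ u * u - m * u ^ 2 / 2 := by
        have := intervalIntegral.integral_mono_on hu.le (hc.intervalIntegrable _ _) (hcl 0 u) hlow
        rw [hint] at this
        simp only [potential]; linarith
      have i2 : (Φ u + Φ v) * (v - u) / 2 ≤ potential Φ v - potential Φ u := by
        have := intervalIntegral.integral_mono_on huv.le (hcl u v) (hc.intervalIntegrable _ _) hup
        rw [hint, ← potential_sub hc] at this
        have e : (Φ u + Φ v) * (v - u) / 2 =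
            Φ u * (v - u) + m * ((v - u) ^ 2 - (u - u) ^ 2) / 2 := by
          have : m * ((v - u) ^ 2 - (u - u) ^ 2) = (Φ v - Φ u) * (v - u) := by rw [← hmv]; ring
          rw [this]; ring
        linarith
      -- The secant line has positive value at `0`; this is where `hanti` enters, and it makes the
      -- next inequality strict.
      have hpos : 0 < Φ u - m * u := by
        have : (Φ u - m * u) * (v - u) = Φ u * v - Φ v * u := by
          have : m * u * (v - u) = (Φ v - Φ u) * u := by rw [← hmv]; ring
          linear_combination -this
        exact pos_of_mul_pos_left (by rw [this]; linarith) hvu.le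
      have j1 : 2 * m * potential Φ u < Φ u ^ 2 := by nlinarith [sq_pos_of_pos hpos]
      have j2 : Φ v ^ 2 - Φ u ^ 2 ≤ 2 * m * (potential Φ v - potential Φ u) := by
        have : 2 * m * ((Φ u + Φ v) * (v - u) / 2) = Φ v ^ 2 - Φ u ^ 2 := by
          linear_combination (Φ u + Φ v) * hmv
        nlinarith
      have j3 : 0 < Φ v ^ 2 - Φ u ^ 2 := by nlinarith
      have k1 : 2 * m * potential Φ u * (Φ v ^ 2 - Φ u ^ 2) < Φ u ^ 2 * (Φ v ^ 2 - Φ u ^ 2) :=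
        mul_lt_mul_of_pos_right j1 j3
      have k2 : (Φ v ^ 2 - Φ u ^ 2) * Φ u ^ 2 ≤
          2 * m * (potential Φ v - potential Φ u) * Φ u ^ 2 :=
        mul_le_mul_of_nonneg_right j2 (by positivity)
      have k3 : 2 * m * (potential Φ u * Φ v ^ 2) < 2 * m * (potential Φ v * Φ u ^ 2) := by
        linarith
      exact lt_of_mul_lt_mul_left k3 (by positivity)
  have hu' := h.energyCoord_pos hc hu
  have hv' := h.energyCoord_pos hc hv0
  rw [energyCoordDeriv, energyCoordDeriv, if_neg hu.ne', if_neg hv0.ne', div_lt_div_iff₀ hv' hu']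
  refine lt_of_pow_lt_pow_left₀ 2 (by positivity) ?_
  rw [mul_pow, mul_pow, h.energyCoord_sq hc hu, h.energyCoord_sq hc hv0]
  linarith

theorem HalfReaction.energyInvDeriv_lt {f Φ : ℝ → ℝ} (hf : HalfReaction f) (h : IsForce Φ) {M : ℝ}
    (hΦ : ∀ u ∈ Icc 0 M, Φ u = f u) {y r : ℝ} (hy : 0 < y) (hyM : energyInv Φ y ≤ M)
    (hr : 0 ≤ r) (hr1 : r < 1) : energyInvDeriv Φ (r * y) < energyInvDeriv Φ y := by
  rcases hr.eq_or_lt with h0 | h0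
  · rw [← h0, zero_mul, h.energyInvDeriv_zero]
    exact h.one_lt_energyInvDeriv hy.ne'
  · have h1 : 0 < energyInv Φ (r * y) := by
      have := h.strictMono_energyInv (mul_pos h0 hy)
      rwa [h.energyInv_zero] at this
    have h2 : energyInv Φ (r * y) < energyInv Φ y :=
      h.strictMono_energyInv (by nlinarith)
    rw [energyInvDeriv, energyInvDeriv, inv_lt_inv₀ (h.energyCoordDeriv_pos _)
      (h.energyCoordDeriv_pos _)]
    refine h.half.energyCoordDeriv_lt h.cont (M := M) ?_ h1 h2 hyM ?_
    · exact ((hf.concave.subset (fun x hx => hx.1) (convex_Icc 0 M))).congr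
        fun x hx => (hΦ x hx).symm
    · rw [hΦ _ ⟨h1.le, h2.le.trans hyM⟩, hΦ _ ⟨h1.le.trans h2.le, hyM⟩]
      exact hf.anti _ _ h1 h2

theorem Reaction.energyInvDeriv_lt {f Φ : ℝ → ℝ} (hf : Reaction f) (h : IsForce Φ) {N M : ℝ}
    (hN : 0 ≤ N) (hM : 0 ≤ M) (hΦ : ∀ u ∈ Icc (-N) M, Φ u = f u) {y r : ℝ} (hy : y ≠ 0)
    (hyM : energyInv Φ y ∈ Icc (-N) M) (hr : 0 ≤ r) (hr1 : r < 1) :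
    energyInvDeriv Φ (r * y) < energyInvDeriv Φ y := by
  rcases hy.lt_or_gt with hy | hy
  · have := hf.neg.energyInvDeriv_lt h.reflect (M := N) (y := -y) (r := r)
      (fun u hu => by
        simp only [oddReflect]
        rw [hΦ]
        exact ⟨by linarith [hu.2], by linarith [hu.1]⟩) (by linarith)
      (by rw [h.energyInv_oddReflect, neg_neg]; linarith [hyM.1]) hr hr1
    rw [h.energyInvDeriv_oddReflect, h.energyInvDeriv_oddReflect] at this
    simpa using this
  · exact hf.pos.energyInvDeriv_lt h (fun u hu => hΦ u ⟨by linarith [hu.1], hu.2⟩) hy hyM.2 hr hr1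

theorem Reaction.energyInvDeriv_le {f Φ : ℝ → ℝ} (hf : Reaction f) (h : IsForce Φ) {N M : ℝ}
    (hN : 0 ≤ N) (hM : 0 ≤ M) (hΦ : ∀ u ∈ Icc (-N) M, Φ u = f u) {y r : ℝ}
    (hyM : energyInv Φ y ∈ Icc (-N) M) (hr : 0 ≤ r) (hr1 : r ≤ 1) :
    energyInvDeriv Φ (r * y) ≤ energyInvDeriv Φ y := by
  rcases hr1.eq_or_lt with h1 | h1
  · rw [h1, one_mul]
  rcases eq_or_ne y 0 with hy | hy
  · rw [hy, mul_zero]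
  · exact (hf.energyInvDeriv_lt h hN hM hΦ hy hyM hr h1).le

theorem Reaction.nodalTime_lt {f Φ : ℝ → ℝ} (hf : Reaction f) (h : IsForce Φ) {N M : ℝ}
    (hN : 0 ≤ N) (hM : 0 ≤ M) (hΦ : ∀ u ∈ Icc (-N) M, Φ u = f u) {S r : ℝ} {j : ℕ} (hj : 0 < j)
    (hS : S ≠ 0) (hSM : ∀ η ∈ Icc (0 : ℝ) (j * Real.pi),
      energyInv Φ (S * Real.sin η) ∈ Icc (-N) M) (hr : 0 ≤ r) (hr1 : r < 1) :
    nodalTime Φ (r * S) j < nodalTime Φ S j := by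
  have hj1 : (1 : ℝ) ≤ j := by exact_mod_cast hj
  have hπ := Real.pi_pos
  refine intervalIntegral.integral_lt_integral_of_continuousOn_of_le_of_exists_lt (by positivity)
    (h.continuous_phaseDensity _).continuousOn (h.continuous_phaseDensity _).continuousOn
    (fun η hη => ?_) ⟨Real.pi / 2, ⟨by positivity, by nlinarith⟩, ?_⟩
  · rw [mul_assoc]
    exact hf.energyInvDeriv_le h hN hM hΦ (hSM η ⟨hη.1.le, hη.2⟩) hr hr1.le
  · rw [mul_assoc]
    exact hf.energyInvDeriv_lt h hN hM hΦ (by simpa using hS)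
      (hSM _ ⟨by positivity, by nlinarith⟩) hr hr1

/-- The squared norm is `T(S) ∫ (S cos η)² g(S sin η) dη`, and each of the three factors is
non-decreasing in `|S|`. -/
theorem Reaction.h10Norm_nodalSolution_le {f Φ : ℝ → ℝ} (hf : Reaction f) (h : IsForce Φ)
    {N M : ℝ} (hN : 0 ≤ N) (hM : 0 ≤ M) (hΦ : ∀ u ∈ Icc (-N) M, Φ u = f u) {S r : ℝ} {j : ℕ}
    (hj : 0 < j) (hSM : ∀ η ∈ Icc (0 : ℝ) (j * Real.pi),
      energyInv Φ (S * Real.sin η) ∈ Icc (-N) M) (hr : 0 ≤ r) (hr1 : r ≤ 1) :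
    h10Norm (nodalSolution Φ (r * S) j) ≤ h10Norm (nodalSolution Φ S j) := by
  have hπ := Real.pi_pos
  have hT : nodalTime Φ (r * S) j ≤ nodalTime Φ S j := by
    refine intervalIntegral.integral_mono_on (by positivity)
      ((h.continuous_phaseDensity _).intervalIntegrable _ _)
      ((h.continuous_phaseDensity _).intervalIntegrable _ _) fun η hη => ?_
    rw [mul_assoc]
    exact hf.energyInvDeriv_le h hN hM hΦ (hSM η hη) hr hr1
  rw [h10Norm, h10Norm, h.integral_derivI_sq_nodalSolution _ hj,
    h.integral_derivI_sq_nodalSolution _ hj]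
  refine Real.sqrt_le_sqrt (mul_le_mul hT ?_ ?_ (h.nodalTime_pos S hj).le)
  · have hcont : ∀ S, Continuous fun η =>
        (S * Real.cos η) ^ 2 * energyInvDeriv Φ (S * Real.sin η) := fun S =>
      Continuous.mul (by fun_prop) (h.continuous_phaseDensity S)
    refine intervalIntegral.integral_mono_on (by positivity) ((hcont _).intervalIntegrable _ _)
      ((hcont _).intervalIntegrable _ _) fun η hη => ?_
    refine mul_le_mul ?_ ?_ (h.energyInvDeriv_pos _).le (sq_nonneg _)
    · rw [mul_assoc, mul_pow]
      exact mul_le_of_le_one_left (sq_nonneg _) (pow_le_one₀ hr hr1)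
    · rw [mul_assoc]
      exact hf.energyInvDeriv_le h hN hM hΦ (hSM η hη) hr hr1
  · exact intervalIntegral.integral_nonneg (by positivity) fun η _ =>
      mul_nonneg (sq_nonneg _) (h.energyInvDeriv_pos _).le

/-! ### Long arches -/

/-- The speed at position `u` is `√(2(F(M) - F(u)))`. If `Ψ'` times the speed is at most `1`, then
time minus `Ψ` of the position is non-decreasing while the orbit climbs from `u₀` to its peak `M`. A
comparison function thus bounds the travel time from below without the improper integral of the
reciprocal speed. -/
theorem IsForce.sub_le_archTime {Φ : ℝ → ℝ} (h : IsForce Φ) {u₀ M : ℝ} (hu₀ : 0 ≤ u₀)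
    (hM : u₀ < M) {Ψ Ψ' : ℝ → ℝ} (hΨ : ∀ u ∈ Icc u₀ M, HasDerivAt Ψ (Ψ' u) u)
    (hb : ∀ u ∈ Icc u₀ M, Ψ' u ^ 2 * (2 * (potential Φ M - potential Φ u)) ≤ 1) :
    Ψ M - Ψ u₀ ≤ phaseTime Φ (energyCoord Φ M) Real.pi := by
  set S := energyCoord Φ M with hS
  have hM0 : 0 < M := hu₀.trans_lt hM
  have hS0 : 0 < S := h.half.energyCoord_pos h.cont hM0
  have hπ := Real.pi_pos
  have hy0 : 0 ≤ energyCoord Φ u₀ / S := by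
    refine div_nonneg ?_ hS0.le
    have := h.strictMono_energyCoord.monotone hu₀
    rwa [energyCoord_zero] at this
  have hy1 : energyCoord Φ u₀ / S ≤ 1 :=
    (div_le_one hS0).2 (h.strictMono_energyCoord hM).le
  set η₀ := Real.arcsin (energyCoord Φ u₀ / S) with hη₀
  have hη0 : 0 ≤ η₀ := Real.arcsin_nonneg.2 hy0
  have hη1 : η₀ ≤ Real.pi / 2 := Real.arcsin_le_pi_div_two _
  have hsin0 : S * Real.sin η₀ = energyCoord Φ u₀ := by
    rw [hη₀, Real.sin_arcsin (by linarith) hy1, mul_div_cancel₀ _ hS0.ne']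
  have hmem : ∀ η ∈ Icc η₀ (Real.pi / 2), energyInv Φ (S * Real.sin η) ∈ Icc u₀ M := by
    intro η hη
    constructor
    · rw [← h.energyInv_energyCoord u₀, ← hsin0]
      refine h.strictMono_energyInv.monotone (mul_le_mul_of_nonneg_left ?_ hS0.le)
      exact Real.sin_le_sin_of_le_of_le_pi_div_two (by linarith) hη.2 hη.1
    · conv_rhs => rw [← h.energyInv_energyCoord M]
      exact h.strictMono_energyInv.monotone (mul_le_of_le_one_right hS0.le (Real.sin_le_one _))
  have hderiv : ∀ η ∈ Icc η₀ (Real.pi / 2),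
      HasDerivAt (fun η => phaseTime Φ S η - Ψ (energyInv Φ (S * Real.sin η)))
        (energyInvDeriv Φ (S * Real.sin η) - Ψ' (energyInv Φ (S * Real.sin η)) *
          (energyInvDeriv Φ (S * Real.sin η) * (S * Real.cos η))) η := fun η hη =>
    (h.hasDerivAt_phaseTime S η).sub ((hΨ _ (hmem η hη)).comp η
      ((h.hasDerivAt_energyInv _).comp η ((Real.hasDerivAt_sin η).const_mul S)))
  have hmono : MonotoneOn (fun η => phaseTime Φ S η - Ψ (energyInv Φ (S * Real.sin η)))
      (Icc η₀ (Real.pi / 2)) := by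
    refine monotoneOn_of_hasDerivWithinAt_nonneg (convex_Icc _ _)
      (fun η hη => (hderiv η hη).continuousAt.continuousWithinAt)
      (fun η hη => (hderiv η (interior_subset hη)).hasDerivWithinAt) fun η hη => ?_
    have hη' := interior_subset hη
    have hsq : (Ψ' (energyInv Φ (S * Real.sin η)) * (S * Real.cos η)) ^ 2 ≤ 1 := by
      have h1 := hb _ (hmem η hη')
      rw [mul_sub, ← h.energyCoord_sq, ← h.energyCoord_sq, h.energyCoord_energyInv, ← hS] at h1
      have h2 : (S * Real.cos η) ^ 2 = S ^ 2 - (S * Real.sin η) ^ 2 := by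
        rw [mul_pow, mul_pow, Real.cos_sq']; ring
      rwa [mul_pow, h2]
    have h3 := le_of_abs_le ((sq_le_one_iff_abs_le_one _).1 hsq)
    have h4 := mul_le_of_le_one_right (h.energyInvDeriv_pos (S * Real.sin η)).le h3
    linarith
  have h5 := hmono (left_mem_Icc.2 hη1) (right_mem_Icc.2 hη1) hη1
  simp only [hsin0, Real.sin_pi_div_two, mul_one, h.energyInv_energyCoord] at h5
  rw [hS, h.energyInv_energyCoord, ← hS] at h5
  have h6 := (h.strictMono_phaseTime S).monotone hη0
  rw [phaseTime_zero] at h6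
  have h7 := (h.strictMono_phaseTime S).monotone (by linarith : Real.pi / 2 ≤ Real.pi)
  linarith

/-- If `f` has a positive zero `z`, orbits peaking just below `z` linger near this equilibrium.
Otherwise `f > 0` on `(0, ∞)`, and `f x ≤ ε x` for large `x` makes high arches slow. The bound
covers every force equal to `f` on `[0, M]`, because the truncation also involves a level on the
negative side. -/
theorem HalfReaction.exists_long_arch {f : ℝ → ℝ} (hf : HalfReaction f) {Λ : ℝ} (hΛ : 0 < Λ) :
    ∃ M : ℝ, 0 < M ∧ 0 < f M ∧ ∀ Φ : ℝ → ℝ, IsForce Φ → (∀ u ∈ Icc 0 M, Φ u = f u) →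
      Λ ≤ phaseTime Φ (energyCoord Φ M) Real.pi := by
  by_cases hz' : ∃ z : ℝ, 0 < z ∧ f z = 0
  · obtain ⟨z, hz, hfz⟩ := hz'
    obtain ⟨C, hC, hlip⟩ := hf.exists_lipschitz hz.le
    set L := C + 1 with hL
    have hL0 : 0 < L := by linarith
    have hfL : ∀ u ∈ Icc 0 z, f u ≤ L * (z - u) := by
      intro u hu
      have h1 := hlip u hu z ⟨hz.le, le_rfl⟩
      rw [hfz, sub_zero, abs_sub_comm u z, abs_of_nonneg (by linarith [hu.2] : 0 ≤ z - u)] at h1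
      have h2 := (le_abs_self _).trans h1
      have h3 : C * (z - u) ≤ L * (z - u) :=
        mul_le_mul_of_nonneg_right (by linarith) (by linarith [hu.2])
      linarith
    -- The speed is at most `√L (z - u)`, so `Ψ = -log(z - u) / √L` is admissible; between `0` and
    -- `z - z E` it gains `-log E / √L`, which is `Λ` for this `E`.
    set E := Real.exp (-(Λ * √L)) with hE
    have hE0 : 0 < E := Real.exp_pos _
    have hE1 : E < 1 := by
      rw [hE, Real.exp_lt_one_iff, neg_neg_iff_pos]
      exact mul_pos hΛ (Real.sqrt_pos.2 hL0)
    have hzE : 0 < z * E := mul_pos hz hE0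
    have hM0 : 0 < z - z * E := by nlinarith
    refine ⟨z - z * E, hM0, ?_, fun Φ h hΦ => ?_⟩
    · have := hf.anti (z - z * E) z hM0 (by linarith)
      rw [hfz, zero_mul] at this
      exact pos_of_mul_pos_left this hz.le
    · have h1 := h.sub_le_archTime (u₀ := 0) (M := z - z * E) le_rfl hM0
        (Ψ := fun u => -Real.log (z - u) / √L) (Ψ' := fun u => 1 / (z - u) / √L) ?_ ?_
      · refine le_trans (le_of_eq ?_) h1
        simp only [sub_sub_cancel, sub_zero]
        rw [Real.log_mul hz.ne' hE0.ne', hE, Real.log_exp]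
        have := (Real.sqrt_pos.2 hL0).ne'
        field_simp
        ring
      · intro u hu
        have hne : z - u ≠ 0 := by linarith [hu.2]
        have h2 := ((((hasDerivAt_id u).const_sub z).log hne).neg.div_const (√L))
        refine h2.congr_deriv ?_
        simp [neg_div]
      · intro u hu
        have hne : 0 < z - u := by linarith [hu.2]
        have h2 : ∫ x in u..(z - z * E), Φ x ≤ ∫ x in u..(z - z * E), L * (z - x) := by
          refine intervalIntegral.integral_mono_on hu.2 (h.cont.intervalIntegrable _ _)
            ((by fun_prop : Continuous fun x => L * (z - x)).intervalIntegrable _ _) fun x hx => ?_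
          rw [hΦ x ⟨hu.1.trans hx.1, hx.2⟩]
          exact hfL x ⟨hu.1.trans hx.1, by linarith [hx.2]⟩
        have h3 : ∫ x in u..(z - z * E), L * (z - x) = L * ((z - u) ^ 2 - (z * E) ^ 2) / 2 := by
          rw [intervalIntegral.integral_const_mul,
            intervalIntegral.integral_comp_sub_left (fun x => x) z, integral_id]
          ring
        rw [potential_sub h.cont]
        have h4 : 2 * (∫ x in u..(z - z * E), Φ x) ≤ L * (z - u) ^ 2 := by
          rw [h3] at h2
          nlinarith [mul_pos hL0 (pow_pos hzE 2)]
        have h5 : (1 / (z - u) / √L) ^ 2 = 1 / (L * (z - u) ^ 2) := by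
          rw [div_pow, div_pow, Real.sq_sqrt hL0.le, one_pow, div_div, mul_comm]
        rw [h5, one_div_mul_eq_div, div_le_one (by positivity)]
        exact h4
  · have hpos : ∀ u : ℝ, 0 < u → 0 < f u := by
      intro u hu
      by_contra hneg
      have h1 : Tendsto (slope f 0) (𝓝[>] 0) (𝓝 1) :=
        (hasDerivAt_iff_tendsto_slope.1 hf.deriv).mono_left
          (nhdsWithin_mono _ fun x hx => ne_of_gt hx)
      obtain ⟨e, he, he'⟩ :=
        ((h1.eventually (lt_mem_nhds zero_lt_one)).and (Ioo_mem_nhdsGT hu)).exists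
      rw [slope_def_field, hf.zero, sub_zero, sub_zero] at he
      have hfe : 0 < f e := by
        have := mul_pos he he'.1
        rwa [div_mul_cancel₀ _ he'.1.ne'] at this
      obtain ⟨z, hz, hfz⟩ := intermediate_value_Icc' he'.2.le hf.cont.continuousOn
        (show (0 : ℝ) ∈ Icc (f u) (f e) from ⟨not_lt.1 hneg, hfe.le⟩)
      exact hz' ⟨z, he'.1.trans_le hz.1, hfz⟩
    -- On `[v, 2v]` the speed is then at most `√(4 ε v²) = v / Λ`, so crossing this interval takes
    -- at least `Λ`.
    set ε := 1 / (4 * Λ ^ 2) with hε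
    have hε0 : 0 < ε := by positivity
    obtain ⟨v, hv, hfv⟩ := hf.small ε hε0
    refine ⟨2 * v, by linarith, hpos _ (by linarith), fun Φ h hΦ => ?_⟩
    have h1 := h.sub_le_archTime (u₀ := v) (M := 2 * v) hv.le (by linarith)
      (Ψ := fun u => Λ / v * u) (Ψ' := fun _ => Λ / v) ?_ ?_
    · refine le_trans (le_of_eq ?_) h1
      field_simp
      ring
    · intro u _
      simpa using (hasDerivAt_id u).const_mul (Λ / v)
    · intro u hu
      have h2 : ∫ x in u..(2 * v), Φ x ≤ ∫ x in u..(2 * v), ε * x := by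
        refine intervalIntegral.integral_mono_on hu.2 (h.cont.intervalIntegrable _ _)
          ((by fun_prop : Continuous fun x => ε * x).intervalIntegrable _ _) fun x hx => ?_
        have hvx : v ≤ x := hu.1.trans hx.1
        rw [hΦ x ⟨by linarith, hx.2⟩]
        rcases hvx.eq_or_lt with h' | h'
        · rw [← h']; exact hfv
        · have := hf.anti v x hv h'
          have h3 : f x * v ≤ ε * x * v := by nlinarith
          exact le_of_mul_le_mul_right h3 hv
      rw [intervalIntegral.integral_const_mul, integral_id] at h2
      rw [potential_sub h.cont]
      have h4 : 2 * (∫ x in u..(2 * v), Φ x) ≤ ε * (4 * v ^ 2) := by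
        nlinarith [mul_nonneg hε0.le (sq_nonneg u)]
      have h5 : (Λ / v) ^ 2 * (ε * (4 * v ^ 2)) = 1 := by
        rw [hε]; field_simp
      rw [← h5]
      exact mul_le_mul_of_nonneg_left h4 (sq_nonneg _)

/-! ### Regularity and classification of strong solutions -/

theorem MemH2H10.apply_zero {u : ℝ → ℝ} (h : MemH2H10 u) : u 0 = 0 := h.eq_zero 0 (by simp)

theorem MemH2H10.apply_one {u : ℝ → ℝ} (h : MemH2H10 u) : u 1 = 0 := h.eq_zero 1 (by simp)

/-- `(u, v)` solves the first order system `u' = v`, `v' = -μ Φ(u)` on `[0,1]`. -/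
structure IsSystemSolution (μ : ℝ) (Φ u v : ℝ → ℝ) : Prop where
  left : ∀ x ∈ Icc (0 : ℝ) 1, HasDerivWithinAt u (v x) (Icc 0 1) x
  right : ∀ x ∈ Icc (0 : ℝ) 1, HasDerivWithinAt v (-(μ * Φ (u x))) (Icc 0 1) x

/-- The absolutely continuous `u'` is the integral of `u''`, which equals a continuous function
almost everywhere; hence `u'` is differentiable and the equation holds at every point of `[0,1]`. -/
theorem IsStrongSolution.isSystemSolution {c lam : ℝ} {f u : ℝ → ℝ} (hf : Continuous f)
    (hc : c ≠ 0) (hu : IsStrongSolution c lam f u) :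
    IsSystemSolution (lam / c) f u (derivI u) := by
  obtain ⟨hmem, heq⟩ := hu
  refine ⟨fun x hx => (hmem.differentiableOn x hx).hasDerivWithinAt, ?_⟩
  set g : ℝ → ℝ := fun x => -(lam / c * f (u (projIcc 0 1 zero_le_one x))) with hg
  have hgc : Continuous g := by
    have h1 : Continuous fun x : Icc (0 : ℝ) 1 => u x :=
      continuousOn_iff_continuous_domRestrict.1 hmem.differentiableOn.continuousOn
    exact (continuous_const.mul (hf.comp (h1.comp continuous_projIcc))).neg
  have hgx : ∀ x ∈ Icc (0 : ℝ) 1, g x = -(lam / c * f (u x)) := fun x hx => by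
    simp only [hg, projIcc_of_mem zero_le_one hx]
  have hint : ∀ y ∈ Icc (0 : ℝ) 1, derivI u y = derivI u 0 + ∫ x in (0 : ℝ)..y, g x := by
    intro y hy
    have h1 := (hmem.absolutelyContinuous.mono (c := 0) (d := y) (by
      rw [uIcc_of_le hy.1, uIcc_of_le zero_le_one]
      exact Icc_subset_Icc_right hy.2)).integral_deriv_eq_sub
    have h2 : ∫ x in (0 : ℝ)..y, deriv (derivI u) x = ∫ x in (0 : ℝ)..y, g x := by
      refine intervalIntegral.integral_congr_ae ?_
      rw [Measure.restrict_congr_set Ioo_ae_eq_Ioc, ae_restrict_iff' measurableSet_Ioc] at heq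
      filter_upwards [heq] with x hx hxy
      rw [uIoc_of_le hy.1] at hxy
      have h3 := hx ⟨hxy.1, hxy.2.trans hy.2⟩
      rw [hgx x ⟨hxy.1.le, hxy.2.trans hy.2⟩]
      field_simp
      linarith
    rw [← h2, h1]; ring
  intro x hx
  have h3 : HasDerivAt (fun y => derivI u 0 + ∫ x in (0 : ℝ)..y, g x) (g x) x :=
    (hasDerivAt_potential hgc x).const_add _
  rw [← hgx x hx]
  exact h3.hasDerivWithinAt.congr hint (hint x hx)

theorem IsSystemSolution.continuousOn_left {μ : ℝ} {Φ u v : ℝ → ℝ}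
    (h : IsSystemSolution μ Φ u v) : ContinuousOn u (Icc 0 1) :=
  fun x hx => (h.left x hx).continuousWithinAt

theorem IsSystemSolution.congr {μ : ℝ} {Φ Φ' u v : ℝ → ℝ} (h : IsSystemSolution μ Φ u v)
    (hΦ : ∀ x ∈ Icc (0 : ℝ) 1, Φ (u x) = Φ' (u x)) : IsSystemSolution μ Φ' u v :=
  ⟨h.left, fun x hx => by rw [← hΦ x hx]; exact h.right x hx⟩

theorem IsSystemSolution.eqOn {μ : ℝ} {Φ u₁ v₁ u₂ v₂ : ℝ → ℝ} {C : NNReal}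
    (hΦ : LipschitzWith C Φ) (h₁ : IsSystemSolution μ Φ u₁ v₁) (h₂ : IsSystemSolution μ Φ u₂ v₂)
    {x₀ : ℝ} (hx₀ : x₀ ∈ Ico (0 : ℝ) 1) (hu : u₁ x₀ = u₂ x₀) (hv : v₁ x₀ = v₂ x₀) :
    EqOn u₁ u₂ (Icc 0 1) := by
  have hfield : LipschitzWith (max 1 (Real.nnabs μ * C))
      fun p : ℝ × ℝ => (p.2, -(μ * Φ p.1)) := by
    refine LipschitzWith.prodMk LipschitzWith.prod_snd (LipschitzWith.of_dist_le_mul fun p q => ?_)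
    have h1 := hΦ.dist_le_mul p.1 q.1
    rw [Real.dist_eq] at h1 ⊢
    have h2 : -(μ * Φ p.1) - -(μ * Φ q.1) = -(μ * (Φ p.1 - Φ q.1)) := by ring
    rw [h2, abs_neg, abs_mul, NNReal.coe_mul, Real.coe_nnabs, mul_assoc]
    refine mul_le_mul_of_nonneg_left (h1.trans ?_) (abs_nonneg _)
    exact mul_le_mul_of_nonneg_left (le_max_left _ _) C.2
  have hd₁ : ∀ t ∈ Icc (0 : ℝ) 1, HasDerivWithinAt (fun t => (u₁ t, v₁ t))
      (v₁ t, -(μ * Φ (u₁ t))) (Icc 0 1) t := fun t ht => (h₁.left t ht).prodMk (h₁.right t ht)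
  have hd₂ : ∀ t ∈ Icc (0 : ℝ) 1, HasDerivWithinAt (fun t => (u₂ t, v₂ t))
      (v₂ t, -(μ * Φ (u₂ t))) (Icc 0 1) t := fun t ht => (h₂.left t ht).prodMk (h₂.right t ht)
  have hc₁ : ContinuousOn (fun t => (u₁ t, v₁ t)) (Icc 0 1) :=
    fun t ht => (hd₁ t ht).continuousWithinAt
  have hc₂ : ContinuousOn (fun t => (u₂ t, v₂ t)) (Icc 0 1) :=
    fun t ht => (hd₂ t ht).continuousWithinAt
  have hinit : (fun t => (u₁ t, v₁ t)) x₀ = (fun t => (u₂ t, v₂ t)) x₀ := by simp [hu, hv]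
  have key : EqOn (fun t => (u₁ t, v₁ t)) (fun t => (u₂ t, v₂ t)) (Icc 0 1) := by
    rcases hx₀.1.eq_or_lt with h0 | h0
    · subst h0
      exact ODE_solution_unique (v := fun _ p => (p.2, -(μ * Φ p.1))) (fun _ => hfield) hc₁
        (fun t ht => (hd₁ t (Ico_subset_Icc_self ht)).mono_of_mem_nhdsWithin
          (Icc_mem_nhdsGE_of_mem ht)) hc₂
        (fun t ht => (hd₂ t (Ico_subset_Icc_self ht)).mono_of_mem_nhdsWithin
          (Icc_mem_nhdsGE_of_mem ht)) hinit
    · exact ODE_solution_unique_of_mem_Icc (v := fun _ p => (p.2, -(μ * Φ p.1)))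
        (s := fun _ => univ) (fun _ _ => hfield.lipschitzOnWith) ⟨h0, hx₀.2⟩ hc₁
        (fun t ht => (hd₁ t (Ioo_subset_Icc_self ht)).hasDerivAt (Icc_mem_nhds ht.1 ht.2))
        (fun _ _ => trivial) hc₂
        (fun t ht => (hd₂ t (Ioo_subset_Icc_self ht)).hasDerivAt (Icc_mem_nhds ht.1 ht.2))
        (fun _ _ => trivial) hinit
  intro x hx
  exact congrArg Prod.fst (key hx)

theorem IsSystemSolution.energy {μ : ℝ} {Φ u v : ℝ → ℝ} (hΦ : Continuous Φ)
    (h : IsSystemSolution μ Φ u v) {x : ℝ} (hx : x ∈ Icc (0 : ℝ) 1) :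
    v x ^ 2 / 2 + μ * potential Φ (u x) = v 0 ^ 2 / 2 + μ * potential Φ (u 0) := by
  have hd : ∀ x ∈ Icc (0 : ℝ) 1, HasDerivWithinAt
      (fun x => v x ^ 2 / 2 + μ * potential Φ (u x)) 0 (Icc 0 1) x := by
    intro x hx
    have h1 := ((h.right x hx).pow 2).div_const 2
    have h2 := ((hasDerivAt_potential hΦ (u x)).comp_hasDerivWithinAt x (h.left x hx)).const_mul μ
    refine (h1.add h2).congr_deriv ?_
    simp; ring
  exact constant_of_has_deriv_right_zero (fun x hx => (hd x hx).continuousWithinAt)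
    (fun x hx => (hd x (Ico_subset_Icc_self hx)).mono_of_mem_nhdsWithin
      (Icc_mem_nhdsGE_of_mem hx)) x hx

theorem IsStrongSolution.neg {c lam : ℝ} {f u : ℝ → ℝ} (hu : IsStrongSolution c lam f u) :
    IsStrongSolution c lam (oddReflect f) (-u) := by
  have hd : derivI (-u) = -derivI u := by
    funext x; exact derivWithin.neg
  have hdd : deriv (-derivI u) = -deriv (derivI u) := by funext x; exact deriv.neg
  obtain ⟨⟨h1, h2, h3, h4⟩, h5⟩ := hu
  refine ⟨⟨fun x hx => by simp [h1 x hx], h2.neg, by rw [hd]; exact h3.neg, ?_⟩, ?_⟩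
  · rw [hd, hdd]; exact h4.neg
  · rw [hd, hdd]
    filter_upwards [h5] with x hx
    simp only [Pi.neg_apply, oddReflect, neg_neg]
    linarith

/-- At the maximum `u' = 0`, so energy conservation makes the potential at `u x₀` at least that at
every value in `[0, u x₀]`, all of which are attained; hence `f (u x₀) ≥ 0`. If it were `0`, the
constant `u x₀` would solve the same Cauchy problem, contradicting `u 0 = 0`. -/
theorem IsStrongSolution.reaction_max_pos {c lam : ℝ} {f u : ℝ → ℝ} (hf : Reaction f)
    (hc : 0 < c) (hlam : 0 < lam) (hu : IsStrongSolution c lam f u) {x₀ : ℝ}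
    (hx₀ : x₀ ∈ Icc (0 : ℝ) 1) (hmax : IsMaxOn u (Icc 0 1) x₀) (hpos : 0 < u x₀) :
    0 < f (u x₀) := by
  have hμ : 0 < lam / c := div_pos hlam hc
  have hs := hu.isSystemSolution hf.pos.cont hc.ne'
  have hu0 := hu.1.apply_zero
  have h0 : 0 < x₀ := lt_of_le_of_ne hx₀.1 fun h => by rw [← h, hu0] at hpos; exact hpos.false
  have h1 : x₀ < 1 := lt_of_le_of_ne hx₀.2 fun h => by
    rw [h, hu.1.apply_one] at hpos; exact hpos.false
  have hnhds : Icc (0 : ℝ) 1 ∈ 𝓝 x₀ := Icc_mem_nhds h0 h1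
  have hv0 : derivI u x₀ = 0 :=
    (hmax.isLocalMax hnhds).hasDerivAt_eq_zero ((hs.left x₀ hx₀).hasDerivAt hnhds)
  have hFle : ∀ τ ∈ Icc 0 (u x₀), potential f τ ≤ potential f (u x₀) := by
    intro τ hτ
    have hivt := intermediate_value_Icc hx₀.1 (hs.continuousOn_left.mono
      (Icc_subset_Icc_right hx₀.2))
    rw [hu0] at hivt
    obtain ⟨x, hx, rfl⟩ := hivt hτ
    have e1 := hs.energy hf.pos.cont ⟨hx.1, hx.2.trans hx₀.2⟩
    have e2 := hs.energy hf.pos.cont hx₀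
    rw [hv0] at e2
    have e3 : lam / c * potential f (u x) ≤ lam / c * potential f (u x₀) := by
      nlinarith [sq_nonneg (derivI u x)]
    exact le_of_mul_le_mul_left e3 hμ
  have hge : 0 ≤ f (u x₀) := by
    have h2 : Tendsto (slope (potential f) (u x₀)) (𝓝[<] (u x₀)) (𝓝 (f (u x₀))) :=
      (hasDerivAt_iff_tendsto_slope.1 (hasDerivAt_potential hf.pos.cont (u x₀))).mono_left
        (nhdsWithin_mono _ fun x hx => ne_of_lt hx)
    refine ge_of_tendsto h2 ?_
    filter_upwards [Ioo_mem_nhdsLT hpos] with τ hτ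
    rw [slope_def_field]
    exact div_nonneg_of_nonpos (by linarith [hFle τ ⟨hτ.1.le, hτ.2.le⟩]) (by linarith [hτ.2])
  refine hge.lt_of_ne' fun hzero => ?_
  obtain ⟨B, hB⟩ := isCompact_Icc.exists_bound_of_continuousOn hs.continuousOn_left
  have hB0 : 0 ≤ B := (norm_nonneg _).trans (hB x₀ hx₀)
  -- Truncation exactly at the range of `u` (with slack below) supplies the Lipschitz constant for
  -- uniqueness; no sign of `f` at the levels is needed.
  obtain ⟨C, hC⟩ := hf.exists_lipschitzWith_truncate (N := B + 1) (by linarith) hpos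
  have hs' : IsSystemSolution (lam / c) (truncate f (B + 1) (u x₀)) u (derivI u) := by
    refine hs.congr fun x hx => (truncate_eq ⟨?_, hmax hx⟩).symm
    have := hB x hx
    rw [Real.norm_eq_abs, abs_le] at this
    linarith [this.1]
  have hconst : IsSystemSolution (lam / c) (truncate f (B + 1) (u x₀)) (fun _ => u x₀)
      fun _ => 0 := by
    refine ⟨fun x _ => hasDerivWithinAt_const _ _ _, fun x _ => ?_⟩
    rw [truncate_eq ⟨by linarith, le_rfl⟩, hzero, mul_zero, neg_zero]
    exact hasDerivWithinAt_const _ _ _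
  have := hs'.eqOn hC hconst ⟨h0.le, h1⟩ rfl hv0 (left_mem_Icc.2 zero_le_one)
  rw [hu0] at this
  exact hpos.ne this

theorem HalfReaction.exists_pos {f : ℝ → ℝ} (hf : HalfReaction f) : ∃ M, 0 < M ∧ 0 < f M := by
  obtain ⟨M, h1, h2, -⟩ := hf.exists_long_arch one_pos
  exact ⟨M, h1, h2⟩

theorem IsStrongSolution.exists_upper_bound {c lam : ℝ} {f u : ℝ → ℝ} (hf : Reaction f)
    (hc : 0 < c) (hlam : 0 < lam) (hu : IsStrongSolution c lam f u) :
    ∃ M, 0 < M ∧ 0 < f M ∧ ∀ x ∈ Icc (0 : ℝ) 1, u x ≤ M := by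
  have hs := hu.isSystemSolution hf.pos.cont hc.ne'
  obtain ⟨x₀, hx₀, hmax⟩ := isCompact_Icc.exists_isMaxOn (nonempty_Icc.2 zero_le_one)
    hs.continuousOn_left
  rcases le_or_gt (u x₀) 0 with h | h
  · obtain ⟨M, h1, h2⟩ := hf.pos.exists_pos
    exact ⟨M, h1, h2, fun x hx => (hmax hx).trans (h.trans h1.le)⟩
  · exact ⟨u x₀, h, hu.reaction_max_pos hf hc hlam hx₀ hmax h, fun x hx => hmax hx⟩

theorem IsStrongSolution.exists_bounds {c lam : ℝ} {f u : ℝ → ℝ} (hf : Reaction f)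
    (hc : 0 < c) (hlam : 0 < lam) (hu : IsStrongSolution c lam f u) :
    ∃ N M, 0 < N ∧ 0 < M ∧ f (-N) < 0 ∧ 0 < f M ∧ ∀ x ∈ Icc (0 : ℝ) 1, u x ∈ Icc (-N) M := by
  obtain ⟨M, hM, hfM, h1⟩ := hu.exists_upper_bound hf hc hlam
  obtain ⟨N, hN, hfN, h2⟩ := hu.neg.exists_upper_bound hf.reflect hc hlam
  refine ⟨N, M, hN, hM, by simpa [oddReflect] using hfN, hfM, fun x hx => ⟨?_, h1 x hx⟩⟩
  have := h2 x hx
  simp only [Pi.neg_apply] at this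
  linarith

theorem IsForce.isSystemSolution_orbit {Φ : ℝ → ℝ} (h : IsForce Φ) (S : ℝ) {μ ν : ℝ}
    (hμ : ν ^ 2 = μ) : IsSystemSolution μ Φ (fun x => orbit Φ S (ν * x))
      fun x => ν * (S * Real.cos (phase Φ S (ν * x))) := by
  constructor
  · intro x _
    have h1 := (h.hasDerivAt_orbit S (ν * x)).comp x ((hasDerivAt_id x).const_mul ν)
    rw [mul_one, mul_comm] at h1
    exact h1.hasDerivWithinAt
  · intro x _
    have h1 := ((h.hasDerivAt_velocity S (ν * x)).comp x
      ((hasDerivAt_id x).const_mul ν)).const_mul ν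
    have h2 : ν * (-Φ (orbit Φ S (ν * x)) * (ν * 1)) = -(μ * Φ (orbit Φ S (ν * x))) := by
      rw [← hμ]; ring
    rw [h2] at h1
    exact h1.hasDerivWithinAt

/-- With `ν = √(lam / c)`, `u` and the orbit of amplitude `S = u'(0) / ν` run at speed `ν` have the
same Cauchy data at `0`. The condition `u 1 = 0` puts the phase at time `ν` at a multiple of `π`. -/
theorem IsStrongSolution.eq_nodalSolution {c lam : ℝ} {f u Φ : ℝ → ℝ} (hf : Continuous f)
    (hc : 0 < c) (hlam : 0 < lam) (hu : IsStrongSolution c lam f u) (hne : u ≠ 0)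
    (h : IsForce Φ) (hΦ : ∀ x ∈ Icc (0 : ℝ) 1, f (u x) = Φ (u x)) :
    ∃ (S : ℝ) (j : ℕ), S ≠ 0 ∧ 0 < j ∧ c * nodalTime Φ S j ^ 2 = lam ∧
      u = nodalSolution Φ S j := by
  have hμ : 0 < lam / c := div_pos hlam hc
  set ν := √(lam / c) with hν
  have hν0 : 0 < ν := Real.sqrt_pos.2 hμ
  have hνsq : ν ^ 2 = lam / c := Real.sq_sqrt hμ.le
  have hs := (hu.isSystemSolution hf hc.ne').congr hΦ
  obtain ⟨C, hC⟩ := h.lip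
  set S := derivI u 0 / ν with hS
  have hEq : EqOn u (fun x => orbit Φ S (ν * x)) (Icc 0 1) := by
    refine hs.eqOn hC (h.isSystemSolution_orbit S hνsq) ⟨le_rfl, zero_lt_one⟩ ?_ ?_
    · simp [hu.1.apply_zero, orbit, h.phase_zero, h.energyInv_zero]
    · simp only [mul_zero, h.phase_zero, Real.cos_zero, mul_one, hS]
      field_simp
  have hS0 : S ≠ 0 := by
    intro h0
    refine hne (funext fun x => ?_)
    by_cases hx : x ∈ Icc (0 : ℝ) 1
    · rw [hEq hx]
      simp [h0, orbit, h.energyInv_zero]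
    · exact hu.1.eq_zero x fun hx' => hx (Ioo_subset_Icc_self hx')
  have h1 := hEq (right_mem_Icc.2 zero_le_one)
  rw [hu.1.apply_one] at h1
  simp only [mul_one, orbit] at h1
  rw [eq_comm, h.energyInv_eq_zero, mul_eq_zero, or_iff_right hS0, Real.sin_eq_zero_iff] at h1
  obtain ⟨n, hn⟩ := h1
  have hphase : 0 < phase Φ S ν := by
    have := h.strictMono_phase S hν0
    rwa [h.phase_zero] at this
  have hn0 : 0 < n := by
    rw [← hn] at hphase
    exact_mod_cast pos_of_mul_pos_left hphase Real.pi_pos.le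
  lift n to ℕ using hn0.le
  have hT : nodalTime Φ S n = ν := by
    rw [nodalTime, ← h.phaseTime_phase S ν, ← hn]
    norm_cast
  refine ⟨S, n, hS0, by exact_mod_cast hn0, ?_, ?_⟩
  · rw [hT, hνsq]; field_simp
  · funext x
    by_cases hx : x ∈ Icc (0 : ℝ) 1
    · rw [hEq hx, h.nodalSolution_eq S n hx, hT]
    · have hx' : x ∉ Ioo (0 : ℝ) 1 := fun hx' => hx (Ioo_subset_Icc_self hx')
      rw [hu.1.eq_zero x hx', nodalSolution, if_neg hx']

theorem IsForce.energyInv_mem_of_nodalSolution_mem {Φ : ℝ → ℝ} (h : IsForce Φ) {S : ℝ} {j : ℕ}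
    (hj : 0 < j) {s : Set ℝ} (hs : ∀ x ∈ Icc (0 : ℝ) 1, nodalSolution Φ S j x ∈ s) :
    ∀ η ∈ Icc (0 : ℝ) (j * Real.pi), energyInv Φ (S * Real.sin η) ∈ s := by
  intro η hη
  have hT := h.nodalTime_pos S hj
  have h1 := (h.strictMono_phaseTime S).monotone hη.1
  rw [phaseTime_zero] at h1
  have hx : phaseTime Φ S η / nodalTime Φ S j ∈ Icc (0 : ℝ) 1 :=
    ⟨div_nonneg h1 hT.le, (div_le_one hT).2 ((h.strictMono_phaseTime S).monotone hη.2)⟩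
  have h2 := hs _ hx
  rwa [h.nodalSolution_eq S j hx, mul_div_cancel₀ _ hT.ne', orbit, h.phase_phaseTime] at h2

/-! ### Symmetries and monotonicity of the `L^p` norm -/

theorem integral_comp_sin_of_even {G : ℝ → ℝ} (hG : Continuous G) (heven : Function.Even G)
    (S : ℝ) (j : ℕ) : ∫ η in (0 : ℝ)..(j * Real.pi), G (S * Real.sin η) =
      2 * j * ∫ η in (0 : ℝ)..(Real.pi / 2), G (S * Real.sin η) := by
  have hc : Continuous fun η => G (S * Real.sin η) := hG.comp (by fun_prop)
  have hper : Function.Periodic (fun η => G (S * Real.sin η)) Real.pi := fun η => by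
    simp only [Real.sin_add_pi, mul_neg]
    exact heven _
  have h1 := hper.intervalIntegral_add_zsmul_eq j 0 (fun _ _ => hc.intervalIntegrable _ _)
  simp only [zero_add, natCast_zsmul, nsmul_eq_mul] at h1
  have h2 : ∫ η in (Real.pi / 2)..Real.pi, G (S * Real.sin η) =
      ∫ η in (0 : ℝ)..(Real.pi / 2), G (S * Real.sin η) := by
    have := intervalIntegral.integral_comp_sub_left (a := 0) (b := Real.pi / 2)
      (fun η => G (S * Real.sin η)) Real.pi
    simp only [Real.sin_pi_sub, sub_zero, sub_half] at this
    exact this.symm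
  rw [h1, ← intervalIntegral.integral_add_adjacent_intervals (hc.intervalIntegrable 0 (Real.pi / 2))
    (hc.intervalIntegrable _ _), h2]
  ring

theorem functional_neg {l : (ℝ → ℝ) → ℝ} (hl : IsH10Functional l ∨ IsLpFunctional l)
    (u : ℝ → ℝ) : l (-u) = l u := by
  have hd : derivI (-u) = -derivI u := by
    funext x; exact derivWithin.neg
  rcases hl with ⟨r, hr, hl⟩ | ⟨p, r, hp, hr, hl⟩
  · simp [hl, h10Norm, hd]
  · simp [hl, lpNormI]

namespace IsForce

variable {Φ : ℝ → ℝ}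

theorem energyInvDeriv_neg (h : IsForce Φ) (hodd : oddReflect Φ = Φ) (y : ℝ) :
    energyInvDeriv Φ (-y) = energyInvDeriv Φ y := by
  rw [← h.energyInvDeriv_oddReflect, hodd]

theorem abs_energyInv_neg (h : IsForce Φ) (hodd : oddReflect Φ = Φ) (y : ℝ) :
    |energyInv Φ (-y)| = |energyInv Φ y| := by
  have := h.energyInv_oddReflect y
  rw [hodd] at this
  rw [this, abs_neg]

theorem sin_sub_of_even {j : ℕ} (hj : Even j) (η : ℝ) :
    Real.sin (j * Real.pi - η) = -Real.sin η := by
  rw [Real.sin_sub, Real.sin_nat_mul_pi, Real.cos_nat_mul_pi, hj.neg_one_pow]; ring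

theorem cos_sub_of_even {j : ℕ} (hj : Even j) (η : ℝ) :
    Real.cos (j * Real.pi - η) = Real.cos η := by
  rw [Real.cos_sub, Real.sin_nat_mul_pi, Real.cos_nat_mul_pi, hj.neg_one_pow]; ring

theorem nodalTime_neg_of_even (S : ℝ) {j : ℕ} (hj : Even j) :
    nodalTime Φ (-S) j = nodalTime Φ S j := by
  have := intervalIntegral.integral_comp_sub_left (a := 0) (b := j * Real.pi)
    (fun η => energyInvDeriv Φ (S * Real.sin η)) (j * Real.pi)
  simp only [sin_sub_of_even hj, sub_zero, sub_self] at this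
  rw [nodalTime, nodalTime, phaseTime, phaseTime, ← this]
  simp

theorem h10Norm_nodalSolution_neg_of_even (h : IsForce Φ) (S : ℝ) {j : ℕ} (hj : Even j)
    (hj0 : 0 < j) : h10Norm (nodalSolution Φ (-S) j) = h10Norm (nodalSolution Φ S j) := by
  have := intervalIntegral.integral_comp_sub_left (a := 0) (b := j * Real.pi)
    (fun η => (S * Real.cos η) ^ 2 * energyInvDeriv Φ (S * Real.sin η)) (j * Real.pi)
  simp only [sin_sub_of_even hj, cos_sub_of_even hj, sub_zero, sub_self] at this
  rw [h10Norm, h10Norm, h.integral_derivI_sq_nodalSolution _ hj0,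
    h.integral_derivI_sq_nodalSolution _ hj0, nodalTime_neg_of_even S hj, ← this]
  simp

/-- At phase `arcsin (r sin η)` the orbit of amplitude `S` is where the orbit of amplitude `r S` is
at phase `η`. The more energetic orbit is faster at each position, so it arrives no later. -/
theorem phaseTime_arcsin_le (h : IsForce Φ) {S r : ℝ} (hr : 0 ≤ r) (hr1 : r < 1) {η : ℝ}
    (hη : η ∈ Icc 0 (Real.pi / 2)) :
    phaseTime Φ S (Real.arcsin (r * Real.sin η)) ≤ phaseTime Φ (r * S) η := by
  have hlt : ∀ x : ℝ, |r * Real.sin x| < 1 := fun x => by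
    rw [abs_mul, abs_of_nonneg hr]
    exact (mul_le_of_le_one_right hr (Real.abs_sin_le_one x)).trans_lt hr1
  have hd : ∀ x : ℝ, HasDerivAt
      (fun x => phaseTime Φ (r * S) x - phaseTime Φ S (Real.arcsin (r * Real.sin x)))
      (energyInvDeriv Φ (r * S * Real.sin x) - energyInvDeriv Φ (r * S * Real.sin x) *
        (1 / √(1 - (r * Real.sin x) ^ 2) * (r * Real.cos x))) x := by
    intro x
    have h1 := abs_lt.1 (hlt x)
    have h2 := (h.hasDerivAt_phaseTime S (Real.arcsin (r * Real.sin x))).comp x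
      ((Real.hasDerivAt_arcsin h1.1.ne' h1.2.ne).comp x ((Real.hasDerivAt_sin x).const_mul r))
    rw [Real.sin_arcsin h1.1.le h1.2.le] at h2
    refine ((h.hasDerivAt_phaseTime (r * S) x).sub h2).congr_deriv ?_
    rw [show S * (r * Real.sin x) = r * S * Real.sin x by ring]
  have hmono : Monotone
      fun x => phaseTime Φ (r * S) x - phaseTime Φ S (Real.arcsin (r * Real.sin x)) := by
    refine monotone_of_hasDerivAt_nonneg hd fun x => ?_
    have h1 : 0 < 1 - (r * Real.sin x) ^ 2 := by
      have := (sq_lt_one_iff_abs_lt_one _).2 (hlt x)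
      linarith
    have h2 : r * Real.cos x ≤ √(1 - (r * Real.sin x) ^ 2) := by
      refine Real.le_sqrt_of_sq_le ?_
      have : (r * Real.cos x) ^ 2 = r ^ 2 - (r * Real.sin x) ^ 2 := by
        rw [mul_pow, mul_pow, Real.cos_sq']; ring
      rw [this]
      have : r ^ 2 ≤ 1 := pow_le_one₀ hr hr1.le
      linarith
    have h3 : 1 / √(1 - (r * Real.sin x) ^ 2) * (r * Real.cos x) ≤ 1 := by
      rw [one_div_mul_eq_div]
      exact (div_le_one (Real.sqrt_pos.2 h1)).2 h2
    have h4 := mul_le_of_le_one_right (h.energyInvDeriv_pos (r * S * Real.sin x)).le h3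
    simp only [Pi.zero_apply]
    linarith
  have h5 := hmono hη.1
  simp only [Real.sin_zero, mul_zero, Real.arcsin_zero, phaseTime_zero, sub_zero] at h5
  linarith

/-- At the same fraction of its longer quarter period, the larger orbit has had at least as much
time and needs no more of it to reach the position of the smaller one, so it lies above. -/
theorem quarter_orbit_le (h : IsForce Φ) {S r : ℝ} (hS : 0 ≤ S) (hr : 0 ≤ r) (hr1 : r < 1)
    (hT : phaseTime Φ (r * S) (Real.pi / 2) ≤ phaseTime Φ S (Real.pi / 2)) {x : ℝ}
    (hx : x ∈ Icc (0 : ℝ) 1) :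
    0 ≤ orbit Φ (r * S) (phaseTime Φ (r * S) (Real.pi / 2) * x) ∧
      orbit Φ (r * S) (phaseTime Φ (r * S) (Real.pi / 2) * x) ≤
      orbit Φ S (phaseTime Φ S (Real.pi / 2) * x) := by
  have hπ := Real.pi_pos
  have hmem : ∀ S, phase Φ S (phaseTime Φ S (Real.pi / 2) * x) ∈ Icc 0 (Real.pi / 2) := by
    intro S
    have h0 := (h.strictMono_phaseTime S).monotone (by positivity : 0 ≤ Real.pi / 2)
    rw [phaseTime_zero] at h0
    constructor
    · have := (h.strictMono_phase S).monotone (mul_nonneg h0 hx.1)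
      rwa [h.phase_zero] at this
    · have := (h.strictMono_phase S).monotone (mul_le_of_le_one_right h0 hx.2)
      rwa [h.phase_phaseTime] at this
  set η := phase Φ (r * S) (phaseTime Φ (r * S) (Real.pi / 2) * x) with hη
  have hη' := hmem (r * S)
  have hsin : 0 ≤ Real.sin η := Real.sin_nonneg_of_nonneg_of_le_pi hη'.1 (by linarith [hη'.2])
  have h1 := h.phaseTime_arcsin_le (S := S) hr hr1 hη'
  rw [h.phaseTime_phase, ← hη] at h1
  have h2 : Real.arcsin (r * Real.sin η) ≤ phase Φ S (phaseTime Φ S (Real.pi / 2) * x) := by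
    rw [← (h.strictMono_phaseTime S).le_iff_le, h.phaseTime_phase]
    exact h1.trans (mul_le_mul_of_nonneg_right hT hx.1)
  have hsin1 := Real.sin_le_one η
  have h3 : r * Real.sin η ≤ Real.sin (phase Φ S (phaseTime Φ S (Real.pi / 2) * x)) := by
    rw [← Real.sin_arcsin (x := r * Real.sin η) (by nlinarith) (by nlinarith)]
    exact Real.sin_le_sin_of_le_of_le_pi_div_two (Real.neg_pi_div_two_le_arcsin _)
      (hmem S).2 h2
  constructor
  · rw [← h.energyInv_zero]
    exact h.strictMono_energyInv.monotone (mul_nonneg (mul_nonneg hr hS) hsin)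
  · refine h.strictMono_energyInv.monotone ?_
    rw [← hη, mul_comm r S, mul_assoc]
    exact mul_le_mul_of_nonneg_left h3 hS

/-- For an odd force all quarter waves contribute equally, so both the integral and the total time
carry the factor `2 j`, which cancels. -/
theorem integral_abs_rpow_eq_quarter (h : IsForce Φ) (hodd : oddReflect Φ = Φ) (S : ℝ) {j : ℕ}
    (hj : 0 < j) {p : ℝ} (hp : 0 ≤ p) : ∫ x in (0 : ℝ)..1, |nodalSolution Φ S j x| ^ p =
      ∫ x in (0 : ℝ)..1, |orbit Φ S (phaseTime Φ S (Real.pi / 2) * x)| ^ p := by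
  have hpow : Continuous fun y => |energyInv Φ y| ^ p :=
    h.continuous_energyInv.abs.rpow_const fun _ => Or.inr hp
  have h1 := h.integral_comp_phase S (b := Real.pi / 2) (by positivity)
    (G := fun η => |energyInv Φ (S * Real.sin η)| ^ p) (hpow.comp (by fun_prop))
  have h2 := integral_comp_sin_of_even
    (G := fun y => |energyInv Φ y| ^ p * energyInvDeriv Φ y)
    (hpow.mul h.continuous_energyInvDeriv)
    (fun y => by simp only [h.energyInvDeriv_neg hodd, h.abs_energyInv_neg hodd]) S j
  have h3 := integral_comp_sin_of_even (G := energyInvDeriv Φ) h.continuous_energyInvDeriv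
    (h.energyInvDeriv_neg hodd) S j
  have hj' : (2 * j : ℝ) ≠ 0 := by positivity
  rw [h.integral_abs_rpow_nodalSolution S hj hp, h2, nodalTime, phaseTime, h3,
    mul_div_mul_left _ _ hj']
  exact h1.symm

theorem nodalSolution_neg (h : IsForce Φ) (hodd : oddReflect Φ = Φ) (S : ℝ) (j : ℕ) :
    nodalSolution Φ (-S) j = -nodalSolution Φ S j := by
  have e : ∀ η, phaseTime Φ (-S) η = phaseTime Φ S η := fun η => by
    simp only [phaseTime, neg_mul, h.energyInvDeriv_neg hodd]
  have e' : phase Φ (-S) = phase Φ S := by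
    rw [phase, phase, funext e]
  have e'' : ∀ y, energyInv Φ (-y) = -energyInv Φ y := fun y => by
    have := h.energyInv_oddReflect y
    rw [hodd] at this
    rw [this, neg_neg]
  funext x
  simp only [nodalSolution, orbit, nodalTime, e, e', neg_mul, e'', Pi.neg_apply]
  split_ifs <;> simp

end IsForce

theorem Reaction.lpNormI_nodalSolution_le {f Φ : ℝ → ℝ} (hf : Reaction f) (h : IsForce Φ)
    (hodd : oddReflect Φ = Φ) {N M : ℝ} (hN : 0 ≤ N) (hM : 0 ≤ M)
    (hΦ : ∀ u ∈ Icc (-N) M, Φ u = f u) {S r : ℝ} {j : ℕ} (hj : 0 < j) (hS : 0 ≤ S)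
    (hSM : ∀ η ∈ Icc (0 : ℝ) (j * Real.pi), energyInv Φ (S * Real.sin η) ∈ Icc (-N) M)
    (hr : 0 ≤ r) (hr1 : r < 1) {p : ℝ} (hp : 0 ≤ p) :
    lpNormI p (nodalSolution Φ (r * S) j) ≤ lpNormI p (nodalSolution Φ S j) := by
  have hπ := Real.pi_pos
  have hj1 : (1 : ℝ) ≤ j := by exact_mod_cast hj
  have hT : phaseTime Φ (r * S) (Real.pi / 2) ≤ phaseTime Φ S (Real.pi / 2) := by
    refine intervalIntegral.integral_mono_on (by positivity)
      ((h.continuous_phaseDensity _).intervalIntegrable _ _)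
      ((h.continuous_phaseDensity _).intervalIntegrable _ _) fun η hη => ?_
    rw [mul_assoc]
    exact hf.energyInvDeriv_le h hN hM hΦ (hSM η ⟨hη.1, by nlinarith [hη.2]⟩) hr hr1.le
  rw [lpNormI, lpNormI, h.integral_abs_rpow_eq_quarter hodd _ hj hp,
    h.integral_abs_rpow_eq_quarter hodd _ hj hp]
  have hc : ∀ S, Continuous fun x => |orbit Φ S (phaseTime Φ S (Real.pi / 2) * x)| ^ p :=
    fun S => ((h.continuous_orbit S).comp (by fun_prop)).abs.rpow_const fun _ => Or.inr hp
  refine Real.rpow_le_rpow (intervalIntegral.integral_nonneg zero_le_one fun x _ => by positivity)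
    (intervalIntegral.integral_mono_on zero_le_one ((hc _).intervalIntegrable _ _)
      ((hc _).intervalIntegrable _ _) fun x hx => ?_) (by positivity)
  obtain ⟨h0, h1⟩ := h.quarter_orbit_le hS hr hr1 hT hx
  exact Real.rpow_le_rpow (abs_nonneg _) (abs_le_abs_of_nonneg h0 h1) hp

/-! ### The nonlocal problem -/

/-- The inequality is strict at `d`, so by continuity of `a` it persists slightly beyond `d`. -/
theorem lt_dSup {a : ℝ → ℝ} (ha : ContinuousOn a (Ici 0)) {lam d : ℝ} {j : ℕ} (hd : 0 ≤ d)
    (h : ∀ e ∈ Icc 0 d, a e * Real.pi ^ 2 * (j : ℝ) ^ 2 < lam) : (d : EReal) < dSup a lam j := by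
  have h1 : ContinuousWithinAt (fun e => a e * Real.pi ^ 2 * (j : ℝ) ^ 2) (Ici d) d :=
    (((ha d hd).mono (Ici_subset_Ici.2 hd)).mul_const _).mul_const _
  have h2 : {e | a e * Real.pi ^ 2 * (j : ℝ) ^ 2 < lam} ∈ 𝓝[≥] d :=
    h1.eventually (gt_mem_nhds (h d ⟨hd, le_rfl⟩))
  obtain ⟨b, hb, hsub⟩ := mem_nhdsGE_iff_exists_Icc_subset.1 h2
  refine lt_of_lt_of_le (EReal.coe_lt_coe_iff.2 hb) (le_sSup ⟨b, ⟨hd.trans hb.le, ?_⟩, rfl⟩)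
  intro e he
  rcases le_total e d with h3 | h3
  · exact h e ⟨he.1, h3⟩
  · exact hsub ⟨h3, he.2⟩

theorem units_cast_eq (σ : ℤˣ) : ((σ : ℤ) : ℝ) = 1 ∨ ((σ : ℤ) : ℝ) = -1 := by
  rcases Int.units_eq_one_or σ with rfl | rfl <;> simp

theorem IsForce.phaseTime_pi_le_nodalTime {Φ : ℝ → ℝ} (h : IsForce Φ) (S : ℝ) {j : ℕ}
    (hj : 0 < j) : phaseTime Φ S Real.pi ≤ nodalTime Φ S j := by
  have hj1 : (1 : ℝ) ≤ j := by exact_mod_cast hj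
  exact (h.strictMono_phaseTime S).monotone (by nlinarith [Real.pi_pos])

/-- The second half-wave has the opposite sign, so from `j = 2` on it is one of the arches. -/
theorem IsForce.phaseTime_neg_pi_le_nodalTime {Φ : ℝ → ℝ} (h : IsForce Φ) (S : ℝ) {j : ℕ}
    (hj : 2 ≤ j) : phaseTime Φ (-S) Real.pi ≤ nodalTime Φ S j := by
  have hj1 : (2 : ℝ) ≤ j := by exact_mod_cast hj
  have h1 := (h.strictMono_phaseTime S).monotone
    (by nlinarith [Real.pi_pos] : Real.pi + Real.pi ≤ j * Real.pi)
  have h2 := h.phaseTime_sub S Real.pi (Real.pi + Real.pi)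
  have h3 := intervalIntegral.integral_comp_add_right (a := 0) (b := Real.pi)
    (fun η => energyInvDeriv Φ (S * Real.sin η)) Real.pi
  rw [zero_add] at h3
  have h4 := (h.strictMono_phaseTime S).monotone Real.pi_pos.le
  rw [phaseTime_zero] at h4
  have h5 : phaseTime Φ (-S) Real.pi =
      ∫ η in (0 : ℝ)..Real.pi, energyInvDeriv Φ (S * Real.sin (η + Real.pi)) := by
    simp [phaseTime, Real.sin_add_pi]
  rw [h5, h3, ← h2]
  rw [nodalTime]
  linarith

/-- Let `P`, `Q` be the energy amplitudes of long arches on the positive and negative side. For `j =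
1` only one side is visited and its own amplitude can be used. For `j ≥ 2` both are visited, so
amplitudes are capped by `min P Q`; whichever arch realises the minimum is among the first two. -/
theorem Reaction.exists_force_long {f : ℝ → ℝ} (hf : Reaction f) {Λ : ℝ} (hΛ : 0 < Λ) {j : ℕ}
    (hj : 0 < j) {c : ℝ} (hc : c = 1 ∨ c = -1) :
    ∃ (Φ : ℝ → ℝ) (s₁ : ℝ), IsForce Φ ∧ 0 < s₁ ∧ Λ ≤ nodalTime Φ (c * s₁) j ∧
      ∀ s ∈ Icc 0 s₁, ∀ η ∈ Icc (0 : ℝ) (j * Real.pi),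
        Φ (energyInv Φ (c * s * Real.sin η)) = f (energyInv Φ (c * s * Real.sin η)) := by
  obtain ⟨M, hM, hfM, hlong⟩ := hf.pos.exists_long_arch hΛ
  obtain ⟨N, hN, hfN, hlong'⟩ := hf.neg.exists_long_arch hΛ
  have hfN' : f (-N) < 0 := by simpa [oddReflect] using hfN
  set Φ := truncate f N M with hΦ
  have h : IsForce Φ := hf.isForce_truncate hN hM hfN' hfM
  have hΦf : ∀ u ∈ Icc (-N) M, Φ u = f u := fun u hu => truncate_eq hu
  set P := energyCoord Φ M with hP
  set Q := energyCoord (oddReflect Φ) N with hQ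
  have hP0 : 0 < P := h.half.energyCoord_pos h.cont hM
  have hQ0 : 0 < Q := h.half_neg.energyCoord_pos h.reflect.cont hN
  have hPlong : Λ ≤ phaseTime Φ P Real.pi :=
    hlong Φ h fun u hu => hΦf u ⟨by linarith [hu.1], hu.2⟩
  have hQlong : Λ ≤ phaseTime Φ (-Q) Real.pi := by
    have h1 := hlong' (oddReflect Φ) h.reflect fun u hu => by
      simp only [oddReflect]
      rw [hΦf (-u) ⟨by linarith [hu.2], by linarith [hu.1]⟩]
    simpa only [phaseTime, h.energyInvDeriv_oddReflect, neg_mul, ← hQ] using h1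
  have hle : ∀ y, -Q ≤ y → y ≤ P →
      Φ (energyInv Φ y) = f (energyInv Φ y) := by
    intro y hy1 hy2
    refine hΦf _ ⟨?_, ?_⟩
    · have h1 := h.strictMono_energyInv.monotone hy1
      rwa [hQ, energyCoord_oddReflect, neg_neg, h.energyInv_energyCoord] at h1
    · have h1 := h.strictMono_energyInv.monotone hy2
      rwa [hP, h.energyInv_energyCoord] at h1
  rcases (Nat.succ_le_iff.2 hj).eq_or_lt with h1 | h1
  · have hsin : ∀ η ∈ Icc (0 : ℝ) (j * Real.pi), 0 ≤ Real.sin η := by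
      intro η hη
      rw [← h1] at hη
      exact Real.sin_nonneg_of_nonneg_of_le_pi hη.1 (by simpa using hη.2)
    rcases hc with rfl | rfl
    · refine ⟨Φ, P, h, hP0, ?_, fun s hs η hη => hle _ ?_ ?_⟩
      · rw [one_mul]; exact hPlong.trans (h.phaseTime_pi_le_nodalTime P hj)
      · have := mul_nonneg hs.1 (hsin η hη)
        linarith
      · have := mul_le_of_le_one_right hs.1 (Real.sin_le_one η)
        linarith [hs.2]
    · refine ⟨Φ, Q, h, hQ0, ?_, fun s hs η hη => hle _ ?_ ?_⟩
      · rw [neg_one_mul]; exact hQlong.trans (h.phaseTime_pi_le_nodalTime (-Q) hj)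
      · have := mul_le_of_le_one_right hs.1 (Real.sin_le_one η)
        linarith [hs.2]
      · have := mul_nonneg hs.1 (hsin η hη)
        linarith
  · have hb : ∀ s ∈ Icc 0 (min P Q), ∀ η, |c * s * Real.sin η| ≤ min P Q := by
      intro s hs η
      have hc1 : |c| = 1 := by rcases hc with rfl | rfl <;> simp
      rw [abs_mul, abs_mul, hc1, one_mul, abs_of_nonneg hs.1]
      exact (mul_le_of_le_one_right hs.1 (Real.abs_sin_le_one η)).trans hs.2
    refine ⟨Φ, min P Q, h, lt_min hP0 hQ0, ?_, fun s hs η hη => hle _ ?_ ?_⟩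
    · have h2 : ∀ s, phaseTime Φ s Real.pi ≤ nodalTime Φ (c * s) j := by
        intro s
        rcases hc with rfl | rfl
        · rw [one_mul]; exact h.phaseTime_pi_le_nodalTime s hj
        · have := h.phaseTime_neg_pi_le_nodalTime (-1 * s) h1
          rwa [neg_one_mul, neg_neg, ← neg_one_mul] at this
      have h3 : ∀ s, phaseTime Φ (-s) Real.pi ≤ nodalTime Φ (c * s) j := by
        intro s
        rcases hc with rfl | rfl
        · rw [one_mul]; exact h.phaseTime_neg_pi_le_nodalTime s h1
        · rw [neg_one_mul]; exact h.phaseTime_pi_le_nodalTime (-s) hj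
      rcases le_total P Q with h4 | h4
      · rw [min_eq_left h4]; exact hPlong.trans (h2 P)
      · rw [min_eq_right h4]; exact hQlong.trans (h3 Q)
    · linarith [(abs_le.1 (hb s hs η)).1, min_le_right P Q]
    · linarith [(abs_le.1 (hb s hs η)).2, min_le_left P Q]

theorem exists_branch {f a : ℝ → ℝ} {lam : ℝ} {l : (ℝ → ℝ) → ℝ} (hf : Reaction f)
    (ha : IsDiffusionCoefficient a) (hlam : 0 < lam) (hl : IsH10Functional l ∨ IsLpFunctional l)
    {j : ℕ} (hj : 0 < j) (hj0 : a 0 * Real.pi ^ 2 * (j : ℝ) ^ 2 < lam) (σ : ℤˣ) :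
    ∃ d : ℝ, 0 ≤ d ∧ (d : EReal) < dSup a lam j ∧
      ∃ u : ℝ → ℝ, IsBranch a lam f d σ j u ∧ l u = d := by
  obtain ⟨hac, m, hm, ham⟩ := ha
  have hπ := Real.pi_pos
  have hc := units_cast_eq σ
  set c : ℝ := ((σ : ℤ) : ℝ) with hcdef
  -- Time `√(lam / m)` suffices, because `a ≥ m` then gives `a T² ≥ lam` whatever the value of `l`.
  obtain ⟨Φ, s₁, h, hs₁, hlong, hrange⟩ :=
    hf.exists_force_long (Real.sqrt_pos.2 (div_pos hlam hm)) hj hc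
  set L : ℝ → ℝ := fun s => l (nodalSolution Φ (c * s) j) with hL
  set T : ℝ → ℝ := fun s => nodalTime Φ (c * s) j with hT
  have hLc : Continuous L := (h.continuous_functional_nodalSolution hl hj).comp
    (continuous_const.mul continuous_id)
  have hTc : Continuous T := (h.continuous_nodalTime j).comp (continuous_const.mul continuous_id)
  have hL0 : ∀ s, 0 ≤ L s := fun s => functional_nonneg hl _
  have hGc : Continuous fun s => a (L s) * T s ^ 2 :=
    (hac.comp_continuous hLc hL0).mul (hTc.pow 2)
  have hLzero : L 0 = 0 := by
    simp only [hL, mul_zero, h.nodalSolution_zero_left]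
    exact functional_zero hl
  have hTzero : T 0 = j * Real.pi := by
    simp only [hT, mul_zero, h.nodalTime_zero_left]
  have hc0 : c ≠ 0 := by rcases hc with hc | hc <;> rw [hc] <;> norm_num
  have hTlt : ∀ s, 0 < s → j * Real.pi < T s := fun s hs =>
    h.lt_nodalTime (mul_ne_zero hc0 hs.ne') hj
  have hG0 : a (L 0) * T 0 ^ 2 < lam := by
    rw [hLzero, hTzero]
    linarith [show a 0 * (j * Real.pi) ^ 2 = a 0 * Real.pi ^ 2 * (j : ℝ) ^ 2 by ring]
  have hG1 : lam ≤ a (L s₁) * T s₁ ^ 2 := by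
    have h1 : (√(lam / m)) ^ 2 ≤ T s₁ ^ 2 := pow_le_pow_left₀ (Real.sqrt_nonneg _) hlong 2
    rw [Real.sq_sqrt (div_pos hlam hm).le, div_le_iff₀ hm] at h1
    have h2 : m * T s₁ ^ 2 ≤ a (L s₁) * T s₁ ^ 2 :=
      mul_le_mul_of_nonneg_right (ham _ (hL0 _)) (sq_nonneg _)
    linarith
  have hcomp : IsCompact {s | s ∈ Icc 0 s₁ ∧ lam ≤ a (L s) * T s ^ 2} :=
    isCompact_Icc.inter_right (isClosed_le continuous_const hGc)
  -- The first parameter at which `a(L) T²` reaches `lam`; leastness is what yields `L t < d_j`.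
  obtain ⟨t, ⟨ht, hGt⟩, hleast⟩ := hcomp.exists_isLeast ⟨s₁, ⟨hs₁.le, le_rfl⟩, hG1⟩
  have ht0 : 0 < t := lt_of_le_of_ne ht.1 fun h0 => by
    rw [← h0] at hGt; exact hGt.not_gt hG0
  have hGeq : a (L t) * T t ^ 2 = lam := by
    obtain ⟨s, hs, hse⟩ := intermediate_value_Icc ht.1 hGc.continuousOn
      (show lam ∈ Icc (a (L 0) * T 0 ^ 2) (a (L t) * T t ^ 2) from ⟨hG0.le, hGt⟩)
    have h1 : t ≤ s := hleast ⟨⟨hs.1, hs.2.trans ht.2⟩, hse.ge⟩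
    rw [le_antisymm h1 hs.2]
    exact hse
  -- `L` need not be monotone, but each `e ≤ L t` is `L s` for some `s ≤ t`. For `s < t`, `a(e)
  -- (jπ)² ≤ a(L s) T(s)² < lam`; for `s = t`, strictness comes from `T t > jπ`.
  have hbelow : ∀ e ∈ Icc 0 (L t), a e * Real.pi ^ 2 * (j : ℝ) ^ 2 < lam := by
    intro e he
    have hivt := intermediate_value_Icc ht.1 hLc.continuousOn
    rw [hLzero] at hivt
    obtain ⟨s, hs, rfl⟩ := hivt he
    have hpos : 0 < a (L s) := hm.trans_le (ham _ (hL0 s))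
    have hrw : a (L s) * Real.pi ^ 2 * (j : ℝ) ^ 2 = a (L s) * (j * Real.pi) ^ 2 := by ring
    have hjπ : 0 ≤ j * Real.pi := by positivity
    rw [hrw]
    rcases hs.2.eq_or_lt with h1 | h1
    · rw [h1] at hpos ⊢
      rw [← hGeq]
      exact mul_lt_mul_of_pos_left (pow_lt_pow_left₀ (hTlt t ht0) hjπ two_ne_zero) hpos
    · have h2 : a (L s) * T s ^ 2 < lam := by
        by_contra hcon
        exact h1.not_ge (hleast ⟨⟨hs.1, hs.2.trans ht.2⟩, not_lt.1 hcon⟩)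
      refine lt_of_le_of_lt (mul_le_mul_of_nonneg_left (pow_le_pow_left₀ hjπ ?_ 2) hpos.le) h2
      rcases hs.1.eq_or_lt with h3 | h3
      · rw [← h3, hTzero]
      · exact (hTlt s h3).le
  refine ⟨L t, hL0 t, lt_dSup hac (hL0 t) hbelow, nodalSolution Φ (c * t) j, ?_, rfl⟩
  refine h.isBranch_nodalSolution hj ?_ hGeq (hrange t ht)
  have : c * (c * t) = t := by rcases hc with hc | hc <;> rw [hc] <;> ring
  rw [← hcdef, this]
  exact ht0

/-! ### Admissible zero numbers and uniqueness for non-decreasing diffusion. -/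

theorem IsStrongSolution.lt_of_ncard_zerosI {c lam : ℝ} {f u : ℝ → ℝ} (hf : Reaction f)
    (hc : 0 < c) (hlam : 0 < lam) (hu : IsStrongSolution c lam f u) {j : ℕ}
    (hj : (zerosI u).ncard = j + 1) : c * Real.pi ^ 2 * (j : ℝ) ^ 2 < lam := by
  have hne : u ≠ 0 := by
    rintro rfl
    have : zerosI 0 = Icc (0 : ℝ) 1 := by ext x; simp [zerosI]
    -- The zero function has infinitely many zeros, and `ncard` of an infinite set is `0`, never `j
    -- + 1`.
    rw [this, (Icc_infinite zero_lt_one).ncard] at hj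
    omega
  obtain ⟨N, M, hN, hM, hfN, hfM, hr⟩ := hu.exists_bounds hf hc hlam
  have h := hf.isForce_truncate hN hM hfN hfM
  obtain ⟨S, i, hS, hi, hT, rfl⟩ := hu.eq_nodalSolution hf.pos.cont hc hlam hne h
    fun x hx => (truncate_eq (hr x hx)).symm
  rw [h.ncard_zerosI_nodalSolution hS hi] at hj
  obtain rfl : i = j := by omega
  rw [← hT]
  have := pow_lt_pow_left₀ (h.lt_nodalTime hS hi) (by positivity) two_ne_zero
  calc c * Real.pi ^ 2 * (i : ℝ) ^ 2 = c * (i * Real.pi) ^ 2 := by ring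
    _ < _ := mul_lt_mul_of_pos_left this hc

theorem isNonlocalSolution_zero {f a : ℝ → ℝ} {lam : ℝ} {l : (ℝ → ℝ) → ℝ} (hf : f 0 = 0) :
    IsNonlocalSolution a l lam f 0 := by
  have hd : derivI 0 = 0 := by funext x; simp [derivI]
  have hdd : deriv (0 : ℝ → ℝ) = 0 := by funext x; simp
  refine ⟨⟨fun x _ => rfl, differentiableOn_const 0, ?_, ?_⟩, ?_⟩
  · rw [hd]
    exact (LipschitzWith.const (0 : ℝ)).lipschitzOnWith.absolutelyContinuousOnInterval
  · rw [hd, hdd]; exact MemLp.zero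
  · rw [hd, hdd]
    exact Eventually.of_forall fun x => by simp [hf]

theorem oddReflect_eq_self {f : ℝ → ℝ} (hf : Function.Odd f) : oddReflect f = f := by
  funext u; simp [oddReflect, hf u]

/-- Two solutions can be compared by amplitude only as orbits of the same truncated force. For odd
`f` the levels are taken symmetric, which keeps the truncation odd. -/
theorem exists_common_bounds {c₁ c₂ lam : ℝ} {f u₁ u₂ : ℝ → ℝ} (hf : Reaction f)
    (hc₁ : 0 < c₁) (hc₂ : 0 < c₂) (hlam : 0 < lam) (hu₁ : IsStrongSolution c₁ lam f u₁)
    (hu₂ : IsStrongSolution c₂ lam f u₂) :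
    ∃ N M, 0 < N ∧ 0 < M ∧ f (-N) < 0 ∧ 0 < f M ∧ (Function.Odd f → N = M) ∧
      (∀ x ∈ Icc (0 : ℝ) 1, u₁ x ∈ Icc (-N) M) ∧ ∀ x ∈ Icc (0 : ℝ) 1, u₂ x ∈ Icc (-N) M := by
  obtain ⟨N₁, M₁, hN₁, hM₁, hfN₁, hfM₁, h₁⟩ := hu₁.exists_bounds hf hc₁ hlam
  obtain ⟨N₂, M₂, hN₂, hM₂, hfN₂, hfM₂, h₂⟩ := hu₂.exists_bounds hf hc₂ hlam
  have hN : f (-(max N₁ N₂)) < 0 := by rcases max_choice N₁ N₂ with h | h <;> rw [h] <;> assumption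
  have hM : 0 < f (max M₁ M₂) := by rcases max_choice M₁ M₂ with h | h <;> rw [h] <;> assumption
  have hN0 : 0 < max N₁ N₂ := lt_max_of_lt_left hN₁
  have hM0 : 0 < max M₁ M₂ := lt_max_of_lt_left hM₁
  have key : ∀ x ∈ Icc (0 : ℝ) 1, u₁ x ∈ Icc (-(max N₁ N₂)) (max M₁ M₂) ∧
      u₂ x ∈ Icc (-(max N₁ N₂)) (max M₁ M₂) := fun x hx =>
    ⟨⟨by linarith [(h₁ x hx).1, le_max_left N₁ N₂], (h₁ x hx).2.trans (le_max_left _ _)⟩,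
      ⟨by linarith [(h₂ x hx).1, le_max_right N₁ N₂], (h₂ x hx).2.trans (le_max_right _ _)⟩⟩
  generalize max N₁ N₂ = N at *
  generalize max M₁ M₂ = M at *
  by_cases hodd : Function.Odd f
  · have hR : 0 < f (max N M) := by
      have hN' : 0 < f N := by rw [hodd N] at hN; linarith
      rcases max_choice N M with h | h <;> rw [h] <;> assumption
    have hsub : Icc (-N) M ⊆ Icc (-(max N M)) (max N M) :=
      Icc_subset_Icc (neg_le_neg (le_max_left _ _)) (le_max_right _ _)
    exact ⟨max N M, max N M, lt_max_of_lt_left hN0, lt_max_of_lt_left hN0,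
      by rw [hodd]; linarith, hR, fun _ => rfl, fun x hx => hsub (key x hx).1,
      fun x hx => hsub (key x hx).2⟩
  · exact ⟨N, M, hN0, hM0, hN, hM, fun h => absurd h hodd, fun x hx => (key x hx).1,
      fun x hx => (key x hx).2⟩

theorem Reaction.functional_nodalSolution_le {f Φ : ℝ → ℝ} {l : (ℝ → ℝ) → ℝ} (hf : Reaction f)
    (h : IsForce Φ) (hl : IsH10Functional l ∨ (IsLpFunctional l ∧ oddReflect Φ = Φ)) {N M : ℝ}
    (hN : 0 ≤ N) (hM : 0 ≤ M) (hΦ : ∀ u ∈ Icc (-N) M, Φ u = f u) {S r : ℝ} {j : ℕ} (hj : 0 < j)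
    (hSM : ∀ η ∈ Icc (0 : ℝ) (j * Real.pi), energyInv Φ (S * Real.sin η) ∈ Icc (-N) M)
    (hr : 0 ≤ r) (hr1 : r < 1) : l (nodalSolution Φ (r * S) j) ≤ l (nodalSolution Φ S j) := by
  rcases hl with ⟨q, hq, hl⟩ | ⟨hl', hodd⟩
  · rw [hl, hl]
    exact Real.rpow_le_rpow (Real.sqrt_nonneg _)
      (hf.h10Norm_nodalSolution_le h hN hM hΦ hj hSM hr hr1.le) hq.le
  · have hneg := functional_neg (Or.inr hl')
    obtain ⟨p, q, hp, hq, hl⟩ := hl'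
    have hnn : ∀ u, 0 ≤ lpNormI p u := fun u => Real.rpow_nonneg
      (intervalIntegral.integral_nonneg zero_le_one fun x _ => by positivity) _
    have hinv : ∀ y, energyInv Φ (-y) = -energyInv Φ y := fun y => by
      have := h.energyInv_oddReflect y
      rw [hodd] at this
      rw [this, neg_neg]
    rcases le_total 0 S with hS | hS
    · rw [hl, hl]
      exact Real.rpow_le_rpow (hnn _) (hf.lpNormI_nodalSolution_le h hodd hN hM hΦ hj hS hSM hr hr1
        (by linarith)) hq.le
    · have hΦ' : ∀ u ∈ Icc (-M) N, Φ u = oddReflect f u := fun u hu => by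
        rw [← hodd, oddReflect, oddReflect, hΦ _ ⟨by linarith [hu.2], by linarith [hu.1]⟩]
      have hSM' : ∀ η ∈ Icc (0 : ℝ) (j * Real.pi),
          energyInv Φ (-S * Real.sin η) ∈ Icc (-M) N := fun η hη => by
        have := hSM η hη
        rw [neg_mul, hinv]
        exact ⟨by linarith [this.2], by linarith [this.1]⟩
      rw [← hneg, ← hneg (nodalSolution Φ S j), ← h.nodalSolution_neg hodd,
        ← h.nodalSolution_neg hodd, ← mul_neg, hl, hl]
      exact Real.rpow_le_rpow (hnn _) (hf.reflect.lpNormI_nodalSolution_le h hodd hM hN hΦ' hj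
        (by linarith) hSM' hr hr1 (by linarith)) hq.le

theorem IsForce.sign_of_eventually {Φ : ℝ → ℝ} (h : IsForce Φ) {S : ℝ} {j : ℕ} (hS : S ≠ 0)
    (hj : 0 < j) {σ : ℤˣ}
    (hσ : ∀ᶠ x in 𝓝[>] (0 : ℝ), 0 < ((σ : ℤ) : ℝ) * nodalSolution Φ S j x) :
    0 < ((σ : ℤ) : ℝ) * S := by
  by_contra hcon
  have hne : ((σ : ℤ) : ℝ) * S ≠ 0 := by
    rcases units_cast_eq σ with h1 | h1 <;> rw [h1] <;> simpa using hS
  have h1 : 0 < (((-σ : ℤˣ) : ℤ) : ℝ) * S := by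
    push_cast
    rw [neg_mul]
    exact neg_pos.2 (lt_of_le_of_ne (not_lt.1 hcon) hne)
  obtain ⟨x, hx1, hx2⟩ := (hσ.and (h.sign_nodalSolution hj h1)).exists
  push_cast at hx2
  linarith

theorem IsNonlocalSolution.eq_of_ncard_of_sign {f a : ℝ → ℝ} {lam : ℝ} {l : (ℝ → ℝ) → ℝ}
    (hf : Reaction f) (ha : IsDiffusionCoefficient a) (hlam : 0 < lam)
    (hl : IsH10Functional l ∨ (IsLpFunctional l ∧ Function.Odd f)) (hmono : MonotoneOn a (Ici 0))
    {u₁ u₂ : ℝ → ℝ} (hu₁ : IsNonlocalSolution a l lam f u₁)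
    (hu₂ : IsNonlocalSolution a l lam f u₂) (hne₁ : u₁ ≠ 0) (hne₂ : u₂ ≠ 0)
    (hcard : (zerosI u₁).ncard = (zerosI u₂).ncard) {σ : ℤˣ}
    (hσ₁ : ∀ᶠ x in 𝓝[>] (0 : ℝ), 0 < ((σ : ℤ) : ℝ) * u₁ x)
    (hσ₂ : ∀ᶠ x in 𝓝[>] (0 : ℝ), 0 < ((σ : ℤ) : ℝ) * u₂ x) : u₁ = u₂ := by
  obtain ⟨hac, m, hm, ham⟩ := ha
  have hl' : IsH10Functional l ∨ IsLpFunctional l := hl.imp_right fun h => h.1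
  have hpos : ∀ u, 0 < a (l u) := fun u => hm.trans_le (ham _ (functional_nonneg hl' u))
  obtain ⟨N, M, hN, hM, hfN, hfM, hodd, hr₁, hr₂⟩ :=
    exists_common_bounds hf (hpos u₁) (hpos u₂) hlam hu₁ hu₂
  have hΦ : ∀ u ∈ Icc (-N) M, truncate f N M u = f u := fun u hu => truncate_eq hu
  have h := hf.isForce_truncate hN hM hfN hfM
  have hlΦ : IsH10Functional l ∨
      (IsLpFunctional l ∧ oddReflect (truncate f N M) = truncate f N M) := by
    refine hl.imp_right fun hlo => ⟨hlo.1, ?_⟩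
    rw [oddReflect_truncate hN.le hM.le, oddReflect_eq_self hlo.2, hodd hlo.2]
  generalize truncate f N M = Φ at *
  obtain ⟨S₁, j, hS₁, hj, hT₁, he₁⟩ := hu₁.eq_nodalSolution hf.pos.cont (hpos u₁) hlam hne₁ h
    fun x hx => (hΦ _ (hr₁ x hx)).symm
  obtain ⟨S₂, i, hS₂, hi, hT₂, he₂⟩ := hu₂.eq_nodalSolution hf.pos.cont (hpos u₂) hlam hne₂ h
    fun x hx => (hΦ _ (hr₂ x hx)).symm
  have hij : i = j := by
    rw [he₁, he₂, h.ncard_zerosI_nodalSolution hS₁ hj, h.ncard_zerosI_nodalSolution hS₂ hi] at hcard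
    omega
  subst hij
  rw [he₁] at hσ₁ hr₁ hT₁
  rw [he₂] at hσ₂ hr₂ hT₂
  have hs₁ := h.sign_of_eventually hS₁ hi hσ₁
  have hs₂ := h.sign_of_eventually hS₂ hi hσ₂
  -- Two amplitudes of the same sign, the second strictly smaller in modulus, cannot both give
  -- `lam`: `T` drops strictly and `a(l)` does not increase.
  have key : ∀ S S' : ℝ, S ≠ 0 → (∀ x ∈ Icc (0 : ℝ) 1, nodalSolution Φ S i x ∈ Icc (-N) M) →
      a (l (nodalSolution Φ S i)) * nodalTime Φ S i ^ 2 = lam →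
      a (l (nodalSolution Φ S' i)) * nodalTime Φ S' i ^ 2 = lam →
      0 < S' / S → S' / S < 1 → False := by
    intro S S' hS hr hT hT' hq hq1
    have hSM := h.energyInv_mem_of_nodalSolution_mem hi hr
    have e : S' = S' / S * S := (div_mul_cancel₀ _ hS).symm
    have h1 := hf.nodalTime_lt h hN.le hM.le hΦ hi hS hSM hq.le hq1
    have h2 := hf.functional_nodalSolution_le h hlΦ hN.le hM.le hΦ hi hSM hq.le hq1
    rw [← e] at h1 h2
    have h3 := hmono (functional_nonneg hl' _) (functional_nonneg hl' _) h2
    have h4 := pow_lt_pow_left₀ h1 (h.nodalTime_pos S' hi).le two_ne_zero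
    have h5 : a (l (nodalSolution Φ S' i)) * nodalTime Φ S' i ^ 2 <
        a (l (nodalSolution Φ S i)) * nodalTime Φ S i ^ 2 :=
      lt_of_le_of_lt (mul_le_mul_of_nonneg_right h3 (sq_nonneg _))
        (mul_lt_mul_of_pos_left h4 (hpos _))
    rw [hT, hT'] at h5
    exact h5.false
  have hq : 0 < S₂ / S₁ := by
    have h1 := div_pos hs₂ hs₁
    have hc0 : ((σ : ℤ) : ℝ) ≠ 0 := by rintro h0; rw [h0, zero_mul] at hs₁; exact hs₁.false
    rwa [mul_div_mul_left _ _ hc0] at h1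
  rcases lt_trichotomy (S₂ / S₁) 1 with h1 | h1 | h1
  · exact (key S₁ S₂ hS₁ hr₁ hT₁ hT₂ hq h1).elim
  · rw [he₁, he₂, (div_eq_one_iff_eq hS₁).1 h1]
  · refine (key S₂ S₁ hS₂ hr₂ hT₂ hT₁ ?_ ?_).elim
    · rw [← inv_div]; exact inv_pos.2 hq
    · rw [← inv_div]; exact inv_lt_one_of_one_lt₀ h1

theorem IsNonlocalSolution.exists_sign {f a : ℝ → ℝ} {lam : ℝ} {l : (ℝ → ℝ) → ℝ}
    (hf : Reaction f) (ha : IsDiffusionCoefficient a) (hlam : 0 < lam)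
    (hl : IsH10Functional l ∨ IsLpFunctional l) {u : ℝ → ℝ}
    (hu : IsNonlocalSolution a l lam f u) (hne : u ≠ 0) :
    ∃ (σ : ℤˣ) (j : ℕ), 0 < j ∧ (zerosI u).ncard = j + 1 ∧
      ∀ᶠ x in 𝓝[>] (0 : ℝ), 0 < ((σ : ℤ) : ℝ) * u x := by
  obtain ⟨hac, m, hm, ham⟩ := ha
  have hpos : 0 < a (l u) := hm.trans_le (ham _ (functional_nonneg hl u))
  obtain ⟨N, M, hN, hM, hfN, hfM, hr⟩ := hu.exists_bounds hf hpos hlam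
  have h := hf.isForce_truncate hN hM hfN hfM
  obtain ⟨S, j, hS, hj, -, he⟩ := hu.eq_nodalSolution hf.pos.cont hpos hlam hne h
    fun x hx => (truncate_eq (hr x hx)).symm
  have hcard := h.ncard_zerosI_nodalSolution hS hj
  rw [he]
  rcases hS.lt_or_gt with hS | hS
  · exact ⟨-1, j, hj, hcard, h.sign_nodalSolution hj (by simpa using hS)⟩
  · exact ⟨1, j, hj, hcard, h.sign_nodalSolution hj (by simpa using hS)⟩

/-- For odd `f` the partner is `-u`. Otherwise `j` is even and `l` is the `H¹₀` functional: passing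
from `S` to `-S` amounts to `η ↦ jπ - η`, that is, traversing the solution backwards, which
preserves time and `H¹₀` norm. By uniqueness the two branches then share the same `d`. -/
theorem IsNonlocalSolution.exists_opposite {f a : ℝ → ℝ} {lam : ℝ} {l : (ℝ → ℝ) → ℝ}
    (hf : Reaction f) (ha : IsDiffusionCoefficient a) (hlam : 0 < lam)
    (hl : IsH10Functional l ∨ (IsLpFunctional l ∧ Function.Odd f)) {j : ℕ}
    (hj : Even j ∨ Function.Odd f) {u : ℝ → ℝ} (hu : IsNonlocalSolution a l lam f u) (hne : u ≠ 0)
    (hcard : (zerosI u).ncard = j + 1)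
    (hσ : ∀ᶠ x in 𝓝[>] (0 : ℝ), 0 < ((((1 : ℤˣ) : ℤ) : ℝ)) * u x) :
    ∃ v, IsNonlocalSolution a l lam f v ∧ v ≠ 0 ∧ l v = l u ∧ (zerosI v).ncard = j + 1 ∧
      ∀ᶠ x in 𝓝[>] (0 : ℝ), 0 < ((((-1 : ℤˣ) : ℤ) : ℝ)) * v x := by
  have hl' : IsH10Functional l ∨ IsLpFunctional l := hl.imp_right fun h => h.1
  by_cases hodd : Function.Odd f
  · have hln := functional_neg hl' u
    refine ⟨-u, ?_, neg_ne_zero.2 hne, hln, ?_, ?_⟩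
    · rw [IsNonlocalSolution, hln]
      have := IsStrongSolution.neg hu
      rwa [oddReflect_eq_self hodd] at this
    · simpa [zerosI] using hcard
    · filter_upwards [hσ] with x hx
      simpa using hx
  · have hev := hj.resolve_right hodd
    obtain ⟨r, hr, hlr⟩ := hl.resolve_right fun h => hodd h.2
    obtain ⟨hac, m, hm, ham⟩ := ha
    have hpos : 0 < a (l u) := hm.trans_le (ham _ (functional_nonneg hl' u))
    obtain ⟨N, M, hN, hM, hfN, hfM, hr⟩ := hu.exists_bounds hf hpos hlam
    have h := hf.isForce_truncate hN hM hfN hfM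
    have hΦ : ∀ u ∈ Icc (-N) M, truncate f N M u = f u := fun u hu => truncate_eq hu
    generalize truncate f N M = Φ at *
    obtain ⟨S, i, hS, hi, hT, rfl⟩ := hu.eq_nodalSolution hf.pos.cont hpos hlam hne h
      fun x hx => (hΦ _ (hr x hx)).symm
    rw [h.ncard_zerosI_nodalSolution hS hi] at hcard
    obtain rfl : i = j := by omega
    have hSM := h.energyInv_mem_of_nodalSolution_mem hi hr
    have hs := h.sign_of_eventually hS hi hσ
    have hleq : l (nodalSolution Φ (-S) i) = l (nodalSolution Φ S i) := by
      rw [hlr, hlr, h.h10Norm_nodalSolution_neg_of_even S hev hi]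
    refine ⟨nodalSolution Φ (-S) i, ?_, ?_, hleq,
      h.ncard_zerosI_nodalSolution (neg_ne_zero.2 hS) hi, h.sign_nodalSolution hi ?_⟩
    · rw [IsNonlocalSolution, hleq]
      refine h.isStrongSolution_nodalSolution ?_ fun η hη => hΦ _ ?_
      · rw [IsForce.nodalTime_neg_of_even S hev]; exact hT
      · have := hSM (i * Real.pi - η) ⟨by linarith [hη.2], by linarith [hη.1]⟩
        rwa [IsForce.sin_sub_of_even hev, mul_neg, ← neg_mul] at this
    · intro h0
      have h1 := h.ncard_zerosI_nodalSolution (neg_ne_zero.2 hS) hi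
      have h2 : zerosI 0 = Icc (0 : ℝ) 1 := by ext x; simp [zerosI]
      rw [h0, h2, (Icc_infinite zero_lt_one).ncard] at h1
      omega
    · simpa using hs

theorem hasExactlyCascade_of_monotone {f a : ℝ → ℝ} {lam : ℝ} {k : ℕ} {l : (ℝ → ℝ) → ℝ}
    (hf : Reaction f) (ha : IsDiffusionCoefficient a) (hlam : 0 < lam)
    (hl : IsH10Functional l ∨ (IsLpFunctional l ∧ Function.Odd f))
    (hk : a 0 * Real.pi ^ 2 * (k : ℝ) ^ 2 < lam)
    (hk' : lam ≤ a 0 * Real.pi ^ 2 * ((k : ℝ) + 1) ^ 2) (hmono : MonotoneOn a (Ici 0)) :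
    HasExactlyCascade a l lam f k := by
  have hl' : IsH10Functional l ∨ IsLpFunctional l := hl.imp_right fun h => h.1
  obtain ⟨m, hm, ham⟩ := ha.2
  have ha0 : 0 < a 0 := hm.trans_le (ham 0 le_rfl)
  have hex : ∀ (σ : ℤˣ) (j : ℕ), ∃ (d : ℝ) (u : ℝ → ℝ), j ∈ Finset.Icc 1 k →
      0 ≤ d ∧ (d : EReal) < dSup a lam j ∧ IsBranch a lam f d σ j u ∧ l u = d := by
    intro σ j
    by_cases hj : j ∈ Finset.Icc 1 k
    · rw [Finset.mem_Icc] at hj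
      have hjk : (j : ℝ) ≤ k := by exact_mod_cast hj.2
      have h1 : a 0 * Real.pi ^ 2 * (j : ℝ) ^ 2 < lam := by
        refine lt_of_le_of_lt (mul_le_mul_of_nonneg_left ?_ (by positivity)) hk
        exact pow_le_pow_left₀ (by positivity) hjk 2
      obtain ⟨d, h2, h3, u, h4, h5⟩ := exists_branch hf ha hlam hl' hj.1 h1 σ
      exact ⟨d, u, fun _ => ⟨h2, h3, h4, h5⟩⟩
    · exact ⟨0, 0, fun h => absurd h hj⟩
  choose d u hdu using hex
  have hsol : ∀ σ, ∀ j ∈ Finset.Icc 1 k, IsNonlocalSolution a l lam f (u σ j) := by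
    intro σ j hj
    obtain ⟨-, -, h1, h2⟩ := hdu σ j hj
    rw [IsNonlocalSolution, h2]
    exact h1.solution
  have hne : ∀ σ, ∀ j ∈ Finset.Icc 1 k, u σ j ≠ 0 := by
    intro σ j hj h0
    have h1 := (hdu σ j hj).2.2.1.ncard_zeros
    have h2 : zerosI 0 = Icc (0 : ℝ) 1 := by ext x; simp [zerosI]
    rw [h0, h2, (Icc_infinite zero_lt_one).ncard] at h1
    omega
  have hset : {v : ℝ → ℝ | IsNonlocalSolution a l lam f v} =
      insert 0 {v : ℝ → ℝ | ∃ σ : ℤˣ, ∃ j ∈ Finset.Icc 1 k, v = u σ j} := by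
    ext v
    simp only [mem_ofPred_eq, mem_insert_iff]
    constructor
    · intro hv
      by_cases hv0 : v = 0
      · exact Or.inl hv0
      obtain ⟨σ, j, hj, hcard, hσ⟩ := hv.exists_sign hf ha hlam hl' hv0
      have hpos : 0 < a (l v) := hm.trans_le (ham _ (functional_nonneg hl' v))
      have h1 := IsStrongSolution.lt_of_ncard_zerosI hf hpos hlam hv hcard
      have h2 : a 0 ≤ a (l v) := hmono self_mem_Ici (functional_nonneg hl' v)
        (functional_nonneg hl' v)
      have hjk : j ∈ Finset.Icc 1 k := by
        rw [Finset.mem_Icc]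
        refine ⟨hj, ?_⟩
        by_contra hcon
        have h3 : (k : ℝ) + 1 ≤ j := by exact_mod_cast not_le.1 hcon
        have h4 : a 0 * Real.pi ^ 2 * ((k : ℝ) + 1) ^ 2 ≤ a (l v) * Real.pi ^ 2 * (j : ℝ) ^ 2 := by
          gcongr
        linarith
      refine Or.inr ⟨σ, j, hjk, ?_⟩
      have hb := (hdu σ j hjk).2.2.1
      exact hv.eq_of_ncard_of_sign hf ha hlam hl hmono (hsol σ j hjk) hv0 (hne σ j hjk)
        (hcard.trans hb.ncard_zeros.symm) hσ hb.sign
    · rintro (rfl | ⟨σ, j, hj, rfl⟩)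
      · exact isNonlocalSolution_zero hf.pos.zero
      · exact hsol σ j hj
  -- Zero number and initial sign separate the branches, so the pairs `(σ, j)` count `2 k` distinct
  -- nonzero solutions.
  have hinj : InjOn (fun p : ℤˣ × ℕ => u p.1 p.2)
      ((Finset.univ ×ˢ Finset.Icc 1 k : Finset (ℤˣ × ℕ)) : Set (ℤˣ × ℕ)) := by
    rintro ⟨σ, i⟩ hi ⟨τ, j⟩ hj he
    simp only [Finset.coe_product, Finset.coe_univ, mem_prod, mem_univ, true_and,
      Finset.mem_coe] at hi hj he
    have hbi := (hdu σ i hi).2.2.1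
    have hbj := (hdu τ j hj).2.2.1
    have hij : i = j := by
      have h1 := hbi.ncard_zeros
      rw [he, hbj.ncard_zeros] at h1
      omega
    have hστ : σ = τ := by
      by_contra hcon
      have h1 := hbi.sign
      rw [he, Int.units_ne_iff_eq_neg.1 hcon] at h1
      obtain ⟨x, hx1, hx2⟩ := (h1.and hbj.sign).exists
      push_cast at hx1
      linarith
    rw [hij, hστ]
  refine ⟨d, u, fun σ j hj => hdu σ j hj, fun j hj hsymm => ?_, hset, ?_⟩
  · obtain ⟨-, -, hb, hd⟩ := hdu 1 j hj
    obtain ⟨-, -, hb', hd'⟩ := hdu (-1) j hj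
    obtain ⟨v, hv, hv0, hlv, hvc, hvs⟩ := (hsol 1 j hj).exists_opposite hf ha hlam hl hsymm
      (hne 1 j hj) hb.ncard_zeros hb.sign
    have := hv.eq_of_ncard_of_sign hf ha hlam hl hmono (hsol (-1) j hj) hv0 (hne (-1) j hj)
      (hvc.trans hb'.ncard_zeros.symm) hvs hb'.sign
    rw [← hd, ← hd', ← this, hlv]
  · have himg : {v : ℝ → ℝ | ∃ σ : ℤˣ, ∃ j ∈ Finset.Icc 1 k, v = u σ j} =
        (fun p : ℤˣ × ℕ => u p.1 p.2) ''
          ((Finset.univ ×ˢ Finset.Icc 1 k : Finset (ℤˣ × ℕ)) : Set (ℤˣ × ℕ)) := by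
      ext v
      constructor
      · rintro ⟨σ, j, hj, rfl⟩
        exact ⟨(σ, j), Finset.mem_coe.2 (Finset.mem_product.2 ⟨Finset.mem_univ _, hj⟩), rfl⟩
      · rintro ⟨⟨σ, j⟩, hj, rfl⟩
        exact ⟨σ, j, (Finset.mem_product.1 (Finset.mem_coe.1 hj)).2, rfl⟩
    rw [hset, himg, ncard_insert_of_notMem _ ((Finset.finite_toSet _).image _),
      hinj.ncard_image, ncard_coe_finset, Finset.card_product, Finset.card_univ,
      Fintype.card_units_int, Nat.card_Icc, Nat.add_sub_cancel]
    rintro ⟨⟨σ, j⟩, hj, h0⟩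
    exact hne σ j (Finset.mem_product.1 (Finset.mem_coe.1 hj)).2 h0

end

/-! ### Assembly of the five claims. -/

theorem mainTheorem1 (f a : ℝ → ℝ) (lam : ℝ) (k : ℕ) (l : (ℝ → ℝ) → ℝ)
    (hf : IsChafeeInfanteReaction f) (ha : IsDiffusionCoefficient a) (hlam : 0 < lam)
    (hl : IsH10Functional l ∨ IsLpFunctional l)
    (hk : a 0 * Real.pi ^ 2 * (k : ℝ) ^ 2 < lam) :
    (∀ j ∈ Finset.Icc 1 k, ∀ σ : ℤˣ, ∃ d : ℝ, 0 ≤ d ∧ (d : EReal) < dSup a lam j ∧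
      ∃ u : ℝ → ℝ, IsBranch a lam f d σ j u ∧ l u = d ∧ IsNonlocalSolution a l lam f u) ∧
    (lam ≤ a 0 * Real.pi ^ 2 * ((k : ℝ) + 1) ^ 2 → (∀ s : ℝ, 0 ≤ s → a 0 ≤ a s) →
      ∀ j : ℕ, k < j → ¬ ∃ u : ℝ → ℝ, IsNonlocalSolution a l lam f u ∧
        (zerosI u).ncard = j + 1) ∧
    (∀ N : ℕ, IsLeast {n : ℕ | k ≤ n ∧
        lam ≤ sInf ((fun s : ℝ => a s * Real.pi ^ 2 * ((n : ℝ) + 1) ^ 2) '' Set.Ici 0)} N →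
      ∀ j : ℕ, N < j → ¬ ∃ u : ℝ → ℝ, IsNonlocalSolution a l lam f u ∧
        (zerosI u).ncard = j + 1) ∧
    (IsH10Functional l → lam ≤ a 0 * Real.pi ^ 2 * ((k : ℝ) + 1) ^ 2 →
      MonotoneOn a (Set.Ici 0) → HasExactlyCascade a l lam f k) ∧
    (IsLpFunctional l → lam ≤ a 0 * Real.pi ^ 2 * ((k : ℝ) + 1) ^ 2 → Function.Odd f →
      MonotoneOn a (Set.Ici 0) → HasExactlyCascade a l lam f k) := by
  have hR := hf.reaction
  obtain ⟨m, hm, ham⟩ := ha.2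
  have hpos : ∀ u, 0 < a (l u) := fun u => hm.trans_le (ham _ (functional_nonneg hl u))
  -- Claims 2 and 3 both reduce to this: `lam ≤ a(s) π² (n + 1)²` for every `s ≥ 0` contradicts
  -- `a(l(u)) π² j² < lam` when `j ≥ n + 1`.
  have hnone : ∀ n : ℕ, (∀ s : ℝ, 0 ≤ s → lam ≤ a s * Real.pi ^ 2 * ((n : ℝ) + 1) ^ 2) →
      ∀ j : ℕ, n < j → ¬ ∃ u : ℝ → ℝ, IsNonlocalSolution a l lam f u ∧
        (zerosI u).ncard = j + 1 := by
    rintro n hn j hj ⟨u, hu, hcard⟩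
    have h1 := IsStrongSolution.lt_of_ncard_zerosI hR (hpos u) hlam hu hcard
    have h2 := hn (l u) (functional_nonneg hl u)
    have h3 : (n : ℝ) + 1 ≤ j := by exact_mod_cast hj
    have h4 : a (l u) * Real.pi ^ 2 * ((n : ℝ) + 1) ^ 2 ≤ a (l u) * Real.pi ^ 2 * (j : ℝ) ^ 2 :=
      mul_le_mul_of_nonneg_left (pow_le_pow_left₀ (by positivity) h3 2)
        (mul_nonneg (hpos u).le (sq_nonneg _))
    linarith
  refine ⟨fun j hj σ => ?_, fun hk' hmin => hnone k fun s hs => ?_,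
    fun N hN => hnone N fun s hs => ?_,
    fun hl' hk' hmono => hasExactlyCascade_of_monotone hR ha hlam (Or.inl hl') hk hk' hmono,
    fun hl' hk' hodd hmono =>
      hasExactlyCascade_of_monotone hR ha hlam (Or.inr ⟨hl', hodd⟩) hk hk' hmono⟩
  · rw [Finset.mem_Icc] at hj
    have hjk : (j : ℝ) ≤ k := by exact_mod_cast hj.2
    have ha0 : 0 < a 0 := hm.trans_le (ham 0 le_rfl)
    have h1 : a 0 * Real.pi ^ 2 * (j : ℝ) ^ 2 < lam :=
      lt_of_le_of_lt (mul_le_mul_of_nonneg_left (pow_le_pow_left₀ (by positivity) hjk 2)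
        (by positivity)) hk
    obtain ⟨d, h2, h3, u, h4, h5⟩ := exists_branch hR ha hlam hl hj.1 h1 σ
    refine ⟨d, h2, h3, u, h4, h5, ?_⟩
    rw [IsNonlocalSolution, h5]
    exact h4.solution
  · have := hmin s hs
    refine hk'.trans ?_
    gcongr
  · refine hN.1.2.trans (csInf_le ⟨0, ?_⟩ ⟨s, hs, rfl⟩)
    rintro _ ⟨t, ht, rfl⟩
    have := hm.trans_le (ham t ht)
    positivity
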